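/- **Setting.** Let $X=\mathbb R^{d_1}$, let $Y\subseteq\mathbb R^{d_2}$ be convex and compact with diameter $D(Y)>0$, let $P_Y$ be the Euclidean projection onto $Y$, and consider $\min_{x\in X}\max_{y\in Y} f(x,y)$ with $f=\frac1M\sum_{i=1}^M f_i$, $f_i(x,y)=\mathbb E_{\xi\sim\mathcal D_i}[f_i(x,y;\xi)]$. Assume, for constants $l>0$, $\sigma,\sigma_G,G_y\ge 0$ and all $i$, $x,x'\in X$, $y,y'\in Y$: (1) $f_i$ is differentiable with $\|\nabla f_i(x,y)-\nabla f_i(x',y')\|\le l(\|x-x'\|+\|y-y'\|)$; (2) $\mathbb E[\nabla f_i(x,y;\xi)]=\nabla f_i(x,y)$ and $\mathbb E\|\nabla f_i(x,y;\xi)-\nabla f_i(x,y)\|^2\le\sigma^2$ for $\xi\sim\mathcal D_i$; (3) $\|\nabla f_i(x,y)-\nabla f(x,y)\|^2\le\sigma_G^2$; (4) $\Phi(x)=\max_{y\in Y}f(x,y)$ is bounded below by a finite $\Phi^*$; (5) $|f(x,y)-f(x,y')|\le G_y\|y-y'\|$; (6) $f(x,y)\le f(x,y')+\langle\nabla_y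 f(x,y'),y-y'\rangle$. **Algorithm (FESS-GDA).** Inputs: $x_0,z_0\in X$, $y_0\in Y$, step sizes $\eta_{x,l},\eta_{y,l},\eta_{x,g},\eta_{y,g}>0$, $\beta\in(0,1)$, $p>0$, and integers $T,K\ge1$. In each communication round $t=0,\dots,T-1$ the server draws a uniformly random set $S_t$ of $m$ of the $M$ clients. Each $i\in S_t$ starts from $(x^1_{t,i},y^1_{t,i})=(x_t,y_t)$ and makes $K$ local updates with fresh independent samples $\xi^k_{t,i}\sim\mathcal D_i$, $$x^{k+1}_{t,i}=x^k_{t,i}-\eta_{x,l}\nabla_xf_i(x^k_{t,i},y^k_{t,i};\xi^k_{t,i}),\qquad y^{k+1}_{t,i}=P_Y\big(y^k_{t,i}+\eta_{y,l}\nabla_yf_i(x^k_{t,i},y^k_{t,i};\xi^k_{t,i})\big),$$ and the server sets $$x_{t+1}=x_t-\eta_{x,g}\eta_{x,l}\Big[\tfrac1m\sum_{i\in S_t}\sum_{k=1}^K\nabla_xf_i(x^k_{t,i},y^k_{t,i};\xi^k_{t,i})+Kp(x_t-z_t)\Big],$$ $$y_{t+1}=P_Y\Big(y_t+\eta_{y,g}\eta_{y,l}\tfrac1m\sum_{i\in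 S_t}\sum_{k=1}^K\nabla_yf_i(x^k_{t,i},y^k_{t,i};\xi^k_{t,i})\Big),\qquad z_{t+1}=z_t+\beta(x_{t+1}-z_t).$$ The communication complexity is $T$ and the per-client sample complexity is $KT$. **Theorem.** Let $0<\epsilon\le 2lD(Y)$ and $1\le m\le M$, and suppose that $m=M$ (full participation) or $\sigma_G=0$ (homogeneous data). Then, for suitable step sizes and parameters, FESS-GDA applied to $\tilde f(x,y)=f(x,y)-\frac{\epsilon}{4D(Y)}\|y-y_0\|^2$ (that is, to the losses $f_i(x,y;\xi)-\frac{\epsilon}{4D(Y)}\|y-y_0\|^2$) finds an $\epsilon$-stationary point of $f$ in the mean-square sense: $$\frac1T\sum_{t=0}^{T-1}\mathbb E\Big[\|\nabla_xf(x_t,y_t)\|^2+l^2\big\|P_Y\big(y_t+\tfrac1l\nabla_yf(x_t,y_t)\big)-y_t\big\|^2\Big]\le\epsilon^2,$$ with communication complexity $T=O(\epsilon^{-3})$ and per-client sample complexity $KT=O(m^{-1}\epsilon^{-6})$ (in the range $m\le\epsilon^{-3}$; in general $KT=O(\max\{m^{-1}\epsilon^{-6},\epsilon^{-3}\})$, since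 every round uses at least one sample per participating client). The constants in $O(\cdot)$ depend only on $l,\sigma,\sigma_G,G_y,D(Y)$ and an upper bound $\Delta$ on the initial gap $\Phi(x_0)-\Phi^*+l\|x_0-z_0\|^2$; the step sizes and parameters depend only on these and on $\epsilon,m,M$. -/

import Mathlib

open MeasureTheory ProbabilityTheory

noncomputable section

namespace FedMinimax

/-- The Euclidean space `ℝᵈ`. -/
abbrev Vec (d : ℕ) : Type := EuclideanSpace ℝ (Fin d)

/-- `p` is a point of `Y` that is closest to `y`. -/
def IsNearest {d : ℕ} (Y : Set (Vec d)) (y p : Vec d) : Prop :=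
  p ∈ Y ∧ ∀ v ∈ Y, ‖y - p‖ ≤ ‖y - v‖

open Classical in
/-- The Euclidean projection `P_Y(y) = argmin_{v ∈ Y} ‖y - v‖² / 2`
(it exists and is unique when `Y` is nonempty, closed and convex). -/
def proj {d : ℕ} (Y : Set (Vec d)) (y : Vec d) : Vec d :=
  if h : ∃ p, IsNearest Y y p then h.choose else y

/-- The partial gradient `∇ₓ g(x, y)`. -/
def gradX {d₁ d₂ : ℕ} (g : Vec d₁ → Vec d₂ → ℝ) (x : Vec d₁) (y : Vec d₂) : Vec d₁ :=
  gradient (fun x' => g x' y) x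

/-- The partial gradient `∇_y g(x, y)`. -/
def gradY {d₁ d₂ : ℕ} (g : Vec d₁ → Vec d₂ → ℝ) (x : Vec d₁) (y : Vec d₂) : Vec d₂ :=
  gradient (fun y' => g x y') y

/-- The full gradient `∇g(x, y) = (∇ₓ g(x, y), ∇_y g(x, y))`; its norm is the `ℓ²` norm. -/
def grad {d₁ d₂ : ℕ} (g : Vec d₁ → Vec d₂ → ℝ) (x : Vec d₁) (y : Vec d₂) :
    WithLp 2 (Vec d₁ × Vec d₂) :=
  WithLp.toLp 2 (gradX g x y, gradY g x y)

/-- Data of a federated minimax problem with `M` clients: client `i` has the loss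
`sampleLoss i x y ξ` at a data point `ξ`, and data points drawn from `dist i`. -/
structure Problem (d₁ d₂ M : ℕ) (Ξ : Type*) [MeasurableSpace Ξ] where
  sampleLoss : Fin M → Vec d₁ → Vec d₂ → Ξ → ℝ
  dist : Fin M → ProbabilityMeasure Ξ

section

variable {d₁ d₂ M : ℕ} {Ξ : Type*} [MeasurableSpace Ξ]

namespace Problem

/-- The loss `(x, y) ↦ f_i(x, y; ξ)` at a fixed data point. -/
def atSample (P : Problem d₁ d₂ M Ξ) (i : Fin M) (ξ : Ξ) : Vec d₁ → Vec d₂ → ℝ :=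
  fun x y => P.sampleLoss i x y ξ

/-- The local loss `f_i(x, y) = 𝔼_{ξ ∼ 𝒟_i} f_i(x, y; ξ)`. -/
def localLoss (P : Problem d₁ d₂ M Ξ) (i : Fin M) : Vec d₁ → Vec d₂ → ℝ :=
  fun x y => ∫ ξ, P.sampleLoss i x y ξ ∂(P.dist i : Measure Ξ)

/-- The global loss `f = (1/M) ∑ f_i`. -/
def loss (P : Problem d₁ d₂ M Ξ) : Vec d₁ → Vec d₂ → ℝ :=
  fun x y => (1 / (M : ℝ)) * ∑ i, P.localLoss i x y

/-- `Φ(x) = max_{y ∈ Y} f(x, y)`. -/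
def primal (P : Problem d₁ d₂ M Ξ) (Y : Set (Vec d₂)) (x : Vec d₁) : ℝ :=
  ⨆ y : Y, P.loss x y

/-- The problem with every sample loss (hence every local loss and the global loss)
replaced by itself minus `c ‖y - y₀‖²`. -/
def regularize (P : Problem d₁ d₂ M Ξ) (c : ℝ) (y₀ : Vec d₂) : Problem d₁ d₂ M Ξ where
  sampleLoss := fun i x y ξ => P.sampleLoss i x y ξ - c * ‖y - y₀‖ ^ 2
  dist := P.dist

/-- The sample losses are integrable and differentiable on `X × Y` (with `X = ℝ^{d₁}`), with
partial gradients that depend measurably on the point of `X × Y` and on the data point. -/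
structure Regular (P : Problem d₁ d₂ M Ξ) (Y : Set (Vec d₂)) : Prop where
  integrable : ∀ i x, ∀ y ∈ Y, Integrable (P.sampleLoss i x y) (P.dist i : Measure Ξ)
  differentiable : ∀ i ξ x, ∀ y ∈ Y,
    DifferentiableAt ℝ (fun w : Vec d₁ × Vec d₂ => P.sampleLoss i w.1 w.2 ξ) (x, y)
  measurable_gradX : ∀ i,
    Measurable fun q : Vec d₁ × Y × Ξ => gradX (P.atSample i q.2.2) q.1 (q.2.1 : Vec d₂)
  measurable_gradY : ∀ i,
    Measurable fun q : Vec d₁ × Y × Ξ => gradY (P.atSample i q.2.2) q.1 (q.2.1 : Vec d₂)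

/-- Each `f_i` is differentiable on `X × Y` with `l`-Lipschitz gradient. -/
structure Smooth (P : Problem d₁ d₂ M Ξ) (Y : Set (Vec d₂)) (l : ℝ) : Prop where
  differentiable : ∀ i x, ∀ y ∈ Y,
    DifferentiableAt ℝ (fun w : Vec d₁ × Vec d₂ => P.localLoss i w.1 w.2) (x, y)
  lipschitz : ∀ i x₁ x₂, ∀ y₁ ∈ Y, ∀ y₂ ∈ Y,
    ‖grad (P.localLoss i) x₁ y₁ - grad (P.localLoss i) x₂ y₂‖ ≤ l * (‖x₁ - x₂‖ + ‖y₁ - y₂‖)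

/-- The sample gradients are unbiased with variance at most `σ²`. -/
structure BoundedVariance (P : Problem d₁ d₂ M Ξ) (Y : Set (Vec d₂)) (σ : ℝ) : Prop where
  integrable : ∀ i x, ∀ y ∈ Y,
    Integrable (fun ξ => grad (P.atSample i ξ) x y) (P.dist i : Measure Ξ)
  unbiased : ∀ i x, ∀ y ∈ Y,
    ∫ ξ, grad (P.atSample i ξ) x y ∂(P.dist i : Measure Ξ) = grad (P.localLoss i) x y
  sq_integrable : ∀ i x, ∀ y ∈ Y,
    Integrable (fun ξ => ‖grad (P.atSample i ξ) x y - grad (P.localLoss i) x y‖ ^ 2)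
      (P.dist i : Measure Ξ)
  variance_le : ∀ i x, ∀ y ∈ Y,
    ∫ ξ, ‖grad (P.atSample i ξ) x y - grad (P.localLoss i) x y‖ ^ 2 ∂(P.dist i : Measure Ξ)
      ≤ σ ^ 2

/-- `‖∇f_i - ∇f‖² ≤ σ_G²` on `X × Y`; for `σ_G = 0` the data are homogeneous. -/
def BoundedHeterogeneity (P : Problem d₁ d₂ M Ξ) (Y : Set (Vec d₂)) (σG : ℝ) : Prop :=
  ∀ i x, ∀ y ∈ Y, ‖grad (P.localLoss i) x y - grad P.loss x y‖ ^ 2 ≤ σG ^ 2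

/-- `f(x, ·)` is `G`-Lipschitz on `Y`. -/
def LipschitzInY (P : Problem d₁ d₂ M Ξ) (Y : Set (Vec d₂)) (G : ℝ) : Prop :=
  ∀ x, ∀ y ∈ Y, ∀ y' ∈ Y, |P.loss x y - P.loss x y'| ≤ G * ‖y - y'‖

/-- The global loss is concave in `y` on `Y`. -/
def ConcaveInY (P : Problem d₁ d₂ M Ξ) (Y : Set (Vec d₂)) : Prop :=
  ∀ x, ∀ y ∈ Y, ∀ y' ∈ Y,
    P.loss x y ≤ P.loss x y' + inner ℝ (gradY P.loss x y') (y - y')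

end Problem

/-- The standing assumptions of the nonconvex-concave setting, with their constants:
`l` (smoothness), `σ` (variance), `σG` (heterogeneity), `G` (Lipschitz constant in `y`),
`D` (diameter of `Y`), `Φlow` (lower bound of `Φ`). -/
structure NonconvexConcave (P : Problem d₁ d₂ M Ξ) (Y : Set (Vec d₂))
    (l σ σG G D Φlow : ℝ) : Prop where
  regular : P.Regular Y
  smooth : P.Smooth Y l
  variance : P.BoundedVariance Y σ
  heterogeneity : P.BoundedHeterogeneity Y σG
  lower_bound : ∀ x, Φlow ≤ P.primal Y x
  convex : Convex ℝ Y
  compact : IsCompact Y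
  diam_eq : Metric.diam Y = D
  lipschitz : P.LipschitzInY Y G
  concave : P.ConcaveInY Y

/-- The numerical inputs of FESS-GDA: local and global step sizes, the smoothing parameters
`β` and `p`, the number `T` of communication rounds, the number `K` of local updates. -/
structure Params where
  ηxl : ℝ
  ηyl : ℝ
  ηxg : ℝ
  ηyg : ℝ
  β : ℝ
  p : ℝ
  T : ℕ
  K : ℕ

/-- The admissible inputs: positive step sizes, `β ∈ (0, 1)`, `p > 0`, `T, K ≥ 1`. -/
structure Params.Admissible (θ : Params) : Prop where
  ηxl_pos : 0 < θ.ηxl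
  ηyl_pos : 0 < θ.ηyl
  ηxg_pos : 0 < θ.ηxg
  ηyg_pos : 0 < θ.ηyg
  β_pos : 0 < θ.β
  β_lt_one : θ.β < 1
  p_pos : 0 < θ.p
  one_le_T : 1 ≤ θ.T
  one_le_K : 1 ≤ θ.K

/-- The randomness of one communication round: the set of participating clients, and the
data points `ξ_i^k` of client `i` at its `k`-th local update. -/
abbrev Round (M K : ℕ) (Ξ : Type*) : Type _ := Finset (Fin M) × (Fin M → Fin K → Ξ)

/-- The law of one round: a uniformly random set of `m` clients and, independently of it,
independent data points `ξ_i^k ∼ 𝒟_i`. (Data points of clients that do not participate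
are never used.) -/
def roundLaw (P : Problem d₁ d₂ M Ξ) (m K : ℕ) : Measure (Round M K Ξ) :=
  (uniformOn {S : Finset (Fin M) | S.card = m}).prod
    (Measure.pi fun i => Measure.pi fun _ : Fin K => (P.dist i : Measure Ξ))

/-- The model of client `i` after `k` of its `K` local projected stochastic gradient
descent-ascent updates, started at the global model `w`. -/
def localIter (P : Problem d₁ d₂ M Ξ) (Y : Set (Vec d₂)) (θ : Params) (i : Fin M)
    (ξ : Fin θ.K → Ξ) (w : Vec d₁ × Vec d₂) : ℕ → Vec d₁ × Vec d₂
  | 0 => w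
  | k + 1 =>
    let v := localIter P Y θ i ξ w k
    if h : k < θ.K then
      (v.1 - θ.ηxl • gradX (P.atSample i (ξ ⟨k, h⟩)) v.1 v.2,
        proj Y (v.2 + θ.ηyl • gradY (P.atSample i (ξ ⟨k, h⟩)) v.1 v.2))
    else v

/-- The sum over the `K` local updates of client `i` of its stochastic gradients in `x`. -/
def localSumX (P : Problem d₁ d₂ M Ξ) (Y : Set (Vec d₂)) (θ : Params) (i : Fin M)
    (ξ : Fin θ.K → Ξ) (w : Vec d₁ × Vec d₂) : Vec d₁ :=
  ∑ k : Fin θ.K, gradX (P.atSample i (ξ k))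
    (localIter P Y θ i ξ w k).1 (localIter P Y θ i ξ w k).2

/-- The sum over the `K` local updates of client `i` of its stochastic gradients in `y`. -/
def localSumY (P : Problem d₁ d₂ M Ξ) (Y : Set (Vec d₂)) (θ : Params) (i : Fin M)
    (ξ : Fin θ.K → Ξ) (w : Vec d₁ × Vec d₂) : Vec d₂ :=
  ∑ k : Fin θ.K, gradY (P.atSample i (ξ k))
    (localIter P Y θ i ξ w k).1 (localIter P Y θ i ξ w k).2

/-- The state `(x_t, y_t, z_t)` of the server. -/
structure State (d₁ d₂ : ℕ) where
  x : Vec d₁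
  y : Vec d₂
  z : Vec d₁

/-- One communication round with `m` participating clients. With `η_x = η_{x,g} η_{x,l}`,
`η_y = η_{y,g} η_{y,l}` and the averages `ḡ` of the stochastic gradients over the `m K` local
updates of the round,
`x_{t+1} = x_t - η_x K (ḡ_x + p (x_t - z_t))`, `y_{t+1} = P_Y (y_t + η_y K ḡ_y)` and
`z_{t+1} = z_t + β (x_{t+1} - z_t)`. -/
def serverStep (P : Problem d₁ d₂ M Ξ) (Y : Set (Vec d₂)) (θ : Params) (m : ℕ)
    (r : Round M θ.K Ξ) (s : State d₁ d₂) : State d₁ d₂ :=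
  let gx : Vec d₁ :=
    (1 / ((m : ℝ) * θ.K)) • ∑ i ∈ r.1, localSumX P Y θ i (r.2 i) (s.x, s.y)
  let gy : Vec d₂ :=
    (1 / ((m : ℝ) * θ.K)) • ∑ i ∈ r.1, localSumY P Y θ i (r.2 i) (s.x, s.y)
  let x' : Vec d₁ := s.x - (θ.ηxg * θ.ηxl * θ.K) • (gx + θ.p • (s.x - s.z))
  { x := x'
    y := proj Y (s.y + (θ.ηyg * θ.ηyl * θ.K) • gy)
    z := s.z + θ.β • (x' - s.z) }

/-- The states of FESS-GDA with initial state `s₀` along the realization `r` of the rounds. -/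
def fessGDA (P : Problem d₁ d₂ M Ξ) (Y : Set (Vec d₂)) (θ : Params) (m : ℕ)
    (s₀ : State d₁ d₂) (r : ℕ → Round M θ.K Ξ) : ℕ → State d₁ d₂
  | 0 => s₀
  | t + 1 => serverStep P Y θ m (r t) (fessGDA P Y θ m s₀ r t)

/-- The first stationarity measure `‖∇ₓ f(x, y)‖`. -/
def residX (f : Vec d₁ → Vec d₂ → ℝ) (x : Vec d₁) (y : Vec d₂) : ℝ :=
  ‖gradX f x y‖

/-- The second stationarity measure `l ‖P_Y(y + (1/l) ∇_y f(x, y)) - y‖`. -/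
def residY (f : Vec d₁ → Vec d₂ → ℝ) (Y : Set (Vec d₂)) (l : ℝ) (x : Vec d₁) (y : Vec d₂) : ℝ :=
  l * ‖proj Y (y + (1 / l) • gradY f x y) - y‖

/-- The random points `w 0, …, w (T - 1)` contain an `ε`-stationary point of `f` on average:
a uniformly chosen one of them has expected squared stationarity measures that sum to at
most `ε²`. In particular for some `t < T` both `𝔼 ‖∇ₓ f(w t)‖²` and
`𝔼 (l ‖P_Y(y t + (1/l) ∇_y f(w t)) - y t‖)²` are at most `ε²`. -/
def FindsStationaryPoint {Ω : Type*} [MeasurableSpace Ω] (μ : Measure Ω)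
    (f : Vec d₁ → Vec d₂ → ℝ) (Y : Set (Vec d₂)) (l ε : ℝ) (T : ℕ)
    (w : ℕ → Ω → Vec d₁ × Vec d₂) : Prop :=
  (∀ t < T, ∀ᵐ ω ∂μ, (w t ω).2 ∈ Y) ∧
  (∀ t < T, Integrable (fun ω => residX f (w t ω).1 (w t ω).2 ^ 2) μ) ∧
  (∀ t < T, Integrable (fun ω => residY f Y l (w t ω).1 (w t ω).2 ^ 2) μ) ∧
  (1 / (T : ℝ)) * ∑ t ∈ Finset.range T,
    (∫ ω, residX f (w t ω).1 (w t ω).2 ^ 2 ∂μ + ∫ ω, residY f Y l (w t ω).1 (w t ω).2 ^ 2 ∂μ)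
      ≤ ε ^ 2

end

end FedMinimax

end

/-! With μ = ε/(2D), the regularized loss φ = f - μ/2 ‖y - y₀‖² is μ-strongly concave in y, and on Y
its y-gradient differs from that of f by at most μD = ε/2. It therefore suffices to analyse smoothed
gradient descent-ascent on φ, and to show that one communication round is a step of that method with
a small gradient error.

Adding l‖x - z‖² makes φ strongly convex in x. Let x(y, z) be the minimizer (`proxPoint`), d(y, z)
the minimum (`dualValue`) and P(z) the maximum of d(·, z) over Y (`saddleValue`). The Lyapunov
function is 2P - d + l‖x - x(y, z)‖². The x-step contracts towards x(y, z) (`proxPoint_tracking`),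
the y-step raises d (`dualValue_ascent`), and the z-step lowers 2P - d as far as x(y, z) is near the
saddle point. Strong concavity bounds the squared distance to the saddle point by l/μ times squared
step lengths and errors (`dual_error_bound`, `saddle_distance`); choosing β proportional to μ/l
cancels that factor. This gives `potential_descent`, and in terms of the stationarity measures
`potential_stationarity`: a decrease of order β/l times the measures, up to squared gradient errors
and the bias of the regularization.

The global step sizes are chosen so that a round has effective steps 1/(9l) and 1/(200l) whatever
the local step size η is. The gradient error then has two parts: averaged martingale noise, of mean
square at most σ²/(mK), and client drift of order lηK, which a small η suppresses. Full
participation or homogeneity makes the local gradients at the server's point average exactly to ∇f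
(`average_grad_localLoss`). Errors enter only through second moments (`lintegral_roundError_sq_le`).
The drift bound contains the possibly unbounded ‖∇ₓf‖², but with a coefficient small enough to be
absorbed by the descent (`average_le_of_descent`).

Telescoping bounds the average measure by terms of order l/(βT) and σ²/(βmK), plus drift and the
bias 2(μD)² = ε²/2. Since β is of order ε, T of order ε⁻³ and mK of order ε⁻³ are enough, up to
rounding K up to an integer. -/

noncomputable section

namespace FedMinimax

/-! ### The smoothed function: inner minimizer, dual value, saddle point. -/

section InexactStep

variable {E F : Type*} [NormedAddCommGroup E] [InnerProductSpace ℝ E]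
  [NormedAddCommGroup F] [InnerProductSpace ℝ F]

/-- `φ` is `l`-weakly convex in `x` and `μ`-strongly concave in `y ∈ Y`, with partial gradients
`gx` and `gy` that are Lipschitz on `X × Y`. -/
structure WeaklyConvexStronglyConcave (Y : Set F) (φ : E → F → ℝ) (gx : E → F → E)
    (gy : E → F → F) (l μ G : ℝ) : Prop where
  l_pos : 0 < l
  μ_pos : 0 < μ
  G_nonneg : 0 ≤ G
  convex : Convex ℝ Y
  compact : IsCompact Y
  nonempty : Y.Nonempty
  lower_x : ∀ x x', ∀ y ∈ Y, φ x y + inner ℝ (gx x y) (x' - x) - l / 2 * ‖x' - x‖ ^ 2 ≤ φ x' y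
  upper_y : ∀ x, ∀ y ∈ Y, ∀ y' ∈ Y,
    φ x y ≤ φ x y' + inner ℝ (gy x y') (y - y') - μ / 2 * ‖y - y'‖ ^ 2
  lip_gx : ∀ x x', ∀ y ∈ Y, ∀ y' ∈ Y, ‖gx x y - gx x' y'‖ ≤ l * (‖x - x'‖ + ‖y - y'‖)
  lip_gy : ∀ x x', ∀ y ∈ Y, ∀ y' ∈ Y, ‖gy x y - gy x' y'‖ ≤ l * ‖x - x'‖ + 2 * l * ‖y - y'‖
  lip_y : ∀ x, ∀ y ∈ Y, ∀ y' ∈ Y, φ x y - φ x y' ≤ G * ‖y - y'‖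

/-- The gradient in `x` of the smoothed function `φ(x, y) + l ‖x - z‖²`. -/
def smoothedGrad (gx : E → F → E) (l : ℝ) (z : E) (y : F) (x : E) : E :=
  gx x y + (2 * l) • (x - z)

open Classical in
/-- The minimizer in `x` of the smoothed function `φ(x, y) + l ‖x - z‖²`. -/
def proxPoint (gx : E → F → E) (l : ℝ) (y : F) (z : E) : E :=
  if h : ∃ x, smoothedGrad gx l z y x = 0 then h.choose else z

/-- The minimal value in `x` of the smoothed function `φ(x, y) + l ‖x - z‖²`. -/
def dualValue (φ : E → F → ℝ) (gx : E → F → E) (l : ℝ) (y : F) (z : E) : ℝ :=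
  φ (proxPoint gx l y z) y + l * ‖proxPoint gx l y z - z‖ ^ 2

namespace WeaklyConvexStronglyConcave

variable {Y : Set F} {φ : E → F → ℝ} {gx : E → F → E} {gy : E → F → F} {l μ G : ℝ}

/-- The Lipschitz gradient of φ costs at most l of monotonicity, while the quadratic term supplies
2l. -/
lemma smoothedGrad_strongMono (h : WeaklyConvexStronglyConcave Y φ gx gy l μ G) (z : E) {y : F}
    (hy : y ∈ Y) (x x' : E) :
    l * ‖x - x'‖ ^ 2 ≤
      inner ℝ (smoothedGrad gx l z y x - smoothedGrad gx l z y x') (x - x') := by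
  have e : smoothedGrad gx l z y x - smoothedGrad gx l z y x'
      = (gx x y - gx x' y) + (2 * l) • (x - x') := by
    simp only [smoothedGrad, smul_sub]; abel
  have h1 := abs_real_inner_le_norm (gx x y - gx x' y) (x - x')
  have h2 := h.lip_gx x x' y hy y hy
  simp only [sub_self, norm_zero, add_zero] at h2
  rw [e, inner_add_left, real_inner_smul_left, real_inner_self_eq_norm_sq]
  have h3 := neg_abs_le (inner ℝ (gx x y - gx x' y) (x - x'))
  have h4 := mul_le_mul_of_nonneg_right h2 (norm_nonneg (x - x'))
  nlinarith

lemma smoothedGrad_lipschitz (h : WeaklyConvexStronglyConcave Y φ gx gy l μ G) (z : E) {y : F}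
    (hy : y ∈ Y) (x x' : E) :
    ‖smoothedGrad gx l z y x - smoothedGrad gx l z y x'‖ ≤ 3 * l * ‖x - x'‖ := by
  have e : smoothedGrad gx l z y x - smoothedGrad gx l z y x'
      = (gx x y - gx x' y) + (2 * l) • (x - x') := by
    simp only [smoothedGrad, smul_sub]; abel
  have h2 := h.lip_gx x x' y hy y hy
  simp only [sub_self, norm_zero, add_zero] at h2
  have hl := h.l_pos
  rw [e]
  refine (norm_add_le _ _).trans ?_
  rw [norm_smul, Real.norm_of_nonneg (by positivity)]
  linarith

/-- For an operator of monotonicity modulus l and Lipschitz constant 3l, the step l/(3l)² = 1/(9l)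
is the optimal one in the expansion of the square: the factor is 1 - 2/9 + 1/9. -/
lemma gradStep_contracting (h : WeaklyConvexStronglyConcave Y φ gx gy l μ G) (z : E) {y : F}
    (hy : y ∈ Y) (x x' : E) :
    ‖(x - (1 / (9 * l)) • smoothedGrad gx l z y x)
      - (x' - (1 / (9 * l)) • smoothedGrad gx l z y x')‖ ^ 2 ≤ 8 / 9 * ‖x - x'‖ ^ 2 := by
  have hl := h.l_pos
  have e : (x - (1 / (9 * l)) • smoothedGrad gx l z y x)
      - (x' - (1 / (9 * l)) • smoothedGrad gx l z y x')
      = (x - x') - (1 / (9 * l)) • (smoothedGrad gx l z y x - smoothedGrad gx l z y x') := by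
    simp only [smul_sub]; abel
  have h1 := h.smoothedGrad_strongMono z hy x x'
  have h2 := h.smoothedGrad_lipschitz z hy x x'
  rw [e, norm_sub_sq_real, real_inner_smul_right, norm_smul, Real.norm_of_nonneg (by positivity),
    real_inner_comm]
  have h3 : ‖smoothedGrad gx l z y x - smoothedGrad gx l z y x'‖ ^ 2 ≤ (3 * l * ‖x - x'‖) ^ 2 :=
    pow_le_pow_left₀ (norm_nonneg _) h2 2
  have h4 : 1 / (9 * l) * (l * ‖x - x'‖ ^ 2) ≤ 1 / (9 * l) *
      inner ℝ (smoothedGrad gx l z y x - smoothedGrad gx l z y x') (x - x') := by gcongr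
  have h5 : 1 / (9 * l) * (l * ‖x - x'‖ ^ 2) = 1 / 9 * ‖x - x'‖ ^ 2 := by field_simp
  have h6 : (1 / (9 * l) * ‖smoothedGrad gx l z y x - smoothedGrad gx l z y x'‖) ^ 2
      ≤ 1 / 9 * ‖x - x'‖ ^ 2 := by
    rw [mul_pow]
    calc _ ≤ (1 / (9 * l)) ^ 2 * (3 * l * ‖x - x'‖) ^ 2 := by gcongr
      _ = _ := by field_simp; norm_num
  linarith

/-- The minimizer is the fixed point of the contracting gradient step, so Banach's theorem replaces
any coercivity argument. -/
lemma exists_smoothedGrad_eq_zero [CompleteSpace E]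
    (h : WeaklyConvexStronglyConcave Y φ gx gy l μ G) (z : E) {y : F}
    (hy : y ∈ Y) : ∃ x, smoothedGrad gx l z y x = 0 := by
  have hl := h.l_pos
  let f : E → E := fun x => x - (1 / (9 * l)) • smoothedGrad gx l z y x
  have hf : ContractingWith (Real.toNNReal (Real.sqrt (8 / 9))) f := by
    refine ⟨?_, ?_⟩
    · rw [← NNReal.coe_lt_coe, Real.coe_toNNReal _ (Real.sqrt_nonneg _), NNReal.coe_one,
        Real.sqrt_lt' one_pos]
      norm_num
    · refine LipschitzWith.of_dist_le_mul fun x x' => ?_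
      rw [Real.coe_toNNReal _ (Real.sqrt_nonneg _), dist_eq_norm, dist_eq_norm]
      have := Real.sqrt_le_sqrt (h.gradStep_contracting z hy x x')
      rwa [Real.sqrt_sq (norm_nonneg _), Real.sqrt_mul (by norm_num),
        Real.sqrt_sq (norm_nonneg _)] at this
  have hfix := hf.fixedPoint_isFixedPt
  refine ⟨ContractingWith.fixedPoint f hf, ?_⟩
  · have : f (ContractingWith.fixedPoint f hf) = ContractingWith.fixedPoint f hf := hfix
    have h2 : (1 / (9 * l)) • smoothedGrad gx l z y (ContractingWith.fixedPoint f hf) = 0 := by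
      simpa [f] using this
    rcases smul_eq_zero.1 h2 with h3 | h3
    · exact absurd h3 (by positivity)
    · exact h3

variable [CompleteSpace E]

lemma smoothedGrad_proxPoint (h : WeaklyConvexStronglyConcave Y φ gx gy l μ G) (z : E) {y : F}
    (hy : y ∈ Y) : smoothedGrad gx l z y (proxPoint gx l y z) = 0 := by
  have hx := h.exists_smoothedGrad_eq_zero z hy
  rw [proxPoint, dif_pos hx]
  exact hx.choose_spec

/-- Changing (y, z) perturbs the gradient at a fixed point by at most l‖y - y'‖ + 2l‖z - z'‖; strong
monotonicity with modulus l divides this by l. -/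
lemma proxPoint_lipschitz (h : WeaklyConvexStronglyConcave Y φ gx gy l μ G) (z z' : E) {y y' : F}
    (hy : y ∈ Y) (hy' : y' ∈ Y) :
    ‖proxPoint gx l y z - proxPoint gx l y' z'‖ ≤ ‖y - y'‖ + 2 * ‖z - z'‖ := by
  have hl := h.l_pos
  set a := proxPoint gx l y z
  set b := proxPoint gx l y' z'
  have ha : smoothedGrad gx l z y a = 0 := h.smoothedGrad_proxPoint z hy
  have hb : smoothedGrad gx l z' y' b = 0 := h.smoothedGrad_proxPoint z' hy'
  have h1 := h.smoothedGrad_strongMono z hy a b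
  have e : smoothedGrad gx l z y a - smoothedGrad gx l z y b
      = (gx b y' - gx b y) + (2 * l) • (z - z') := by
    rw [ha, ← hb]
    simp only [smoothedGrad, smul_sub]; abel
  have h2 := h.lip_gx b b y' hy' y hy
  rw [sub_self, norm_zero, zero_add, norm_sub_rev y' y] at h2
  have h3 : ‖(gx b y' - gx b y) + (2 * l) • (z - z')‖ ≤ l * (‖y - y'‖ + 2 * ‖z - z'‖) := by
    refine (norm_add_le _ _).trans ?_
    rw [norm_smul, Real.norm_of_nonneg (by positivity)]
    linarith
  have h4 := real_inner_le_norm ((gx b y' - gx b y) + (2 * l) • (z - z')) (a - b)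
  rw [e] at h1
  have h5 := mul_le_mul_of_nonneg_right h3 (norm_nonneg (a - b))
  by_contra! hlt
  have hpos : 0 < ‖a - b‖ := lt_of_le_of_lt (by positivity) hlt
  have : l * ‖a - b‖ * (‖y - y'‖ + 2 * ‖z - z'‖) < l * ‖a - b‖ * ‖a - b‖ :=
    mul_lt_mul_of_pos_left hlt (by positivity)
  nlinarith

/-- Quadratic growth at the minimizer: the curvature 2l of the smoothing term exceeds the possible
concavity l of φ by l. -/
lemma dualValue_add_le (h : WeaklyConvexStronglyConcave Y φ gx gy l μ G) (z x : E) {y : F}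
    (hy : y ∈ Y) :
    dualValue φ gx l y z + l / 2 * ‖x - proxPoint gx l y z‖ ^ 2 ≤ φ x y + l * ‖x - z‖ ^ 2 := by
  have h1 := h.lower_x (proxPoint gx l y z) x y hy
  have h0 := h.smoothedGrad_proxPoint z hy
  rw [dualValue]
  set a := proxPoint gx l y z
  have e : gx a y = -((2 * l) • (a - z)) := eq_neg_of_add_eq_zero_left h0
  rw [e, inner_neg_left, real_inner_smul_left] at h1
  have e2 : ‖x - z‖ ^ 2 = ‖x - a‖ ^ 2 + 2 * inner ℝ (a - z) (x - a) + ‖a - z‖ ^ 2 := by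
    rw [← sub_add_sub_cancel x a z, norm_add_sq_real, real_inner_comm]
  rw [e2]
  nlinarith

lemma dualValue_le (h : WeaklyConvexStronglyConcave Y φ gx gy l μ G) (z x : E) {y : F}
    (hy : y ∈ Y) : dualValue φ gx l y z ≤ φ x y + l * ‖x - z‖ ^ 2 := by
  have := h.dualValue_add_le z x hy
  have : 0 ≤ l / 2 * ‖x - proxPoint gx l y z‖ ^ 2 := by have := h.l_pos; positivity
  linarith

lemma dualValue_sub_le (h : WeaklyConvexStronglyConcave Y φ gx gy l μ G) (z : E) {y y' : F}
    (hy : y ∈ Y) (hy' : y' ∈ Y) :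
    dualValue φ gx l y z - dualValue φ gx l y' z ≤ G * ‖y - y'‖ := by
  have h1 := h.dualValue_le z (proxPoint gx l y' z) hy
  have h2 := h.lip_y (proxPoint gx l y' z) y hy y' hy'
  rw [dualValue.eq_def φ gx l y' z]
  linarith

/-- A Danskin-type argument in place of a minimax theorem. A maximizer `ys` of the dual value is
compared with points moved slightly from it towards `y`. Since the inner minimizer is Lipschitz in
y, it moves by O(τ), and letting τ tend to 0 shows that `ys` maximizes φ at its own inner minimizer.
-/
lemma exists_saddle (h : WeaklyConvexStronglyConcave Y φ gx gy l μ G) (z : E) :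
    ∃ ys ∈ Y, ∀ y ∈ Y, φ (proxPoint gx l ys z) y ≤ φ (proxPoint gx l ys z) ys := by
  have hl := h.l_pos
  have hcont : ContinuousOn (fun y => dualValue φ gx l y z) Y := by
    refine (LipschitzOnWith.of_dist_le_mul (K := Real.toNNReal G) ?_).continuousOn
    intro y hy y' hy'
    rw [Real.coe_toNNReal _ h.G_nonneg, Real.dist_eq, abs_le, dist_eq_norm]
    constructor
    · have := h.dualValue_sub_le z hy' hy
      rw [norm_sub_rev] at this
      linarith
    · exact h.dualValue_sub_le z hy hy'
  obtain ⟨ys, hys, hmax⟩ := h.compact.exists_isMaxOn h.nonempty hcont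
  refine ⟨ys, hys, fun y hy => ?_⟩
  have key : ∀ τ : ℝ, 0 < τ → τ ≤ 1 →
      φ (proxPoint gx l ys z) y ≤ φ (proxPoint gx l ys z) ys
        + τ * (‖y - ys‖ * (‖gx (proxPoint gx l ys z) y‖ + ‖(2 * l) • (proxPoint gx l ys z - z)‖)
          + l * ‖y - ys‖ ^ 2) := by
    intro τ hτ hτ1
    set w : F := ys + τ • (y - ys) with hw
    have hwY : w ∈ Y := by
      have := h.convex hys hy (a := 1 - τ) (b := τ) (by linarith) hτ.le (by ring)
      have e : (1 - τ) • ys + τ • y = w := by rw [hw, sub_smul, one_smul, smul_sub]; abel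
      rwa [e] at this
    set xw := proxPoint gx l w z with hxw
    set xs := proxPoint gx l ys z with hxs
    have hd : ‖xw - xs‖ ≤ τ * ‖y - ys‖ := by
      have := h.proxPoint_lipschitz z z hwY hys
      rw [sub_self, norm_zero, mul_zero, add_zero] at this
      refine this.trans (le_of_eq ?_)
      rw [hw, add_sub_cancel_left, norm_smul, Real.norm_of_nonneg hτ.le]
    have hmx : dualValue φ gx l w z ≤ dualValue φ gx l ys z := hmax hwY
    have c1 := h.upper_y xw ys hys w hwY
    have c2 := h.upper_y xw y hy w hwY
    have e1 : ys - w = (-τ) • (y - ys) := by rw [hw, neg_smul]; abel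
    have e2 : y - w = (1 - τ) • (y - ys) := by rw [hw, sub_smul, one_smul]; abel
    have p1 : 0 ≤ μ / 2 * ‖ys - w‖ ^ 2 := by have := h.μ_pos; positivity
    have p2 : 0 ≤ μ / 2 * ‖y - w‖ ^ 2 := by have := h.μ_pos; positivity
    rw [e1, real_inner_smul_right] at c1
    rw [e2, real_inner_smul_right] at c2
    have c3 : (1 - τ) * φ xw ys + τ * φ xw y ≤ φ xw w := by
      rw [← e1] at c1; rw [← e2] at c2
      nlinarith
    have c4 := h.dualValue_le z xw hys
    -- The value of the smoothed function at (`xw`, `ys`) is at least the dual value at `ys`, while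
    -- its value at (`xw`, `w`) is at most that. Concavity then leaves exactly the weight τ, which
    -- is divided out.
    have c5 : τ * (φ xw y + l * ‖xw - z‖ ^ 2) ≤ τ * dualValue φ gx l ys z := by
      have : φ xw w + l * ‖xw - z‖ ^ 2 ≤ dualValue φ gx l ys z := hmx
      nlinarith
    have c6 := le_of_mul_le_mul_left c5 hτ
    have c7 := h.lower_x xs xw y hy
    have c8 : ‖xs - z‖ ^ 2 + 2 * inner ℝ (xs - z) (xw - xs) ≤ ‖xw - z‖ ^ 2 := by
      have : ‖xw - z‖ ^ 2 = ‖xw - xs‖ ^ 2 + 2 * inner ℝ (xs - z) (xw - xs) + ‖xs - z‖ ^ 2 := by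
        rw [← sub_add_sub_cancel xw xs z, norm_add_sq_real, real_inner_comm]
      nlinarith [sq_nonneg ‖xw - xs‖]
    have c9 : -(‖gx xs y‖ * (τ * ‖y - ys‖)) ≤ inner ℝ (gx xs y) (xw - xs) := by
      have := abs_real_inner_le_norm (gx xs y) (xw - xs)
      have h2 := mul_le_mul_of_nonneg_left hd (norm_nonneg (gx xs y))
      have := neg_abs_le (inner ℝ (gx xs y) (xw - xs))
      linarith
    have c10 : -(‖(2 * l) • (xs - z)‖ * (τ * ‖y - ys‖)) ≤ 2 * l * inner ℝ (xs - z) (xw - xs) := by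
      rw [← real_inner_smul_left]
      have := abs_real_inner_le_norm ((2 * l) • (xs - z)) (xw - xs)
      have h2 := mul_le_mul_of_nonneg_left hd (norm_nonneg ((2 * l) • (xs - z)))
      have := neg_abs_le (inner ℝ ((2 * l) • (xs - z)) (xw - xs))
      linarith
    have c11 : ‖xw - xs‖ ^ 2 ≤ τ * ‖y - ys‖ ^ 2 := by
      have : ‖xw - xs‖ ^ 2 ≤ (τ * ‖y - ys‖) ^ 2 := pow_le_pow_left₀ (norm_nonneg _) hd 2
      have h3 : τ * τ * ‖y - ys‖ ^ 2 ≤ τ * 1 * ‖y - ys‖ ^ 2 := by gcongr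
      nlinarith
    have c12 : dualValue φ gx l ys z = φ xs ys + l * ‖xs - z‖ ^ 2 := rfl
    have c13 := mul_le_mul_of_nonneg_left c8 hl.le
    have c14 := mul_le_mul_of_nonneg_left c11 hl.le
    nlinarith [mul_nonneg hl.le (mul_nonneg hτ.le (sq_nonneg ‖y - ys‖))]
  set B := ‖y - ys‖ * (‖gx (proxPoint gx l ys z) y‖ + ‖(2 * l) • (proxPoint gx l ys z - z)‖)
          + l * ‖y - ys‖ ^ 2
  have hB : 0 ≤ B := by positivity
  refine le_of_forall_pos_le_add fun δ hδ => ?_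
  refine (key (min 1 (δ / (B + 1))) (lt_min one_pos (by positivity)) (min_le_left _ _)).trans ?_
  gcongr
  calc _ ≤ δ / (B + 1) * B := by gcongr; exact min_le_right _ _
    _ ≤ δ := by rw [div_mul_eq_mul_div, div_le_iff₀ (by positivity)]; nlinarith

end WeaklyConvexStronglyConcave
end InexactStep

/-! ### Descent of the Lyapunov function under an inexact step. -/

section InexactDescent

variable {E F : Type*} [NormedAddCommGroup E] [InnerProductSpace ℝ E]
  [NormedAddCommGroup F] [InnerProductSpace ℝ F]

open Classical in
/-- The maximizer over `Y` of the dual value. -/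
def saddleY (Y : Set F) (φ : E → F → ℝ) (gx : E → F → E) (l : ℝ) (z : E) : F :=
  if h : ∃ ys ∈ Y, ∀ y ∈ Y, φ (proxPoint gx l ys z) y ≤ φ (proxPoint gx l ys z) ys
  then h.choose else 0

/-- The value of the saddle point problem for the smoothed function. -/
def saddleValue (Y : Set F) (φ : E → F → ℝ) (gx : E → F → E) (l : ℝ) (z : E) : ℝ :=
  dualValue φ gx l (saddleY Y φ gx l z) z

/-- The Lyapunov function of smoothed gradient descent-ascent. -/
def potential (Y : Set F) (φ : E → F → ℝ) (gx : E → F → E) (l : ℝ) (x : E) (y : F) (z : E) : ℝ :=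
  2 * saddleValue Y φ gx l z - dualValue φ gx l y z + l * ‖x - proxPoint gx l y z‖ ^ 2

lemma norm_sub_sq_sub_norm_sub_sq (a z z' : E) :
    ‖a - z'‖ ^ 2 - ‖a - z‖ ^ 2 = 2 * inner ℝ (z - a) (z' - z) + ‖z' - z‖ ^ 2 := by
  rw [← sub_sub_sub_cancel_right a z' z, norm_sub_sq_real, ← neg_sub a z, inner_neg_left]
  ring

namespace WeaklyConvexStronglyConcave

variable {Y : Set F} {φ : E → F → ℝ} {gx : E → F → E} {gy : E → F → F} {l μ G : ℝ}
  [CompleteSpace E]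

lemma saddleY_spec (h : WeaklyConvexStronglyConcave Y φ gx gy l μ G) (z : E) :
    saddleY Y φ gx l z ∈ Y ∧ ∀ y ∈ Y,
      φ (proxPoint gx l (saddleY Y φ gx l z) z) y
        ≤ φ (proxPoint gx l (saddleY Y φ gx l z) z) (saddleY Y φ gx l z) := by
  have hx := h.exists_saddle z
  rw [saddleY, dif_pos hx]
  exact hx.choose_spec

lemma le_saddleValue (h : WeaklyConvexStronglyConcave Y φ gx gy l μ G) (z : E) {y : F}
    (hy : y ∈ Y) :
    φ (proxPoint gx l (saddleY Y φ gx l z) z) y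
      + l * ‖proxPoint gx l (saddleY Y φ gx l z) z - z‖ ^ 2 ≤ saddleValue Y φ gx l z := by
  have := (h.saddleY_spec z).2 y hy
  rw [saddleValue, dualValue]
  linarith

lemma dualValue_le_saddleValue (h : WeaklyConvexStronglyConcave Y φ gx gy l μ G) (z : E) {y : F}
    (hy : y ∈ Y) : dualValue φ gx l y z ≤ saddleValue Y φ gx l z :=
  (h.dualValue_le z _ hy).trans (h.le_saddleValue z hy)

/-- Only an upper bound on the growth of P is needed: testing the new dual value at the old saddle
point avoids differentiating P. -/
lemma saddleValue_sub_le (h : WeaklyConvexStronglyConcave Y φ gx gy l μ G) (z z' : E) :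
    saddleValue Y φ gx l z' - saddleValue Y φ gx l z
      ≤ l * (‖proxPoint gx l (saddleY Y φ gx l z) z - z'‖ ^ 2
        - ‖proxPoint gx l (saddleY Y φ gx l z) z - z‖ ^ 2) := by
  have h1 := h.dualValue_le z' (proxPoint gx l (saddleY Y φ gx l z) z) (h.saddleY_spec z').1
  have h2 := h.le_saddleValue z (h.saddleY_spec z').1
  rw [saddleValue.eq_def Y φ gx l z']
  linarith

/-- The vector `e` is the residual by which `y` fails the first-order condition of maximizing φ(x(y,
z), ·). Strong concavity turns it into a gap of at most ‖e‖²/(2μ), and quadratic growth of the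
smoothed function in x turns the gap into a distance. This is the only estimate in which the size of
μ enters, and the origin of the slow scale β. -/
lemma dual_error_bound (h : WeaklyConvexStronglyConcave Y φ gx gy l μ G) (z : E) {y : F}
    (hy : y ∈ Y) (e : F)
    (he : ∀ v ∈ Y, inner ℝ (gy (proxPoint gx l y z) y - e) (v - y) ≤ 0) :
    ‖proxPoint gx l y z - proxPoint gx l (saddleY Y φ gx l z) z‖ ^ 2 ≤ ‖e‖ ^ 2 / (l * μ) := by
  have hl := h.l_pos
  have hμ := h.μ_pos
  have h1 := h.dualValue_add_le z (proxPoint gx l (saddleY Y φ gx l z) z) hy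
  have h2 := h.le_saddleValue z hy
  set ys := saddleY Y φ gx l z
  have hys : ys ∈ Y := (h.saddleY_spec z).1
  have h3 := h.dualValue_le z (proxPoint gx l y z) hys
  have h4 := h.upper_y (proxPoint gx l y z) ys hys y hy
  have h5 := he ys hys
  rw [inner_sub_left] at h5
  have h6 := real_inner_le_norm e (ys - y)
  have h7 : saddleValue Y φ gx l z = dualValue φ gx l ys z := rfl
  have h8 : dualValue φ gx l y z
    = φ (proxPoint gx l y z) y + l * ‖proxPoint gx l y z - z‖ ^ 2 := rfl
  -- Maximum over ‖`ys` - `y`‖ of a concave quadratic; the unknown distance in y disappears.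
  have h9 : ‖e‖ * ‖ys - y‖ - μ / 2 * ‖ys - y‖ ^ 2 ≤ ‖e‖ ^ 2 / (2 * μ) := by
    rw [le_div_iff₀ (by positivity)]
    nlinarith [sq_nonneg (‖e‖ - μ * ‖ys - y‖)]
  rw [norm_sub_rev]
  have h10 : l / 2 * ‖proxPoint gx l ys z - proxPoint gx l y z‖ ^ 2 ≤ ‖e‖ ^ 2 / (2 * μ) := by
    linarith
  rw [le_div_iff₀ (by positivity)] at h10 ⊢
  linarith

/-- The gradient step contracts towards the old minimizer, and the Lipschitz bound pays for the
motion of the minimizer itself. -/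
lemma proxPoint_tracking (h : WeaklyConvexStronglyConcave Y φ gx gy l μ G) {x x' z z' δx : E}
    {y y' : F} (hy : y ∈ Y) (hy' : y' ∈ Y)
    (hx : x' = x - (1 / (9 * l)) • (smoothedGrad gx l z y x + δx)) :
    ‖x' - proxPoint gx l y' z'‖ ^ 2 ≤ 17 / 18 * ‖x - proxPoint gx l y z‖ ^ 2
      + (‖δx‖ / l) ^ 2 + 51 * ‖y' - y‖ ^ 2 + 204 * ‖z' - z‖ ^ 2 := by
  have hl := h.l_pos
  have h1 := h.gradStep_contracting z hy x (proxPoint gx l y z)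
  rw [h.smoothedGrad_proxPoint z hy, smul_zero, sub_zero] at h1
  have h2 := h.proxPoint_lipschitz z z' hy hy'
  rw [norm_sub_rev y, norm_sub_rev z] at h2
  set a := proxPoint gx l y z
  set b := proxPoint gx l y' z'
  set c := x - (1 / (9 * l)) • smoothedGrad gx l z y x - a
  have e : x' - b = c + (-((1 / (9 * l)) • δx) + (a - b)) := by
    rw [hx, smul_add]; simp only [c]; abel
  have h3 : ‖x' - b‖ ≤ ‖c‖ + (1 / 9 * (‖δx‖ / l) + ‖y' - y‖ + 2 * ‖z' - z‖) := by
    rw [e]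
    refine (norm_add_le _ _).trans ?_
    gcongr
    refine (norm_add_le _ _).trans ?_
    rw [norm_neg, norm_smul, Real.norm_of_nonneg (by positivity)]
    have : 1 / (9 * l) * ‖δx‖ = 1 / 9 * (‖δx‖ / l) := by field_simp
    linarith
  set q := 1 / 9 * (‖δx‖ / l) + ‖y' - y‖ + 2 * ‖z' - z‖ with hq
  have h4 : ‖x' - b‖ ^ 2 ≤ (‖c‖ + q) ^ 2 := pow_le_pow_left₀ (norm_nonneg _) h3 2
  have h5 : q ^ 2 ≤ 3 * ((1 / 9 * (‖δx‖ / l)) ^ 2 + ‖y' - y‖ ^ 2 + (2 * ‖z' - z‖) ^ 2) := by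
    rw [hq]
    nlinarith [sq_nonneg (1 / 9 * (‖δx‖ / l) - ‖y' - y‖), sq_nonneg (‖y' - y‖ - 2 * ‖z' - z‖),
      sq_nonneg (1 / 9 * (‖δx‖ / l) - 2 * ‖z' - z‖)]
  -- Young's inequality with weight 1/16, so that 17/16 · 8/9 = 17/18 stays below 1; then 51 = 17 ·
  -- 3 and 204 = 51 · 4.
  have h6 : (‖c‖ + q) ^ 2 ≤ 17 / 16 * ‖c‖ ^ 2 + 17 * q ^ 2 := by
    nlinarith [sq_nonneg (‖c‖ - 16 * q)]
  nlinarith [sq_nonneg (‖δx‖ / l)]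

/-- The new minimizer is tested in the old dual problem, so only concavity of φ in y at one fixed x
is needed. The projection inequality yields 200l‖y' - y‖²; the gradient mismatch and Young's
inequality consume 25l of it. The effect of moving z is kept as an exact difference of squares, to
be combined with the change of P. -/
lemma dualValue_ascent (h : WeaklyConvexStronglyConcave Y φ gx gy l μ G) {x z z' : E}
    {y y' δy : F} (hy : y ∈ Y) (hy' : y' ∈ Y)
    (hproj : ∀ v ∈ Y, inner ℝ (y + (1 / (200 * l)) • (gy x y + δy) - y') (v - y') ≤ 0) :
    dualValue φ gx l y z + 175 * l * ‖y' - y‖ ^ 2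
      + l * (‖proxPoint gx l y' z' - z'‖ ^ 2 - ‖proxPoint gx l y' z' - z‖ ^ 2)
      ≤ dualValue φ gx l y' z' + l / 80 * ‖x - proxPoint gx l y z‖ ^ 2 + l * ‖z' - z‖ ^ 2
        + ‖δy‖ ^ 2 / (4 * l) := by
  have hl := h.l_pos
  have h0 := h.proxPoint_lipschitz z z' hy hy'
  rw [norm_sub_rev y, norm_sub_rev z] at h0
  set a := proxPoint gx l y z
  set b := proxPoint gx l y' z'
  have h1 := h.dualValue_le z b hy
  have h2 := h.upper_y b y hy y' hy'
  have h2' : 0 ≤ μ / 2 * ‖y - y'‖ ^ 2 := by have := h.μ_pos; positivity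
  have h3 := hproj y hy
  have e3 : y + (1 / (200 * l)) • (gy x y + δy) - y'
      = (y - y') + (1 / (200 * l)) • (gy x y + δy) := by abel
  rw [e3, inner_add_left, real_inner_self_eq_norm_sq, real_inner_smul_left] at h3
  have h4 : inner ℝ (gy x y + δy) (y - y') ≤ - (200 * l) * ‖y - y'‖ ^ 2 := by
    have := mul_le_mul_of_nonneg_left h3 (by positivity : (0 : ℝ) ≤ 200 * l)
    rw [mul_add, ← mul_assoc, mul_one_div_cancel (by positivity)] at this
    linarith
  have h5 : ‖gy b y' - (gy x y + δy)‖ ≤ l * (‖x - a‖ + ‖y - y'‖ + 2 * ‖z' - z‖)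
      + 2 * l * ‖y - y'‖ + ‖δy‖ := by
    rw [← sub_sub]
    refine (norm_sub_le _ _).trans ?_
    gcongr
    refine (h.lip_gy b x y' hy' y hy).trans ?_
    rw [norm_sub_rev y' y, norm_sub_rev b x]
    gcongr
    have := norm_sub_le_norm_sub_add_norm_sub x a b
    rw [norm_sub_rev y' y] at h0
    linarith
  have h6 := real_inner_le_norm (gy b y' - (gy x y + δy)) (y - y')
  rw [inner_sub_left] at h6
  have h7 := mul_le_mul_of_nonneg_right h5 (norm_nonneg (y - y'))
  have h8 : dualValue φ gx l y' z' = φ b y' + l * ‖b - z'‖ ^ 2 := rfl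
  rw [norm_sub_rev y' y]
  have h9 : ‖δy‖ * ‖y - y'‖ ≤ ‖δy‖ ^ 2 / (4 * l) + l * ‖y - y'‖ ^ 2 := by
    rw [← sub_le_iff_le_add, le_div_iff₀ (by positivity)]
    nlinarith [sq_nonneg (‖δy‖ - 2 * l * ‖y - y'‖)]
  have h10 : l * ‖x - a‖ * ‖y - y'‖ ≤ l / 80 * ‖x - a‖ ^ 2 + 20 * l * ‖y - y'‖ ^ 2 := by
    nlinarith [mul_nonneg hl.le (sq_nonneg (‖x - a‖ - 40 * ‖y - y'‖))]
  have h11 : 2 * l * ‖z' - z‖ * ‖y - y'‖ ≤ l * ‖z' - z‖ ^ 2 + l * ‖y - y'‖ ^ 2 := by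
    nlinarith [mul_nonneg hl.le (sq_nonneg (‖z' - z‖ - ‖y - y'‖))]
  nlinarith

/-- The projection inequality says that `y'` satisfies the first-order condition up to the gradient
mismatch, the error `δy` and 200l(y' - y). Hence 203 = 200 + 2 + 1, the last two from the variation
of the gradient in y and in the inner minimizer. -/
lemma saddle_distance (h : WeaklyConvexStronglyConcave Y φ gx gy l μ G) {x z : E}
    {y y' δy : F} (hy : y ∈ Y) (hy' : y' ∈ Y)
    (hproj : ∀ v ∈ Y, inner ℝ (y + (1 / (200 * l)) • (gy x y + δy) - y') (v - y') ≤ 0) :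
    ‖proxPoint gx l y' z - proxPoint gx l (saddleY Y φ gx l z) z‖ ^ 2
      ≤ 3 * l / μ * (‖x - proxPoint gx l y z‖ ^ 2 + 203 ^ 2 * ‖y' - y‖ ^ 2 + (‖δy‖ / l) ^ 2) := by
  have hl := h.l_pos
  have hμ := h.μ_pos
  set b := proxPoint gx l y' z with hb
  set a := proxPoint gx l y z with ha
  set e : F := (gy b y' - gy x y) - δy + (200 * l) • (y' - y) with he
  have h1 := h.dual_error_bound z hy' e (by
    intro v hv
    have h3 := hproj v hv
    have e3 : gy b y' - e = (200 * l) • (y + (1 / (200 * l)) • (gy x y + δy) - y') := by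
      rw [smul_sub, smul_add, smul_smul, mul_one_div_cancel (by positivity), one_smul, he, smul_sub]
      abel
    rw [← hb, e3, real_inner_smul_left]
    exact mul_nonpos_of_nonneg_of_nonpos (by positivity) h3)
  have h0 := h.proxPoint_lipschitz z z hy hy'
  rw [sub_self, norm_zero, mul_zero, add_zero, norm_sub_rev y, ← ha, ← hb] at h0
  have h2 : ‖e‖ ≤ l * ‖x - a‖ + 203 * l * ‖y' - y‖ + ‖δy‖ := by
    rw [he]
    refine (norm_add_le _ _).trans ?_
    rw [norm_smul, Real.norm_of_nonneg (by positivity)]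
    have h4 := norm_sub_le (gy b y' - gy x y) δy
    have h5 := h.lip_gy b x y' hy' y hy
    have h6 := norm_sub_le_norm_sub_add_norm_sub x a b
    rw [norm_sub_rev b x] at h5
    have h7 := mul_le_mul_of_nonneg_left (h6.trans (add_le_add_right h0 _)) hl.le
    linarith
  have h3 : ‖e‖ ^ 2 ≤ (l * ‖x - a‖ + 203 * l * ‖y' - y‖ + ‖δy‖) ^ 2 :=
    pow_le_pow_left₀ (norm_nonneg _) h2 2
  have h4 : (l * ‖x - a‖ + 203 * l * ‖y' - y‖ + ‖δy‖) ^ 2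
      ≤ 3 * (l ^ 2 * ‖x - a‖ ^ 2 + 203 ^ 2 * l ^ 2 * ‖y' - y‖ ^ 2 + ‖δy‖ ^ 2) := by
    nlinarith [sq_nonneg (l * ‖x - a‖ - 203 * l * ‖y' - y‖), sq_nonneg (l * ‖x - a‖ - ‖δy‖),
      sq_nonneg (203 * l * ‖y' - y‖ - ‖δy‖)]
  refine h1.trans ?_
  calc ‖e‖ ^ 2 / (l * μ) ≤ 3 * (l ^ 2 * ‖x - a‖ ^ 2 + 203 ^ 2 * l ^ 2 * ‖y' - y‖ ^ 2 + ‖δy‖ ^ 2)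
      / (l * μ) := by gcongr; exact h3.trans h4
    _ = _ := by field_simp

/-- The weight 2 on P is what makes the z-step a descent: P contributes 2(z - s) and -d contributes
-(z - b), where the saddle minimizer `s` and the new minimizer `b` are both close to `x'`. What
remains is (z - x') paired with z' - z, which equals -‖z' - z‖²/β. The other terms are absorbed by
the contraction in x and the ascent in y. -/
lemma potential_descent (h : WeaklyConvexStronglyConcave Y φ gx gy l μ G) (hμl : μ ≤ l) {β : ℝ}
    (hβ : β = μ / (100000 * l)) {x x' z z' δx : E} {y y' δy : F} (hy : y ∈ Y) (hy' : y' ∈ Y)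
    (hx : x' = x - (1 / (9 * l)) • (smoothedGrad gx l z y x + δx))
    (hproj : ∀ v ∈ Y, inner ℝ (y + (1 / (200 * l)) • (gy x y + δy) - y') (v - y') ≤ 0)
    (hz : z' = z + β • (x' - z)) :
    potential Y φ gx l x' y' z' + l / 30 * ‖x - proxPoint gx l y z‖ ^ 2
        + 100 * l * ‖y' - y‖ ^ 2 + l / β * ‖z' - z‖ ^ 2
      ≤ potential Y φ gx l x y z + 2 * l * (‖δx‖ / l) ^ 2 + l * (‖δy‖ / l) ^ 2 := by
  have hl := h.l_pos
  have hμ := h.μ_pos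
  have hβ0 : 0 < β := by rw [hβ]; positivity
  have hβ1 : β ≤ 1 / 100000 := by
    rw [hβ, div_le_div_iff₀ (by positivity) (by positivity)]; linarith
  have hA := h.proxPoint_tracking (z' := z') hy hy' hx
  have hB := h.dualValue_ascent (z := z) (z' := z') hy hy' hproj
  have hP := h.saddleValue_sub_le z z'
  have hS := h.saddle_distance (z := z) hy hy' hproj
  have hX := h.proxPoint_lipschitz z' z hy' hy'
  rw [sub_self, norm_zero, zero_add] at hX
  rw [norm_sub_sq_sub_norm_sub_sq] at hB hP
  simp only [potential]
  set s := proxPoint gx l (saddleY Y φ gx l z) z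
  set a := proxPoint gx l y z
  set b := proxPoint gx l y' z'
  set c := proxPoint gx l y' z
  have hd : z' - z = β • (x' - z) := by rw [hz]; abel
  have hcross : 2 * inner ℝ (z - s) (z' - z) - inner ℝ (z - b) (z' - z)
      ≤ -(‖z' - z‖ ^ 2 / β) + (‖x' - b‖ + 2 * (2 * ‖z' - z‖ + ‖c - s‖)) * ‖z' - z‖ := by
    have e1 : 2 * inner ℝ (z - s) (z' - z) - inner ℝ (z - b) (z' - z)
        = inner ℝ (z - x') (z' - z) + inner ℝ ((x' - b) + (2 : ℝ) • ((b - c) + (c - s))) (z' - z) := by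
      rw [← inner_add_left, ← real_inner_smul_left, ← inner_sub_left]
      congr 1
      simp only [smul_add, smul_sub, two_smul]
      abel
    have e2 : inner ℝ (z - x') (z' - z) = -(‖z' - z‖ ^ 2 / β) := by
      have : z - x' = (-(1 / β)) • (z' - z) := by
        rw [hd, smul_smul, neg_mul, one_div_mul_cancel hβ0.ne', neg_one_smul, neg_sub]
      rw [this, real_inner_smul_left, real_inner_self_eq_norm_sq]
      ring
    rw [e1, e2]
    gcongr
    refine (real_inner_le_norm _ _).trans ?_
    gcongr
    refine (norm_add_le _ _).trans ?_
    gcongr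
    rw [norm_smul, Real.norm_of_nonneg (by norm_num)]
    gcongr
    exact (norm_add_le _ _).trans (by gcongr)
  set u := ‖x - a‖
  set v := ‖y' - y‖
  set d := ‖z' - z‖
  set w := ‖x' - b‖
  set t := ‖c - s‖
  set p := ‖δx‖ / l
  set q := ‖δy‖ / l with hq
  have hw1 : 2 * (w * d) ≤ 1 / 4 * (d ^ 2 / β) + 4 * (β * w ^ 2) := by
    have : 1 / 4 * (d ^ 2 / β) + 4 * (β * w ^ 2) - 2 * (w * d) = (d - 4 * β * w) ^ 2 / (4 * β) := by
      field_simp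
      ring
    have : 0 ≤ (d - 4 * β * w) ^ 2 / (4 * β) := by positivity
    linarith
  have ht1 : 4 * (t * d) ≤ 1 / 4 * (d ^ 2 / β) + 16 * (β * t ^ 2) := by
    have : 1 / 4 * (d ^ 2 / β) + 16 * (β * t ^ 2) - 4 * (t * d) = (d - 8 * β * t) ^ 2 / (4 * β) := by
      field_simp
      ring
    have : 0 ≤ (d - 8 * β * t) ^ 2 / (4 * β) := by positivity
    linarith
  -- Here the choice of β cancels the factor l/μ of the error bound.
  have ht2 : 16 * (β * t ^ 2) ≤ 48 / 100000 * (u ^ 2 + 203 ^ 2 * v ^ 2 + q ^ 2) := by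
    have := mul_le_mul_of_nonneg_left hS hβ0.le
    have e : β * (3 * l / μ * (u ^ 2 + 203 ^ 2 * v ^ 2 + q ^ 2))
      = 3 / 100000 * (u ^ 2 + 203 ^ 2 * v ^ 2 + q ^ 2) := by rw [hβ]; field_simp
    linarith
  have hw2 : 4 * (β * w ^ 2)
      ≤ 4 / 100000 * (17 / 18 * u ^ 2 + p ^ 2 + 51 * v ^ 2 + 204 * d ^ 2) := by
    have : β * w ^ 2 ≤ 1 / 100000 * w ^ 2 := by gcongr
    linarith
  have hdβ : 100000 * d ^ 2 ≤ d ^ 2 / β := by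
    rw [le_div_iff₀ hβ0]; nlinarith [sq_nonneg d]
  have hqe : ‖δy‖ ^ 2 / (4 * l) = l * (1 / 4 * q ^ 2) := by rw [hq]; field_simp
  have hdl : l / β * d ^ 2 = l * (d ^ 2 / β) := by ring
  rw [hqe] at hB
  rw [hdl]
  set r := d ^ 2 / β
  have hx2 := mul_le_mul_of_nonneg_left hcross (by positivity : 0 ≤ 2 * l)
  -- The whole balance divided by l. Of the gain 2`r` from the z-step, one `r` is retained as
  -- descent and half an `r` pays for the cross terms; the terms in `d` ^ 2 are negligible against
  -- the rest since β ≤ 1/100000.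
  have key : w ^ 2 + u ^ 2 / 80 + d ^ 2 + 1 / 4 * q ^ 2 - 175 * v ^ 2 + d ^ 2 - 2 * r
      + 2 * ((w + 2 * (2 * d + t)) * d) - u ^ 2 + u ^ 2 / 30 + 100 * v ^ 2 + r
      ≤ 2 * p ^ 2 + q ^ 2 := by
    have e : 2 * ((w + 2 * (2 * d + t)) * d) = 2 * (w * d) + 8 * d ^ 2 + 4 * (t * d) := by ring
    rw [e]
    linarith [sq_nonneg u, sq_nonneg v, sq_nonneg p, sq_nonneg q, sq_nonneg d]
  have := mul_le_mul_of_nonneg_left key hl.le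
  nlinarith

end WeaklyConvexStronglyConcave
end InexactDescent

/-! ### From descent to the stationarity measures; bounds on the potential. -/

section InexactStationarity

variable {E F : Type*} [NormedAddCommGroup E] [InnerProductSpace ℝ E]
  [NormedAddCommGroup F] [InnerProductSpace ℝ F]

/-- Projected steps from `y` with step sizes `η ≤ ν` and directions `g + δ`, `g + r`. -/
lemma projected_step_le {y p q g δ r : F} {η ν : ℝ} (hη : 0 < η) (hην : η ≤ ν)
    (hp : inner ℝ (y + η • (g + δ) - p) (q - p) ≤ 0)
    (hq : inner ℝ (y + ν • (g + r) - q) (p - q) ≤ 0) :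
    ‖q - y‖ ≤ ν / η * ‖p - y‖ + ν * ‖δ - r‖ := by
  have hν : 0 < ν := hη.trans_le hην
  -- With these weights the common direction `g` cancels, leaving only the difference of the two
  -- perturbations.
  have e1 : ν • (y + η • (g + δ) - p) - η • (y + ν • (g + r) - q)
      = η • (q - p) - (ν - η) • (p - y) + (ν * η) • (δ - r) := by
    simp only [smul_sub, smul_add, sub_smul, smul_smul, mul_comm η ν]
    abel
  have h1 : inner ℝ (ν • (y + η • (g + δ) - p) - η • (y + ν • (g + r) - q)) (q - p) ≤ 0 := by
    rw [inner_sub_left, real_inner_smul_left, real_inner_smul_left]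
    have h2 : inner ℝ (y + ν • (g + r) - q) (q - p) = -inner ℝ (y + ν • (g + r) - q) (p - q) := by
      rw [← inner_neg_right, neg_sub]
    rw [h2]
    nlinarith
  rw [e1, inner_add_left, inner_sub_left, real_inner_smul_left, real_inner_smul_left,
    real_inner_smul_left, real_inner_self_eq_norm_sq] at h1
  have h2 := real_inner_le_norm (p - y) (q - p)
  have h3 := neg_le_of_abs_le (abs_real_inner_le_norm (δ - r) (q - p))
  have h4 := mul_le_mul_of_nonneg_left h2 (sub_nonneg.2 hην)
  have h5 := mul_le_mul_of_nonneg_left h3 (mul_pos hν hη).le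
  have h6 : η * ‖q - p‖ ≤ (ν - η) * ‖p - y‖ + ν * η * ‖δ - r‖ := by
    by_contra! hlt
    have hpos : 0 < ‖q - p‖ := by
      by_contra! h0
      have : ‖q - p‖ = 0 := le_antisymm h0 (norm_nonneg _)
      rw [this, mul_zero] at hlt
      have : 0 ≤ (ν - η) * ‖p - y‖ + ν * η * ‖δ - r‖ :=
        add_nonneg (mul_nonneg (sub_nonneg.2 hην) (norm_nonneg _)) (by positivity)
      linarith
    have := mul_lt_mul_of_pos_right hlt hpos
    nlinarith
  have h7 : ‖q - y‖ ≤ ‖q - p‖ + ‖p - y‖ := norm_sub_le_norm_sub_add_norm_sub q p y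
  have h8 : ν / η * ‖p - y‖ + ν * ‖δ - r‖ = (ν * ‖p - y‖ + ν * η * ‖δ - r‖) / η := by
    field_simp
  rw [h8, le_div_iff₀ hη]
  nlinarith

namespace WeaklyConvexStronglyConcave

variable {Y : Set F} {φ : E → F → ℝ} {gx : E → F → E} {gy : E → F → F} {l μ G : ℝ}
  [CompleteSpace E]

/-- The gradient of φ is the smoothed gradient minus 2l(x - z). The former is controlled by the
distance to its zero; the latter splits through `x'`, and x' - z is (z' - z)/β by the update of z.
-/
lemma gx_norm_le (h : WeaklyConvexStronglyConcave Y φ gx gy l μ G) {β : ℝ} (hβ : 0 < β)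
    {x x' z z' δx : E} {y : F} (hy : y ∈ Y)
    (hx : x' = x - (1 / (9 * l)) • (smoothedGrad gx l z y x + δx))
    (hz : z' = z + β • (x' - z)) :
    ‖gx x y‖ ≤ 4 * l * ‖x - proxPoint gx l y z‖ + 2 * l * (‖z' - z‖ / β) + ‖δx‖ := by
  have hl := h.l_pos
  have h1 := h.smoothedGrad_lipschitz z hy x (proxPoint gx l y z)
  rw [h.smoothedGrad_proxPoint z hy, sub_zero] at h1
  have e1 : gx x y = smoothedGrad gx l z y x - (2 * l) • (x - z) := by
    simp [smoothedGrad]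
  have e2 : ‖z' - z‖ / β = ‖x' - z‖ := by
    rw [hz, add_sub_cancel_left, norm_smul, Real.norm_of_nonneg hβ.le]
    field_simp
  have h2 : ‖x - z‖ ≤ ‖x - x'‖ + ‖x' - z‖ := norm_sub_le_norm_sub_add_norm_sub x x' z
  have h3 : ‖x - x'‖ ≤ 1 / (9 * l) * (‖smoothedGrad gx l z y x‖ + ‖δx‖) := by
    rw [hx, sub_sub_cancel, norm_smul, Real.norm_of_nonneg (by positivity)]
    gcongr
    exact norm_add_le _ _
  have h4 : ‖gx x y‖ ≤ ‖smoothedGrad gx l z y x‖ + 2 * l * ‖x - z‖ := by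
    rw [e1]
    refine (norm_sub_le _ _).trans ?_
    rw [norm_smul, Real.norm_of_nonneg (by positivity)]
  have h5 : 2 * l * ‖x - x'‖ ≤ 2 / 9 * (‖smoothedGrad gx l z y x‖ + ‖δx‖) := by
    calc _ ≤ 2 * l * (1 / (9 * l) * (‖smoothedGrad gx l z y x‖ + ‖δx‖)) := by gcongr
      _ = _ := by field_simp
  rw [e2]
  have h6 : 2 * l * ‖x - z‖ ≤ 2 * l * (‖x - x'‖ + ‖x' - z‖) := by gcongr
  have := norm_nonneg δx
  nlinarith [mul_nonneg hl.le (norm_nonneg (x - proxPoint gx l y z))]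

/-- One inexact step decreases the potential by a multiple of the stationarity measures, up to
the squared errors of the gradients. -/
lemma potential_stationarity (h : WeaklyConvexStronglyConcave Y φ gx gy l μ G) (hμl : μ ≤ l)
    {β : ℝ} (hβ : β = μ / (100000 * l)) {x x' z z' δx : E} {y y' q δy r : F}
    (hy : y ∈ Y) (hy' : y' ∈ Y) (hq : q ∈ Y)
    (hx : x' = x - (1 / (9 * l)) • (smoothedGrad gx l z y x + δx))
    (hproj : ∀ v ∈ Y, inner ℝ (y + (1 / (200 * l)) • (gy x y + δy) - y') (v - y') ≤ 0)
    (hqproj : ∀ v ∈ Y, inner ℝ (y + (1 / l) • (gy x y + r) - q) (v - q) ≤ 0)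
    (hz : z' = z + β • (x' - z)) :
    potential Y φ gx l x' y' z'
        + β / (12 * l) * (‖gx x y‖ ^ 2 + (l * ‖q - y‖) ^ 2 - 2 * ‖r‖ ^ 2)
      ≤ potential Y φ gx l x y z + 3 / l * (‖δx‖ ^ 2 + ‖δy‖ ^ 2) := by
  have hl := h.l_pos
  have hμ := h.μ_pos
  have hβ0 : 0 < β := by rw [hβ]; positivity
  have hβ1 : β ≤ 1 / 100000 := by
    rw [hβ, div_le_div_iff₀ (by positivity) (by positivity)]; linarith
  have h1 := h.potential_descent hμl hβ hy hy' hx hproj hz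
  have h2 := h.gx_norm_le hβ0 hy hx hz
  -- The steps 1/l of the stationarity measure and 1/(200l) of the method have ratio 200.
  have h3 : ‖q - y‖ ≤ 200 * ‖y' - y‖ + 1 / l * (‖δy‖ + ‖r‖) := by
    refine (projected_step_le (by positivity) ?_ (hproj q hq) (hqproj y' hy')).trans ?_
    · exact one_div_le_one_div_of_le hl (by linarith)
    · have : 1 / l / (1 / (200 * l)) = 200 := by field_simp
      rw [this]
      gcongr
      exact norm_sub_le _ _
  have h4 : l * ‖q - y‖ ≤ l * (200 * ‖y' - y‖ + ‖δy‖ / l) + ‖r‖ := by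
    calc _ ≤ l * (200 * ‖y' - y‖ + 1 / l * (‖δy‖ + ‖r‖)) := by gcongr
      _ = _ := by field_simp; ring
  set u := ‖x - proxPoint gx l y z‖
  set v := ‖y' - y‖
  have ed : ‖z' - z‖ = β * (‖z' - z‖ / β) := by field_simp
  set d := ‖z' - z‖ / β
  have ep : ‖δx‖ = l * (‖δx‖ / l) := by field_simp
  have eq : ‖δy‖ = l * (‖δy‖ / l) := by field_simp
  set a := ‖δx‖ / l
  set b := ‖δy‖ / l
  rw [ed] at h1
  rw [ep] at h2
  have h5 : ‖gx x y‖ ^ 2 ≤ l ^ 2 * (48 * u ^ 2 + 12 * d ^ 2 + 3 * a ^ 2) := by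
    have : ‖gx x y‖ ^ 2 ≤ (4 * l * u + 2 * l * d + l * a) ^ 2 :=
      pow_le_pow_left₀ (norm_nonneg _) h2 2
    have e : (4 * l * u + 2 * l * d + l * a) ^ 2 = l ^ 2 * (4 * u + 2 * d + a) ^ 2 := by ring
    rw [e] at this
    refine this.trans ?_
    refine mul_le_mul_of_nonneg_left ?_ (sq_nonneg l)
    linarith [sq_nonneg (4 * u - 2 * d), sq_nonneg (4 * u - a), sq_nonneg (2 * d - a)]
  have h6 : (l * ‖q - y‖) ^ 2 ≤ l ^ 2 * (160000 * v ^ 2 + 4 * b ^ 2) + 2 * ‖r‖ ^ 2 := by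
    have : (l * ‖q - y‖) ^ 2 ≤ (l * (200 * v + b) + ‖r‖) ^ 2 :=
      pow_le_pow_left₀ (by positivity) h4 2
    refine this.trans (add_sq_le.trans ?_)
    have h7 : (200 * v + b) ^ 2 ≤ 2 * ((200 * v) ^ 2 + b ^ 2) := add_sq_le
    have h8 := mul_le_mul_of_nonneg_left h7 (sq_nonneg l)
    rw [mul_pow l]
    linarith
  have h7 : β / (12 * l) * (‖gx x y‖ ^ 2 + (l * ‖q - y‖) ^ 2 - 2 * ‖r‖ ^ 2)
      ≤ l * (β * (4 * u ^ 2 + d ^ 2 + a ^ 2 + 40000 / 3 * v ^ 2 + b ^ 2)) := by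
    calc _ ≤ β / (12 * l) * (l ^ 2 * (48 * u ^ 2 + 12 * d ^ 2 + 12 * a ^ 2 + 160000 * v ^ 2
          + 12 * b ^ 2)) := by
          gcongr
          have ha := mul_nonneg (sq_nonneg l) (sq_nonneg a)
          have hb := mul_nonneg (sq_nonneg l) (sq_nonneg b)
          linarith
      _ = _ := by field_simp; ring
  have h8 : β * (4 * u ^ 2 + a ^ 2 + 40000 / 3 * v ^ 2 + b ^ 2)
      ≤ 1 / 100000 * (4 * u ^ 2 + a ^ 2 + 40000 / 3 * v ^ 2 + b ^ 2) := by gcongr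
  have e9 : l / β * (β * d) ^ 2 = l * (β * d ^ 2) := by field_simp
  have e10 : 3 / l * (‖δx‖ ^ 2 + ‖δy‖ ^ 2) = l * (3 * a ^ 2 + 3 * b ^ 2) := by
    rw [ep, eq]; field_simp
  rw [e9] at h1
  rw [e10]
  -- Only the term in `d` ^ 2 comes with a factor β on the descent side, so it alone fixes the rate
  -- β/(12l).
  have h11 : β * (4 * u ^ 2 + d ^ 2 + a ^ 2 + 40000 / 3 * v ^ 2 + b ^ 2) + 2 * a ^ 2 + b ^ 2
      ≤ u ^ 2 / 30 + 100 * v ^ 2 + β * d ^ 2 + 3 * a ^ 2 + 3 * b ^ 2 := by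
    nlinarith [sq_nonneg u, sq_nonneg v, sq_nonneg a, sq_nonneg b]
  have := mul_le_mul_of_nonneg_left h11 hl.le
  linarith

/-- Since d ≤ P, the potential is at least P, and P is at least a value of φ at the saddle
minimizer, at any y. -/
lemma le_potential (h : WeaklyConvexStronglyConcave Y φ gx gy l μ G) {low : ℝ}
    (hlow : ∀ x, ∃ y ∈ Y, low ≤ φ x y) (x : E) {y : F} (hy : y ∈ Y) (z : E) :
    low ≤ saddleValue Y φ gx l z ∧ low ≤ potential Y φ gx l x y z := by
  have hl := h.l_pos
  obtain ⟨v, hv, hlv⟩ := hlow (proxPoint gx l (saddleY Y φ gx l z) z)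
  have h1 := h.le_saddleValue z hv
  have h2 := h.dualValue_le_saddleValue z hy
  have h3 : 0 ≤ l * ‖proxPoint gx l (saddleY Y φ gx l z) z - z‖ ^ 2 := by positivity
  have h4 : 0 ≤ l * ‖x - proxPoint gx l y z‖ ^ 2 := by positivity
  rw [potential]
  constructor <;> linarith

/-- Quadratic growth bounds l‖x - x(y, z)‖² by twice the gap to d, so d enters three times in all.
Each is traded for P at the price `G` * `D`. -/
lemma potential_le (h : WeaklyConvexStronglyConcave Y φ gx gy l μ G) {low U D : ℝ}
    (hlow : ∀ x, ∃ y ∈ Y, low ≤ φ x y) (x : E) {y : F} (hy : y ∈ Y) (z : E)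
    (hU : ∀ v ∈ Y, φ x v ≤ U) (hD : ∀ v ∈ Y, ‖v - y‖ ≤ D) :
    potential Y φ gx l x y z - low ≤ 2 * (U + l * ‖x - z‖ ^ 2 - low) + 3 * G * D := by
  have hs := (h.saddleY_spec z).1
  have h1 := h.dualValue_le z x hs
  have h2 := h.dualValue_sub_le z hs hy
  have h3 := mul_le_mul_of_nonneg_left (hD _ hs) h.G_nonneg
  have h4 := h.dualValue_add_le z x hy
  have h5 := (h.le_potential hlow x hy z).1
  have h6 := hU _ hs
  have h7 := hU _ hy
  rw [potential]
  rw [← saddleValue.eq_def] at h1 h2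
  linarith

end WeaklyConvexStronglyConcave
end InexactStationarity

/-! ### Euclidean projection onto a compact convex set. -/

section Projection

variable {d : ℕ} {Y : Set (Vec d)}

lemma proj_spec (hc : Convex ℝ Y) (hk : IsCompact Y) (hn : Y.Nonempty) (y : Vec d) :
    proj Y y ∈ Y ∧ ∀ v ∈ Y, inner ℝ (y - proj Y y) (v - proj Y y) ≤ 0 := by
  have hex : ∃ p, IsNearest Y y p := by
    obtain ⟨p, hp, hmin⟩ := hk.exists_isMinOn hn
      (f := fun v => ‖y - v‖) (by fun_prop)
    exact ⟨p, hp, fun v hv => hmin hv⟩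
  have h : IsNearest Y y (proj Y y) := by
    rw [proj, dif_pos hex]
    exact hex.choose_spec
  refine ⟨h.1, (norm_eq_iInf_iff_real_inner_le_zero hc h.1).1 ?_⟩
  have : Nonempty Y := ⟨⟨_, h.1⟩⟩
  refine le_antisymm (le_ciInf fun v => h.2 v v.2) ?_
  exact ciInf_le ⟨0, by rintro _ ⟨v, rfl⟩; exact norm_nonneg _⟩ (⟨_, h.1⟩ : Y)

lemma proj_nonexpansive (hc : Convex ℝ Y) (hk : IsCompact Y) (hn : Y.Nonempty) :
    LipschitzWith 1 (proj Y) := by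
  refine LipschitzWith.of_dist_le_mul fun a b => ?_
  rw [NNReal.coe_one, one_mul, dist_eq_norm, dist_eq_norm]
  have ha := proj_spec hc hk hn a
  have hb := proj_spec hc hk hn b
  have h1 := ha.2 _ hb.1
  have h2 := hb.2 _ ha.1
  set p := proj Y a
  set q := proj Y b
  have e : inner ℝ (a - p) (q - p) + inner ℝ (b - q) (p - q)
      = ‖p - q‖ ^ 2 - inner ℝ (a - b) (p - q) := by
    rw [← neg_sub p q, inner_neg_right, ← real_inner_self_eq_norm_sq, ← inner_neg_left,
      ← inner_add_left, ← inner_sub_left]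
    congr 1
    abel
  have h3 := real_inner_le_norm (a - b) (p - q)
  by_contra! hlt
  have : 0 < ‖p - q‖ := (norm_nonneg _).trans_lt hlt
  nlinarith

end Projection

/-! ### Calculus: partial gradients, weak convexity, feasible directional derivatives. -/

section Gradients

variable {d₁ d₂ M : ℕ}

lemma DifferentiableAt.slice_x {g : Vec d₁ → Vec d₂ → ℝ} {x : Vec d₁} {y : Vec d₂}
    (h : DifferentiableAt ℝ (fun w : Vec d₁ × Vec d₂ => g w.1 w.2) (x, y)) :
    DifferentiableAt ℝ (fun x' => g x' y) x := by
  have : DifferentiableAt ℝ (fun x' : Vec d₁ => (x', y)) x := by fun_prop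
  exact DifferentiableAt.comp (f := fun x' : Vec d₁ => (x', y))
    (g := fun w : Vec d₁ × Vec d₂ => g w.1 w.2) x h this

lemma DifferentiableAt.slice_y {g : Vec d₁ → Vec d₂ → ℝ} {x : Vec d₁} {y : Vec d₂}
    (h : DifferentiableAt ℝ (fun w : Vec d₁ × Vec d₂ => g w.1 w.2) (x, y)) :
    DifferentiableAt ℝ (fun y' => g x y') y := by
  have : DifferentiableAt ℝ (fun y' : Vec d₂ => (x, y')) y := by fun_prop
  exact DifferentiableAt.comp (f := fun y' : Vec d₂ => (x, y'))
    (g := fun w : Vec d₁ × Vec d₂ => g w.1 w.2) y h this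

lemma hasGradientAt_average {E : Type*} [NormedAddCommGroup E] [InnerProductSpace ℝ E]
    [CompleteSpace E] {f : Fin M → E → ℝ} {x : E} (h : ∀ i, DifferentiableAt ℝ (f i) x) (c : ℝ) :
    HasGradientAt (fun x' => c * ∑ i, f i x') (c • ∑ i, gradient (f i) x) x := by
  rw [hasGradientAt_iff_hasFDerivAt, map_smul, map_sum]
  refine HasFDerivAt.const_mul ?_ c
  exact HasFDerivAt.fun_sum fun i _ => (h i).hasGradientAt.hasFDerivAt

lemma hasGradientAt_sq_dist {E : Type*} [NormedAddCommGroup E] [InnerProductSpace ℝ E]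
    [CompleteSpace E] (c : ℝ) (y₀ y : E) :
    HasGradientAt (fun y' => c * ‖y' - y₀‖ ^ 2) ((2 * c) • (y - y₀)) y := by
  rw [hasGradientAt_iff_hasFDerivAt]
  have h1 : HasFDerivAt (fun y' : E => y' - y₀) (ContinuousLinearMap.id ℝ E) y :=
    (hasFDerivAt_id y).sub_const y₀
  have h2 := (h1.norm_sq).const_mul c
  refine h2.congr_fderiv ?_
  ext v
  simp [InnerProductSpace.toDual_apply_apply]
  ring

/-- A function with Lipschitz gradient is weakly convex. -/
lemma weaklyConvex_of_lipschitz_gradient {E : Type*} [NormedAddCommGroup E]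
    [InnerProductSpace ℝ E] [CompleteSpace E] {f : E → ℝ} {l : ℝ}
    (hf : ∀ x, DifferentiableAt ℝ f x)
    (hl : ∀ x x', ‖gradient f x - gradient f x'‖ ≤ l * ‖x - x'‖) (x x' : E) :
    f x + inner ℝ (gradient f x) (x' - x) - l / 2 * ‖x' - x‖ ^ 2 ≤ f x' := by
  set v := x' - x with hv
  -- The quadratic compensates the largest possible decrease of the slope along the segment, so this
  -- function is nondecreasing.
  let h : ℝ → ℝ := fun t => f (x + t • v) - t * inner ℝ (gradient f x) v + l / 2 * t ^ 2 * ‖v‖ ^ 2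
  have hd : ∀ t, HasDerivAt h (inner ℝ (gradient f (x + t • v)) v
      - inner ℝ (gradient f x) v + l * t * ‖v‖ ^ 2) t := by
    intro t
    have h1 : HasDerivAt (fun t : ℝ => x + t • v) v t := by
      simpa using ((hasDerivAt_id t).smul_const v).const_add x
    have h2 : HasDerivAt (fun t : ℝ => f (x + t • v)) (inner ℝ (gradient f (x + t • v)) v) t := by
      exact ((hf (x + t • v)).hasGradientAt.hasFDerivAt.comp_hasDerivAt t h1).congr_deriv
        (InnerProductSpace.toDual_apply_apply ..)
    have h3 : HasDerivAt (fun t : ℝ => t * inner ℝ (gradient f x) v)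
        (inner ℝ (gradient f x) v) t := by
      simpa using (hasDerivAt_id t).mul_const (inner ℝ (gradient f x) v)
    have h4 : HasDerivAt (fun t : ℝ => l / 2 * t ^ 2 * ‖v‖ ^ 2) (l * t * ‖v‖ ^ 2) t := by
      have := ((hasDerivAt_pow 2 t).const_mul (l / 2)).mul_const (‖v‖ ^ 2)
      refine this.congr_deriv ?_
      push_cast
      ring
    exact (h2.sub h3).add h4
  have hmono : MonotoneOn h (Set.Icc 0 1) := by
    refine monotoneOn_of_deriv_nonneg (convex_Icc 0 1)
      (fun t _ => (hd t).continuousAt.continuousWithinAt)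
      (fun t _ => (hd t).differentiableAt.differentiableWithinAt) fun t ht => ?_
    rw [interior_Icc] at ht
    rw [(hd t).deriv, ← inner_sub_left]
    have h1 := neg_le_of_abs_le (abs_real_inner_le_norm (gradient f (x + t • v) - gradient f x) v)
    have h2 := hl (x + t • v) x
    rw [add_sub_cancel_left, norm_smul, Real.norm_of_nonneg ht.1.le] at h2
    have h3 := mul_le_mul_of_nonneg_right h2 (norm_nonneg v)
    nlinarith
  have := hmono (Set.left_mem_Icc.2 zero_le_one) (Set.right_mem_Icc.2 zero_le_one) zero_le_one
  simp only [h, zero_smul, add_zero, zero_mul, sub_zero, one_smul, one_mul, one_pow, mul_one,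
    ne_eq, OfNat.ofNat_ne_zero, not_false_eq_true, zero_pow, mul_zero] at this
  have e : x + v = x' := by rw [hv]; abel
  rw [e] at this
  linarith

/-- The directional derivative of a Lipschitz function, within a convex set. -/
lemma inner_gradient_le_of_lipschitzOn {E : Type*} [NormedAddCommGroup E]
    [InnerProductSpace ℝ E] [CompleteSpace E] {f : E → ℝ} {Y : Set E} (hc : Convex ℝ Y) {G : ℝ}
    (hG : ∀ y ∈ Y, ∀ y' ∈ Y, |f y - f y'| ≤ G * ‖y - y'‖) {y v : E} (hy : y ∈ Y) (hv : v ∈ Y)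
    (hf : DifferentiableAt ℝ f y) : inner ℝ (gradient f y) (v - y) ≤ G * ‖v - y‖ := by
  have h1 : HasDerivAt (fun t : ℝ => y + t • (v - y)) (v - y) 0 := by
    simpa using ((hasDerivAt_id (0 : ℝ)).smul_const (v - y)).const_add y
  have h2 : HasDerivAt (fun t : ℝ => f (y + t • (v - y))) (inner ℝ (gradient f y) (v - y)) 0 := by
    have hf' : HasFDerivAt f (InnerProductSpace.toDual ℝ E (gradient f y))
        (y + (0 : ℝ) • (v - y)) := by
      simpa using hf.hasGradientAt.hasFDerivAt
    exact (hf'.comp_hasDerivAt (0 : ℝ) h1).congr_deriv (InnerProductSpace.toDual_apply_apply ..)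
  -- Only the right derivative is usable: for t < 0 the point may leave `Y`.
  have h3 := h2.tendsto_slope_zero_right
  refine le_of_tendsto h3 ?_
  filter_upwards [Ioc_mem_nhdsGT (zero_lt_one (α := ℝ))] with t ht
  have hmem : y + t • (v - y) ∈ Y := by
    have := hc hy hv (a := 1 - t) (b := t) (by linarith [ht.2]) ht.1.le (by ring)
    have e : (1 - t) • y + t • v = y + t • (v - y) := by rw [sub_smul, one_smul, smul_sub]; abel
    rwa [e] at this
  have h4 := (le_abs_self _).trans (hG _ hmem y hy)
  rw [add_sub_cancel_left, norm_smul, Real.norm_of_nonneg ht.1.le] at h4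
  simp only [zero_add, zero_smul, add_zero, smul_eq_mul]
  rw [inv_mul_le_iff₀ ht.1]
  linarith

end Gradients

/-! ### The federated problem: averaged gradients and the regularized loss. -/

section ProblemFacts

variable {d₁ d₂ M : ℕ} {Ξ : Type*} [MeasurableSpace Ξ] {P : Problem d₁ d₂ M Ξ}
  {Y : Set (Vec d₂)} {l σ σG G D Φlow : ℝ}

lemma withLp_norm_fst_le {E F : Type*} [NormedAddCommGroup E] [NormedAddCommGroup F]
    (w : WithLp 2 (E × F)) : ‖w.fst‖ ≤ ‖w‖ := by
  refine le_of_sq_le_sq ?_ (norm_nonneg _)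
  rw [WithLp.prod_norm_sq_eq_of_L2]
  nlinarith [sq_nonneg ‖w.snd‖]

lemma withLp_norm_snd_le {E F : Type*} [NormedAddCommGroup E] [NormedAddCommGroup F]
    (w : WithLp 2 (E × F)) : ‖w.snd‖ ≤ ‖w‖ := by
  refine le_of_sq_le_sq ?_ (norm_nonneg _)
  rw [WithLp.prod_norm_sq_eq_of_L2]
  nlinarith [sq_nonneg ‖w.fst‖]

namespace Problem

lemma Smooth.hasGradientAt_loss_x (h : P.Smooth Y l) (x : Vec d₁) {y : Vec d₂} (hy : y ∈ Y) :
    HasGradientAt (fun x' => P.loss x' y)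
      ((1 / (M : ℝ)) • ∑ i, gradX (P.localLoss i) x y) x :=
  hasGradientAt_average (f := fun i x' => P.localLoss i x' y)
    (fun i => DifferentiableAt.slice_x (h.differentiable i x y hy)) _

lemma Smooth.hasGradientAt_loss_y (h : P.Smooth Y l) (x : Vec d₁) {y : Vec d₂} (hy : y ∈ Y) :
    HasGradientAt (fun y' => P.loss x y')
      ((1 / (M : ℝ)) • ∑ i, gradY (P.localLoss i) x y) y :=
  hasGradientAt_average (f := fun i y' => P.localLoss i x y')
    (fun i => DifferentiableAt.slice_y (h.differentiable i x y hy)) _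

lemma Smooth.grad_loss (h : P.Smooth Y l) (x : Vec d₁) {y : Vec d₂} (hy : y ∈ Y) :
    grad P.loss x y = (1 / (M : ℝ)) • ∑ i, grad (P.localLoss i) x y := by
  rw [grad, gradX, gradY, (h.hasGradientAt_loss_x x hy).gradient,
    (h.hasGradientAt_loss_y x hy).gradient]
  simp only [grad]
  rw [← WithLp.toLp_sum, ← WithLp.toLp_smul]
  congr 1
  ext1
  · simp [Prod.fst_sum]
  · simp [Prod.snd_sum]

lemma Smooth.grad_loss_lipschitz (h : P.Smooth Y l) (hl : 0 ≤ l) (x x' : Vec d₁) {y y' : Vec d₂}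
    (hy : y ∈ Y) (hy' : y' ∈ Y) :
    ‖grad P.loss x y - grad P.loss x' y'‖ ≤ l * (‖x - x'‖ + ‖y - y'‖) := by
  rw [h.grad_loss x hy, h.grad_loss x' hy', ← smul_sub, ← Finset.sum_sub_distrib, norm_smul,
    Real.norm_of_nonneg (by positivity)]
  rcases Nat.eq_zero_or_pos M with rfl | hM
  · simp only [Finset.univ_eq_empty, Finset.sum_empty, norm_zero, mul_zero]
    positivity
  have hM' : (0 : ℝ) < M := by exact_mod_cast hM
  calc _ ≤ 1 / (M : ℝ) * ∑ i : Fin M, l * (‖x - x'‖ + ‖y - y'‖) := by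
        gcongr
        exact (norm_sum_le _ _).trans (Finset.sum_le_sum fun i _ =>
          h.lipschitz i x x' y hy y' hy')
    _ = _ := by
        rw [Finset.sum_const, Finset.card_univ, Fintype.card_fin, nsmul_eq_mul]
        field_simp

lemma gradX_regularize (c : ℝ) (y₀ : Vec d₂) (i : Fin M) (ξ : Ξ) (x : Vec d₁) (y : Vec d₂) :
    gradX ((P.regularize c y₀).atSample i ξ) x y = gradX (P.atSample i ξ) x y := by
  simp only [gradX, atSample, regularize, gradient, fderiv_sub_const]

lemma Regular.gradY_regularize (h : P.Regular Y) (c : ℝ) (y₀ : Vec d₂) (i : Fin M) (ξ : Ξ)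
    (x : Vec d₁) {y : Vec d₂} (hy : y ∈ Y) :
    gradY ((P.regularize c y₀).atSample i ξ) x y
      = gradY (P.atSample i ξ) x y - (2 * c) • (y - y₀) := by
  have h1 := (DifferentiableAt.slice_y (g := fun x y => P.sampleLoss i x y ξ)
    (h.differentiable i ξ x y hy)).hasGradientAt
  have h2 := hasGradientAt_sq_dist c y₀ y
  have h3 : HasGradientAt (fun y' => P.sampleLoss i x y' ξ - c * ‖y' - y₀‖ ^ 2)
      (gradient (fun y' => P.sampleLoss i x y' ξ) y - (2 * c) • (y - y₀)) y := by
    rw [hasGradientAt_iff_hasFDerivAt, map_sub]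
    exact h1.hasFDerivAt.sub h2.hasFDerivAt
  exact h3.gradient

end Problem

namespace NonconvexConcave

lemma nonempty (N : NonconvexConcave P Y l σ σG G D Φlow) (hD : 0 < D) : Y.Nonempty := by
  by_contra h
  rw [Set.not_nonempty_iff_eq_empty] at h
  have := N.diam_eq
  rw [h, Metric.diam_empty] at this
  exact hD.ne this

lemma norm_sub_le (N : NonconvexConcave P Y l σ σG G D Φlow) {y y' : Vec d₂} (hy : y ∈ Y)
    (hy' : y' ∈ Y) : ‖y - y'‖ ≤ D := by
  rw [← N.diam_eq, ← dist_eq_norm]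
  exact Metric.dist_le_diam_of_mem N.compact.isBounded hy hy'

lemma loss_le_primal (N : NonconvexConcave P Y l σ σG G D Φlow) (hG : 0 ≤ G) (x : Vec d₁)
    {y : Vec d₂} (hy : y ∈ Y) : P.loss x y ≤ P.primal Y x := by
  refine le_ciSup (f := fun y : Y => P.loss x y) ⟨P.loss x y + G * D, ?_⟩ ⟨y, hy⟩
  rintro _ ⟨v, rfl⟩
  have h1 := (le_abs_self _).trans (N.lipschitz x v v.2 y hy)
  have h2 := mul_le_mul_of_nonneg_left (N.norm_sub_le v.2 hy) hG
  simp only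
  linarith

/-- The assumption bounds a supremum; compactness makes it attained, which is the form that
`le_potential` takes. -/
lemma exists_primal_eq (N : NonconvexConcave P Y l σ σG G D Φlow) (hG : 0 ≤ G) (hD : 0 < D)
    (x : Vec d₁) : ∃ y ∈ Y, Φlow ≤ P.loss x y := by
  have hcont : ContinuousOn (fun y => P.loss x y) Y := by
    refine (LipschitzOnWith.of_dist_le_mul (K := Real.toNNReal G) ?_).continuousOn
    intro y hy y' hy'
    rw [Real.coe_toNNReal _ hG, Real.dist_eq, dist_eq_norm]
    exact N.lipschitz x y hy y' hy'
  obtain ⟨ys, hys, hmax⟩ := N.compact.exists_isMaxOn (N.nonempty hD) hcont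
  refine ⟨ys, hys, (N.lower_bound x).trans ?_⟩
  have : Nonempty Y := ⟨⟨ys, hys⟩⟩
  exact ciSup_le fun v => hmax v.2

/-- Lipschitz continuity on Y controls the gradient only along feasible directions; its component
normal to Y may be large. This one-sided bound is enough for projected steps. -/
lemma inner_gradY_le (N : NonconvexConcave P Y l σ σG G D Φlow) (x : Vec d₁) {y v : Vec d₂}
    (hy : y ∈ Y) (hv : v ∈ Y) : inner ℝ (gradY P.loss x y) (v - y) ≤ G * ‖v - y‖ :=
  inner_gradient_le_of_lipschitzOn N.convex (fun y hy y' hy' => N.lipschitz x y hy y' hy') hy hv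
    (N.smooth.hasGradientAt_loss_y x hy).differentiableAt

/-- The regularized loss fits the analysis of inexact smoothed gradient descent-ascent. -/
lemma weaklyConvexStronglyConcave (N : NonconvexConcave P Y l σ σG G D Φlow) (hl : 0 < l)
    (hG : 0 ≤ G) (hD : 0 < D) {μ : ℝ} (hμ : 0 < μ) (hμl : μ ≤ l) {y₀ : Vec d₂} (hy₀ : y₀ ∈ Y) :
    WeaklyConvexStronglyConcave Y (fun x y => P.loss x y - μ / 2 * ‖y - y₀‖ ^ 2)
      (gradX P.loss) (fun x y => gradY P.loss x y - μ • (y - y₀)) l μ (G + μ * D) where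
  l_pos := hl
  μ_pos := hμ
  G_nonneg := by positivity
  convex := N.convex
  compact := N.compact
  nonempty := N.nonempty hD
  lower_x x x' y hy := by
    have := weaklyConvex_of_lipschitz_gradient (f := fun x => P.loss x y) (l := l)
      (fun x => (N.smooth.hasGradientAt_loss_x x hy).differentiableAt) (fun a b => by
        have := (withLp_norm_fst_le _).trans (N.smooth.grad_loss_lipschitz hl.le a b hy hy)
        rwa [sub_self, norm_zero, add_zero] at this) x x'
    rw [gradX]
    linarith
  upper_y x y hy y' hy' := by
    have h1 := N.concave x y hy y' hy'
    rw [inner_sub_left, real_inner_smul_left]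
    have e : ‖y - y₀‖ ^ 2 = ‖y - y'‖ ^ 2 + 2 * inner ℝ (y' - y₀) (y - y') + ‖y' - y₀‖ ^ 2 := by
      rw [← sub_add_sub_cancel y y' y₀, norm_add_sq_real, real_inner_comm]
    rw [e]
    linarith
  lip_gx x x' y hy y' hy' :=
    (withLp_norm_fst_le _).trans (N.smooth.grad_loss_lipschitz hl.le x x' hy hy')
  lip_gy x x' y hy y' hy' := by
    have h1 := (withLp_norm_snd_le _).trans (N.smooth.grad_loss_lipschitz hl.le x x' hy hy')
    have e : gradY P.loss x y - μ • (y - y₀) - (gradY P.loss x' y' - μ • (y' - y₀))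
        = (gradY P.loss x y - gradY P.loss x' y') - μ • (y - y') := by
      simp only [smul_sub]; abel
    rw [e]
    refine (_root_.norm_sub_le _ _).trans ?_
    rw [norm_smul, Real.norm_of_nonneg hμ.le]
    have h2 : ‖gradY P.loss x y - gradY P.loss x' y'‖ ≤ l * (‖x - x'‖ + ‖y - y'‖) := h1
    have h3 := mul_le_mul_of_nonneg_right hμl (norm_nonneg (y - y'))
    linarith
  lip_y x y hy y' hy' := by
    have h1 := (le_abs_self _).trans (N.lipschitz x y hy y' hy')
    have h2 : ‖y' - y₀‖ ≤ ‖y - y'‖ + ‖y - y₀‖ := by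
      rw [norm_sub_rev y y', ← sub_add_sub_cancel y' y y₀]; exact norm_add_le _ _
    have h3 := N.norm_sub_le hy hy₀
    have h4 := N.norm_sub_le hy' hy₀
    have h5 : ‖y' - y₀‖ ^ 2 - ‖y - y₀‖ ^ 2 ≤ 2 * (D * ‖y - y'‖) := by
      nlinarith [norm_nonneg (y - y₀), norm_nonneg (y' - y₀), norm_nonneg (y - y')]
    have h6 := mul_le_mul_of_nonneg_left h5 (by positivity : 0 ≤ μ / 2)
    linarith

end NonconvexConcave
end ProblemFacts

/-! ### Martingale arguments on product measures by resampling one coordinate. -/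

section Resampling

variable {ι : Type*} [Fintype ι] {α : ι → Type*} [∀ i, MeasurableSpace (α i)]
  {ν : ∀ i, Measure (α i)} [∀ i, IsProbabilityMeasure (ν i)]
  {H : Type*} [NormedAddCommGroup H] [InnerProductSpace ℝ H]

/-- Replacing one coordinate by an independent copy preserves a product measure. -/
lemma measurePreserving_update [DecidableEq ι] (ν : ∀ i, Measure (α i))
    [∀ i, IsProbabilityMeasure (ν i)] (j : ι) :
    MeasurePreserving (fun p : (∀ i, α i) × α j => Function.update p.1 j p.2)
      ((Measure.pi ν).prod (ν j)) (Measure.pi ν) := by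
  have hm : Measurable (fun p : (∀ i, α i) × α j => Function.update p.1 j p.2) :=
    measurable_update'
  refine ⟨hm, ?_⟩
  refine (Measure.pi_eq fun s hs => ?_).symm
  rw [Measure.map_apply hm (MeasurableSet.univ_pi hs)]
  have e : (fun p : (∀ i, α i) × α j => Function.update p.1 j p.2) ⁻¹' (Set.univ.pi s)
      = (Set.univ.pi (Function.update s j Set.univ)) ×ˢ (s j) := by
    ext ⟨ω, t⟩
    simp only [Set.mem_preimage, Set.mem_univ_pi, Set.mem_prod]
    constructor
    · intro h
      refine ⟨fun i => ?_, by simpa using h j⟩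
      by_cases hij : i = j
      · subst hij; simp
      · simpa [hij] using h i
    · rintro ⟨h1, h2⟩ i
      by_cases hij : i = j
      · subst hij; simpa using h2
      · simpa [hij] using h1 i
  rw [e, Measure.prod_prod, Measure.pi_pi]
  rw [← Finset.prod_erase_mul _ _ (Finset.mem_univ j),
    ← Finset.prod_erase_mul _ (fun i => ν i (s i)) (Finset.mem_univ j)]
  simp only [Function.update_self, measure_univ, mul_one]
  congr 1
  refine Finset.prod_congr rfl fun i hi => ?_
  rw [Function.update_of_ne (Finset.ne_of_mem_erase hi)]

/-- This stands in for conditioning on all coordinates but `j`. -/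
lemma integral_resample [DecidableEq ι] {E : Type*} [NormedAddCommGroup E] [NormedSpace ℝ E]
    {F : (∀ i, α i) → E}
    (hF : Integrable F (Measure.pi ν)) (j : ι) :
    ∫ ω, F ω ∂(Measure.pi ν) = ∫ ω, ∫ t, F (Function.update ω j t) ∂(ν j) ∂(Measure.pi ν) := by
  have hp := measurePreserving_update ν j
  have hint : Integrable (fun p : (∀ i, α i) × α j => F (Function.update p.1 j p.2))
      ((Measure.pi ν).prod (ν j)) := hp.integrable_comp_of_integrable hF
  rw [← integral_prod (fun p : (∀ i, α i) × α j => F (Function.update p.1 j p.2)) hint]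
  conv_lhs => rw [← hp.map_eq]
  exact integral_map hp.measurable.aemeasurable (by rw [hp.map_eq]; exact hF.aestronglyMeasurable)

lemma lintegral_resample [DecidableEq ι] {F : (∀ i, α i) → ENNReal}
    (hF : Measurable F) (j : ι) :
    ∫⁻ ω, F ω ∂(Measure.pi ν) = ∫⁻ ω, ∫⁻ t, F (Function.update ω j t) ∂(ν j) ∂(Measure.pi ν) := by
  have hp := measurePreserving_update ν j
  rw [← lintegral_prod (fun p : (∀ i, α i) × α j => F (Function.update p.1 j p.2))
    (hF.comp hp.measurable).aemeasurable]
  conv_lhs => rw [← hp.map_eq]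
  exact lintegral_map hF hp.measurable

lemma integrable_inner_of_memLp {β : Type*} [MeasurableSpace β] {ρ : Measure β} {A B : β → H}
    (hA : MemLp A 2 ρ) (hB : MemLp B 2 ρ) : Integrable (fun ω => inner ℝ (A ω) (B ω)) ρ := by
  have h1 := (memLp_two_iff_integrable_sq_norm hA.1).1 hA
  have h2 := (memLp_two_iff_integrable_sq_norm hB.1).1 hB
  refine (h1.add h2).mono' (hA.1.inner hB.1) (Filter.Eventually.of_forall fun ω => ?_)
  have := norm_inner_le_norm (𝕜 := ℝ) (A ω) (B ω)
  simp only [Pi.add_apply]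
  nlinarith [sq_nonneg (‖A ω‖ - ‖B ω‖), norm_nonneg (A ω), norm_nonneg (B ω)]

/-- A square-integrable function on a product space whose conditional second moment given all
coordinates but one is bounded. -/
lemma memLp_two_of_resample [DecidableEq ι] {H : Type*} [NormedAddCommGroup H]
    {F : (∀ i, α i) → H}
    (hF : AEStronglyMeasurable F (Measure.pi ν)) (hFm : Measurable fun ω => ‖F ω‖) (j : ι) {s : ℝ}
    (hs : 0 ≤ s)
    (hint : ∀ ω, Integrable (fun t => ‖F (Function.update ω j t)‖ ^ 2) (ν j))
    (hle : ∀ ω, ∫ t, ‖F (Function.update ω j t)‖ ^ 2 ∂(ν j) ≤ s) :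
    MemLp F 2 (Measure.pi ν) ∧ ∫ ω, ‖F ω‖ ^ 2 ∂(Measure.pi ν) ≤ s := by
  have h1 : ∫⁻ ω, ENNReal.ofReal (‖F ω‖ ^ 2) ∂(Measure.pi ν) ≤ ENNReal.ofReal s := by
    rw [lintegral_resample (by fun_prop) j]
    calc _ ≤ ∫⁻ _, ENNReal.ofReal s ∂(Measure.pi ν) := by
          refine lintegral_mono fun ω => ?_
          rw [← ofReal_integral_eq_lintegral_ofReal (hint ω)
            (Filter.Eventually.of_forall fun _ => by positivity)]
          exact ENNReal.ofReal_le_ofReal (hle ω)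
      _ = _ := by simp
  have h2 : Integrable (fun ω => ‖F ω‖ ^ 2) (Measure.pi ν) := by
    refine ⟨(hFm.pow_const 2).aestronglyMeasurable, ?_⟩
    rw [hasFiniteIntegral_iff_ofReal (Filter.Eventually.of_forall fun _ => by positivity)]
    exact h1.trans_lt ENNReal.ofReal_lt_top
  refine ⟨(memLp_two_iff_integrable_sq_norm hF).2 h2, ?_⟩
  rw [← ENNReal.ofReal_le_ofReal_iff hs, ofReal_integral_eq_lintegral_ofReal h2
    (Filter.Eventually.of_forall fun _ => by positivity)]
  exact h1

/-- As `A` ignores coordinate `j`, averaging over that coordinate acts on `B` alone. -/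
lemma integral_inner_eq_zero_of_resample [DecidableEq ι] [CompleteSpace H] {A B : (∀ i, α i) → H}
    (hA : MemLp A 2 (Measure.pi ν)) (hB : MemLp B 2 (Measure.pi ν)) (j : ι)
    (hinv : ∀ ω t, A (Function.update ω j t) = A ω)
    (hint : ∀ ω, Integrable (fun t => B (Function.update ω j t)) (ν j))
    (hzero : ∀ ω, ∫ t, B (Function.update ω j t) ∂(ν j) = 0) :
    ∫ ω, inner ℝ (A ω) (B ω) ∂(Measure.pi ν) = 0 := by
  rw [integral_resample (integrable_inner_of_memLp hA hB) j]
  simp only [hinv]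
  have : ∀ ω, ∫ t, inner ℝ (A ω) (B (Function.update ω j t)) ∂(ν j) = 0 := fun ω => by
    rw [integral_inner (hint ω), hzero, inner_zero_right]
  simp [this]

/-- The second moment of a sum of martingale differences. -/
lemma integral_norm_sum_sq [LinearOrder ι] [CompleteSpace H] {N : ι → (∀ i, α i) → H}
    (S : Finset ι) (hN : ∀ i, MemLp (N i) 2 (Measure.pi ν))
    (hinv : ∀ i j, i < j → ∀ ω t, N i (Function.update ω j t) = N i ω)
    (hint : ∀ j ω, Integrable (fun t => N j (Function.update ω j t)) (ν j))
    (hzero : ∀ j ω, ∫ t, N j (Function.update ω j t) ∂(ν j) = 0) :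
    ∫ ω, ‖∑ i ∈ S, N i ω‖ ^ 2 ∂(Measure.pi ν) = ∑ i ∈ S, ∫ ω, ‖N i ω‖ ^ 2 ∂(Measure.pi ν) := by
  -- Of two distinct terms, the earlier does not see the later coordinate, over which the later term
  -- averages to zero.
  have horth : ∀ i j, i ≠ j → ∫ ω, inner ℝ (N i ω) (N j ω) ∂(Measure.pi ν) = 0 := by
    intro i j hij
    rcases lt_or_gt_of_ne hij with h | h
    · exact integral_inner_eq_zero_of_resample (hN i) (hN j) j (hinv i j h) (hint j) (hzero j)
    · simp only [real_inner_comm (N j _)]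
      exact integral_inner_eq_zero_of_resample (hN j) (hN i) i (hinv j i h) (hint i) (hzero i)
  simp only [← real_inner_self_eq_norm_sq, sum_inner, inner_sum]
  rw [integral_finsetSum _ fun i _ => integrable_finsetSum _ fun j _ =>
    integrable_inner_of_memLp (hN j) (hN i)]
  refine Finset.sum_congr rfl fun i hi => ?_
  rw [integral_finsetSum _ fun j _ => integrable_inner_of_memLp (hN j) (hN i)]
  rw [Finset.sum_eq_single i]
  · intro j _ hji
    exact horth j i hji
  · exact fun h => absurd hi h

end Resampling

/-- Discrete Grönwall inequality. -/
lemma le_pow_mul_sum_of_le {d a : ℕ → ℝ} {q : ℝ} {K : ℕ} (hq : 0 ≤ q) (ha : ∀ k, 0 ≤ a k)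
    (h0 : d 0 = 0) (hd : ∀ k < K, d (k + 1) ≤ (1 + q) * d k + a k) {k : ℕ} (hk : k ≤ K) :
    d k ≤ (1 + q) ^ k * ∑ j ∈ Finset.range k, a j := by
  induction k with
  | zero => simp [h0]
  | succ k ih =>
    have h1 := mul_le_mul_of_nonneg_left (ih (by omega)) (by positivity : 0 ≤ 1 + q)
    have h2 : a k ≤ (1 + q) ^ (k + 1) * a k :=
      le_mul_of_one_le_left (ha k) (one_le_pow₀ (by linarith))
    rw [Finset.sum_range_succ, mul_add, pow_succ']
    have := hd k (by omega)
    rw [pow_succ'] at h2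
    linarith

/-! ### Local iterates: adaptedness, measurability, noise. -/

section LocalUpdates

variable {d₁ d₂ M : ℕ} {Ξ : Type*} [MeasurableSpace Ξ] {P : Problem d₁ d₂ M Ξ}
  {Y : Set (Vec d₂)} {l σ σG G D Φlow : ℝ}

namespace NonconvexConcave

lemma localIter_mem (N : NonconvexConcave P Y l σ σG G D Φlow) (Q : Problem d₁ d₂ M Ξ)
    (θ : Params) (i : Fin M) (ξ : Fin θ.K → Ξ) {w : Vec d₁ × Vec d₂} (hw : w.2 ∈ Y) (k : ℕ) :
    (localIter Q Y θ i ξ w k).2 ∈ Y := by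
  induction k with
  | zero => exact hw
  | succ k ih =>
    rw [localIter]
    split_ifs
    · exact (proj_spec N.convex N.compact ⟨_, hw⟩ _).1
    · exact ih

end NonconvexConcave

/-- Adaptedness: the k-th iterate uses only data points of index below k, hence the non-strict `k ≤
j`. -/
lemma localIter_update (Q : Problem d₁ d₂ M Ξ) (Y : Set (Vec d₂))
    (θ : Params) (i : Fin M) (ξ : Fin θ.K → Ξ) (w : Vec d₁ × Vec d₂) (j : Fin θ.K) (t : Ξ)
    {k : ℕ} (hk : k ≤ j) :
    localIter Q Y θ i (Function.update ξ j t) w k = localIter Q Y θ i ξ w k := by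
  induction k with
  | zero => rfl
  | succ k ih =>
    have hne : ∀ h : k < θ.K, (⟨k, h⟩ : Fin θ.K) ≠ j := fun h e => by
      have := congrArg Fin.val e
      simp only at this
      omega
    rw [localIter, localIter, ih (by omega)]
    simp only [Function.update_of_ne (hne _)]

/-- The noise of the sample gradient of client `i` at its `k`-th local update. -/
def localNoise (P Q : Problem d₁ d₂ M Ξ) (Y : Set (Vec d₂)) (θ : Params) (i : Fin M)
    (w : Vec d₁ × Vec d₂) (k : Fin θ.K) (ξ : Fin θ.K → Ξ) : WithLp 2 (Vec d₁ × Vec d₂) :=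
  grad (P.atSample i (ξ k)) (localIter Q Y θ i ξ w k).1 (localIter Q Y θ i ξ w k).2
    - grad (P.localLoss i) (localIter Q Y θ i ξ w k).1 (localIter Q Y θ i ξ w k).2

/-- The iterates of a client, as points of `X × Y`. -/
def localPoint (N : NonconvexConcave P Y l σ σG G D Φlow) (Q : Problem d₁ d₂ M Ξ)
    (θ : Params) (i : Fin M) (k : ℕ) (p : (Vec d₁ × Y) × (Fin θ.K → Ξ)) : Vec d₁ × Y :=
  ((localIter Q Y θ i p.2 (p.1.1, p.1.2) k).1,
    ⟨(localIter Q Y θ i p.2 (p.1.1, p.1.2) k).2, N.localIter_mem Q θ i p.2 p.1.2.2 k⟩)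

namespace NonconvexConcave

/-- The sample gradients are measurable only over points of Y, so the recursion runs in the subtype
rather than in the ambient space. -/
lemma measurable_localPoint (N : NonconvexConcave P Y l σ σG G D Φlow) (c : ℝ) {y₀ : Vec d₂}
    (hy₀ : y₀ ∈ Y) (θ : Params) (i : Fin M) (k : ℕ) :
    Measurable (localPoint N (P.regularize c y₀) θ i k) := by
  induction k with
  | zero => exact measurable_fst
  | succ k ih =>
    by_cases hk : k < θ.K
    · have h0 : Measurable fun p : (Vec d₁ × Y) × (Fin θ.K → Ξ) => p.2 ⟨k, hk⟩ :=
        (measurable_pi_apply _).comp measurable_snd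
      have h1 : Measurable fun p : (Vec d₁ × Y) × (Fin θ.K → Ξ) =>
          ((localPoint N (P.regularize c y₀) θ i k p).1,
            (localPoint N (P.regularize c y₀) θ i k p).2, p.2 ⟨k, hk⟩) :=
        ih.fst.prodMk (ih.snd.prodMk h0)
      have hx := (N.regular.measurable_gradX i).comp h1
      have hy := (N.regular.measurable_gradY i).comp h1
      refine Measurable.prodMk ?_ (Measurable.subtype_mk ?_)
      · have : (fun p : (Vec d₁ × Y) × (Fin θ.K → Ξ) =>
            (localIter (P.regularize c y₀) Y θ i p.2 (p.1.1, p.1.2) (k + 1)).1)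
            = fun p => (localPoint N (P.regularize c y₀) θ i k p).1 - θ.ηxl •
              gradX (P.atSample i (p.2 ⟨k, hk⟩)) (localPoint N (P.regularize c y₀) θ i k p).1
                (localPoint N (P.regularize c y₀) θ i k p).2 := by
          funext p
          rw [localIter]
          simp only [hk, dif_pos, Problem.gradX_regularize]
          rfl
        rw [this]
        exact ih.fst.sub (hx.const_smul θ.ηxl)
      · have : (fun p : (Vec d₁ × Y) × (Fin θ.K → Ξ) =>
            (localIter (P.regularize c y₀) Y θ i p.2 (p.1.1, p.1.2) (k + 1)).2)
            = fun p => proj Y (((localPoint N (P.regularize c y₀) θ i k p).2 : Vec d₂) + θ.ηyl •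
              (gradY (P.atSample i (p.2 ⟨k, hk⟩)) (localPoint N (P.regularize c y₀) θ i k p).1
                (localPoint N (P.regularize c y₀) θ i k p).2
                - (2 * c) • (((localPoint N (P.regularize c y₀) θ i k p).2 : Vec d₂) - y₀))) := by
          funext p
          rw [localIter]
          simp only [hk, dif_pos,
            N.regular.gradY_regularize c y₀ i _ _
              (N.localIter_mem _ θ i p.2 (w := (p.1.1, p.1.2)) p.1.2.2 k)]
          rfl
        rw [this]
        refine (proj_nonexpansive N.convex N.compact ⟨_, hy₀⟩).continuous.measurable.comp ?_
        have hv : Measurable fun p => ((localPoint N (P.regularize c y₀) θ i k p).2 : Vec d₂) :=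
          measurable_subtype_coe.comp ih.snd
        exact hv.add ((hy.sub ((hv.sub_const y₀).const_smul (2 * c))).const_smul θ.ηyl)
    · have : localPoint N (P.regularize c y₀) θ i (k + 1)
          = localPoint N (P.regularize c y₀) θ i k := by
        funext p
        have e : localIter (P.regularize c y₀) Y θ i p.2 (p.1.1, p.1.2) (k + 1)
            = localIter (P.regularize c y₀) Y θ i p.2 (p.1.1, p.1.2) k := by
          rw [localIter]; simp only [hk, dif_neg, not_false_eq_true]
        simp only [localPoint, e]
      rw [this]
      exact ih

lemma continuous_grad_localLoss (N : NonconvexConcave P Y l σ σG G D Φlow) (hl : 0 ≤ l)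
    (i : Fin M) : Continuous fun q : Vec d₁ × Y => grad (P.localLoss i) q.1 q.2 := by
  refine (LipschitzWith.of_dist_le_mul (K := Real.toNNReal (2 * l)) fun p q => ?_).continuous
  rw [Real.coe_toNNReal _ (by positivity), dist_eq_norm]
  refine (N.smooth.lipschitz i p.1 q.1 _ p.2.2 _ q.2.2).trans ?_
  have h1 : ‖p.1 - q.1‖ ≤ dist p q := by rw [← dist_eq_norm]; exact le_max_left _ _
  have h2 : ‖(p.2 : Vec d₂) - q.2‖ ≤ dist p q := by
    rw [← dist_eq_norm]; exact le_max_right (dist p.1 q.1) (dist p.2 q.2)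
  nlinarith

lemma continuous_grad_loss (N : NonconvexConcave P Y l σ σG G D Φlow) (hl : 0 ≤ l) :
    Continuous fun q : Vec d₁ × Y => grad P.loss q.1 q.2 := by
  have : (fun q : Vec d₁ × Y => grad P.loss q.1 q.2)
      = fun q => (1 / (M : ℝ)) • ∑ i, grad (P.localLoss i) q.1 q.2 := by
    funext q
    exact N.smooth.grad_loss q.1 q.2.2
  rw [this]
  exact (continuous_finsetSum Finset.univ fun i _ =>
    N.continuous_grad_localLoss hl i).const_smul (1 / (M : ℝ))

lemma measurable_grad_atSample (N : NonconvexConcave P Y l σ σG G D Φlow) (i : Fin M) :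
    Measurable fun q : Vec d₁ × Y × Ξ => grad (P.atSample i q.2.2) q.1 (q.2.1 : Vec d₂) :=
  (WithLp.measurable_toLp 2 (Vec d₁ × Vec d₂)).comp
    ((N.regular.measurable_gradX i).prodMk (N.regular.measurable_gradY i))

lemma measurable_localNoise (N : NonconvexConcave P Y l σ σG G D Φlow) (hl : 0 ≤ l) (c : ℝ)
    {y₀ : Vec d₂} (hy₀ : y₀ ∈ Y) (θ : Params) (i : Fin M) {w : Vec d₁ × Vec d₂} (hw : w.2 ∈ Y)
    (k : Fin θ.K) : Measurable (localNoise P (P.regularize c y₀) Y θ i w k) := by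
  have h1 : Measurable fun ξ : Fin θ.K → Ξ =>
      localPoint N (P.regularize c y₀) θ i k ((w.1, ⟨w.2, hw⟩), ξ) :=
    (N.measurable_localPoint c hy₀ θ i k).comp measurable_prodMk_left
  have h2 := (N.measurable_grad_atSample i).comp
    (h1.fst.prodMk (h1.snd.prodMk (measurable_pi_apply k)))
  have h3 := (N.continuous_grad_localLoss hl i).measurable.comp h1
  exact h2.sub h3

variable (P) in
/-- The law of the data points that client `i` uses in one round. -/
abbrev _root_.FedMinimax.clientLaw (i : Fin M) (K : ℕ) : Measure (Fin K → Ξ) :=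
  Measure.pi fun _ : Fin K => (P.dist i : Measure Ξ)

lemma localNoise_update {Q : Problem d₁ d₂ M Ξ} (θ : Params) (i : Fin M)
    (w : Vec d₁ × Vec d₂) (k : Fin θ.K) (ξ : Fin θ.K → Ξ) (t : Ξ) :
    localNoise P Q Y θ i w k (Function.update ξ k t)
      = grad (P.atSample i t) (localIter Q Y θ i ξ w k).1 (localIter Q Y θ i ξ w k).2
        - grad (P.localLoss i) (localIter Q Y θ i ξ w k).1 (localIter Q Y θ i ξ w k).2 := by
  rw [localNoise, localIter_update _ _ _ _ _ _ _ _ le_rfl, Function.update_self]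

lemma localNoise_condMean (N : NonconvexConcave P Y l σ σG G D Φlow) (Q : Problem d₁ d₂ M Ξ)
    (θ : Params) (i : Fin M) {w : Vec d₁ × Vec d₂} (hw : w.2 ∈ Y) (k : Fin θ.K)
    (ξ : Fin θ.K → Ξ) :
    Integrable (fun t => localNoise P Q Y θ i w k (Function.update ξ k t)) (P.dist i : Measure Ξ) ∧
    ∫ t, localNoise P Q Y θ i w k (Function.update ξ k t) ∂(P.dist i : Measure Ξ) = 0 := by
  have hmem := N.localIter_mem Q θ i ξ hw k
  have hi := N.variance.integrable i (localIter Q Y θ i ξ w k).1 _ hmem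
  simp only [localNoise_update]
  refine ⟨hi.sub (integrable_const _), ?_⟩
  rw [integral_sub hi (integrable_const _), N.variance.unbiased i _ _ hmem]
  simp

/-- Resampling the k-th data point freezes the k-th iterate, so the pointwise variance bound applies
at it. -/
lemma localNoise_memLp (N : NonconvexConcave P Y l σ σG G D Φlow) (hl : 0 ≤ l) (c : ℝ)
    {y₀ : Vec d₂} (hy₀ : y₀ ∈ Y) (θ : Params) (i : Fin M) {w : Vec d₁ × Vec d₂} (hw : w.2 ∈ Y)
    (k : Fin θ.K) :
    MemLp (localNoise P (P.regularize c y₀) Y θ i w k) 2 (clientLaw P i θ.K) ∧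
    ∫ ξ, ‖localNoise P (P.regularize c y₀) Y θ i w k ξ‖ ^ 2 ∂(clientLaw P i θ.K) ≤ σ ^ 2 := by
  have hm := N.measurable_localNoise hl c hy₀ θ i hw k
  refine memLp_two_of_resample hm.aestronglyMeasurable hm.norm k (sq_nonneg σ) (fun ξ => ?_)
    fun ξ => ?_
  · simp only [localNoise_update]
    exact N.variance.sq_integrable i _ _ (N.localIter_mem _ θ i ξ hw k)
  · simp only [localNoise_update]
    exact N.variance.variance_le i _ _ (N.localIter_mem _ θ i ξ hw k)

/-- The total noise of one client is centered, with variance at most `K σ²`. -/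
lemma clientNoise (N : NonconvexConcave P Y l σ σG G D Φlow) (hl : 0 ≤ l) (c : ℝ)
    {y₀ : Vec d₂} (hy₀ : y₀ ∈ Y) (θ : Params) (i : Fin M) {w : Vec d₁ × Vec d₂} (hw : w.2 ∈ Y) :
    MemLp (fun ξ => ∑ k, localNoise P (P.regularize c y₀) Y θ i w k ξ) 2 (clientLaw P i θ.K) ∧
    ∫ ξ, ∑ k, localNoise P (P.regularize c y₀) Y θ i w k ξ ∂(clientLaw P i θ.K) = 0 ∧
    ∫ ξ, ‖∑ k, localNoise P (P.regularize c y₀) Y θ i w k ξ‖ ^ 2 ∂(clientLaw P i θ.K)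
      ≤ θ.K * σ ^ 2 := by
  have hL := fun k => N.localNoise_memLp hl c hy₀ θ i hw k
  have hint : ∀ k, Integrable (localNoise P (P.regularize c y₀) Y θ i w k) (clientLaw P i θ.K) :=
    fun k => (hL k).1.integrable one_le_two
  refine ⟨memLp_finsetSum _ fun k _ => (hL k).1, ?_, ?_⟩
  · rw [integral_finsetSum _ fun k _ => hint k]
    refine Finset.sum_eq_zero fun k _ => ?_
    rw [integral_resample (hint k) k]
    simp [(N.localNoise_condMean (P.regularize c y₀) θ i hw k _).2]
  · rw [integral_norm_sum_sq Finset.univ (fun k => (hL k).1)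
      (fun j k hjk ξ t => ?_) (fun k ξ => (N.localNoise_condMean _ θ i hw k ξ).1)
      (fun k ξ => (N.localNoise_condMean _ θ i hw k ξ).2)]
    · refine (Finset.sum_le_sum fun k _ => (hL k).2).trans ?_
      simp
    · rw [localNoise, localNoise, localIter_update _ _ _ _ _ _ _ _ (by exact hjk.le),
        Function.update_of_ne hjk.ne]

end NonconvexConcave
end LocalUpdates

/-! ### Client drift and decomposition of the gradient error of a round. -/

section RoundErrors

variable {d₁ d₂ M : ℕ} {Ξ : Type*} [MeasurableSpace Ξ] {P : Problem d₁ d₂ M Ξ}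
  {Y : Set (Vec d₂)} {l σ σG G D Φlow : ℝ}

/-- The distance of the local model of client `i` from the global model `w`. -/
def localDrift (Q : Problem d₁ d₂ M Ξ) (Y : Set (Vec d₂)) (θ : Params) (i : Fin M)
    (w : Vec d₁ × Vec d₂) (ξ : Fin θ.K → Ξ) (k : ℕ) : ℝ :=
  ‖(localIter Q Y θ i ξ w k).1 - w.1‖ + ‖(localIter Q Y θ i ξ w k).2 - w.2‖

/-- The error of the averaged stochastic gradients of one round, as an approximation of the
gradient at `w` of the loss minus `c ‖y - y₀‖²`. -/
def roundError (P : Problem d₁ d₂ M Ξ) (Y : Set (Vec d₂)) (θ : Params) (m : ℕ) (c : ℝ)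
    (y₀ : Vec d₂) (r : Round M θ.K Ξ) (w : Vec d₁ × Vec d₂) : WithLp 2 (Vec d₁ × Vec d₂) :=
  WithLp.toLp 2
    ((1 / ((m : ℝ) * θ.K)) • ∑ i ∈ r.1, localSumX (P.regularize c y₀) Y θ i (r.2 i) w
        - gradX P.loss w.1 w.2,
      (1 / ((m : ℝ) * θ.K)) • ∑ i ∈ r.1, localSumY (P.regularize c y₀) Y θ i (r.2 i) w
        - (gradY P.loss w.1 w.2 - (2 * c) • (w.2 - y₀)))

namespace NonconvexConcave

lemma grad_localLoss_sub_le (N : NonconvexConcave P Y l σ σG G D Φlow) (hσG : 0 ≤ σG) (i : Fin M)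
    (x : Vec d₁) {y : Vec d₂} (hy : y ∈ Y) :
    ‖grad (P.localLoss i) x y - grad P.loss x y‖ ≤ σG :=
  le_of_sq_le_sq (N.heterogeneity i x y hy) hσG

/-- The two blocks need different arguments. In x the triangle inequality suffices, at the cost of
the gradient norm at the server's point. In y the gradient norm is not available, but the projection
inequality gives ‖p - v‖² ≤ η⟨h, p - v⟩, whose right side is bounded by `inner_gradY_le`. -/
lemma localDrift_succ_le (N : NonconvexConcave P Y l σ σG G D Φlow) (hl : 0 ≤ l) (hσG : 0 ≤ σG)
    (hG : 0 ≤ G) (hD : 0 < D) {c : ℝ} (hc : 0 ≤ c) {y₀ : Vec d₂} (hy₀ : y₀ ∈ Y) (θ : Params)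
    {η : ℝ} (hη : 0 ≤ η)
    (hηx : θ.ηxl = η) (hηy : θ.ηyl = η) (i : Fin M) {w : Vec d₁ × Vec d₂} (hw : w.2 ∈ Y)
    (ξ : Fin θ.K → Ξ) (k : Fin θ.K) :
    localDrift (P.regularize c y₀) Y θ i w ξ (k + 1)
      ≤ (1 + η * l) * localDrift (P.regularize c y₀) Y θ i w ξ k
        + η * (‖gradX P.loss w.1 w.2‖ + (G + 2 * σG + 2 * c * D)
          + 2 * ‖localNoise P (P.regularize c y₀) Y θ i w k ξ‖) := by
  have hv := N.localIter_mem (P.regularize c y₀) θ i ξ hw k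
  have hstep : localIter (P.regularize c y₀) Y θ i ξ w (k + 1)
      = ((localIter (P.regularize c y₀) Y θ i ξ w k).1 - η • gradX (P.atSample i (ξ k))
          (localIter (P.regularize c y₀) Y θ i ξ w k).1
          (localIter (P.regularize c y₀) Y θ i ξ w k).2,
        proj Y ((localIter (P.regularize c y₀) Y θ i ξ w k).2 + η • (gradY (P.atSample i (ξ k))
          (localIter (P.regularize c y₀) Y θ i ξ w k).1
          (localIter (P.regularize c y₀) Y θ i ξ w k).2
          - (2 * c) • ((localIter (P.regularize c y₀) Y θ i ξ w k).2 - y₀)))) := by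
    rw [localIter]
    simp only [k.2, dif_pos, Problem.gradX_regularize, hηx, hηy,
      N.regular.gradY_regularize c y₀ i _ _ hv]
  rw [localDrift, hstep]
  simp only
  set v := localIter (P.regularize c y₀) Y θ i ξ w k with hv_def
  set n := ‖localNoise P (P.regularize c y₀) Y θ i w k ξ‖ with hn
  have hloc := N.grad_localLoss_sub_le hσG i v.1 hv
  have hnx : ‖gradX (P.atSample i (ξ k)) v.1 v.2 - gradX (P.localLoss i) v.1 v.2‖ ≤ n :=
    withLp_norm_fst_le (localNoise P (P.regularize c y₀) Y θ i w k ξ)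
  have hny : ‖gradY (P.atSample i (ξ k)) v.1 v.2 - gradY (P.localLoss i) v.1 v.2‖ ≤ n :=
    withLp_norm_snd_le (localNoise P (P.regularize c y₀) Y θ i w k ξ)
  have hlx : ‖gradX (P.localLoss i) v.1 v.2 - gradX P.loss v.1 v.2‖ ≤ σG :=
    (withLp_norm_fst_le _).trans hloc
  have hly : ‖gradY (P.localLoss i) v.1 v.2 - gradY P.loss v.1 v.2‖ ≤ σG :=
    (withLp_norm_snd_le _).trans hloc
  have hgx : ‖gradX P.loss v.1 v.2 - gradX P.loss w.1 w.2‖ ≤ l * (‖v.1 - w.1‖ + ‖v.2 - w.2‖) :=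
    (withLp_norm_fst_le _).trans (N.smooth.grad_loss_lipschitz hl v.1 w.1 hv hw)
  have hd : localDrift (P.regularize c y₀) Y θ i w ξ k = ‖v.1 - w.1‖ + ‖v.2 - w.2‖ := rfl
  rw [hd]
  have h1 : ‖gradX (P.atSample i (ξ k)) v.1 v.2‖
      ≤ n + σG + l * (‖v.1 - w.1‖ + ‖v.2 - w.2‖) + ‖gradX P.loss w.1 w.2‖ := by
    have e : gradX (P.atSample i (ξ k)) v.1 v.2
        = (gradX (P.atSample i (ξ k)) v.1 v.2 - gradX (P.localLoss i) v.1 v.2)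
          + (gradX (P.localLoss i) v.1 v.2 - gradX P.loss v.1 v.2)
          + (gradX P.loss v.1 v.2 - gradX P.loss w.1 w.2) + gradX P.loss w.1 w.2 := by abel
    rw [e]
    refine (norm_add_le _ _).trans (add_le_add ((norm_add_le _ _).trans (add_le_add
      ((norm_add_le _ _).trans (add_le_add hnx hlx)) hgx)) le_rfl)
  set h := gradY (P.atSample i (ξ k)) v.1 v.2 - (2 * c) • (v.2 - y₀) with hh
  have hp := proj_spec N.convex N.compact ⟨_, hw⟩ (v.2 + η • h)
  set p := proj Y (v.2 + η • h)
  have h2 : inner ℝ h (p - v.2) ≤ (n + σG + G + 2 * c * D) * ‖p - v.2‖ := by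
    have e : h = (gradY (P.atSample i (ξ k)) v.1 v.2 - gradY (P.localLoss i) v.1 v.2)
        + (gradY (P.localLoss i) v.1 v.2 - gradY P.loss v.1 v.2)
        + (- ((2 * c) • (v.2 - y₀))) + gradY P.loss v.1 v.2 := by rw [hh]; abel
    rw [e, inner_add_left]
    have h3 := N.inner_gradY_le v.1 hv hp.1
    have h4 : ‖(gradY (P.atSample i (ξ k)) v.1 v.2 - gradY (P.localLoss i) v.1 v.2)
        + (gradY (P.localLoss i) v.1 v.2 - gradY P.loss v.1 v.2)
        + (- ((2 * c) • (v.2 - y₀)))‖ ≤ n + σG + 2 * c * D := by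
      refine (norm_add_le _ _).trans (add_le_add ((norm_add_le _ _).trans (add_le_add hny hly)) ?_)
      rw [norm_neg, norm_smul, Real.norm_of_nonneg (by positivity)]
      exact mul_le_mul_of_nonneg_left (N.norm_sub_le hv hy₀) (by positivity)
    have h5 := (real_inner_le_norm _ (p - v.2)).trans
      (mul_le_mul_of_nonneg_right h4 (norm_nonneg (p - v.2)))
    linarith
  have h3 : ‖p - v.2‖ ≤ η * (n + σG + G + 2 * c * D) := by
    have h4 := hp.2 v.2 hv
    have e : v.2 + η • h - p = η • h - (p - v.2) := by abel
    rw [e, ← neg_sub p v.2, inner_neg_right, inner_sub_left, real_inner_smul_left,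
      real_inner_self_eq_norm_sq] at h4
    have h5 := mul_le_mul_of_nonneg_left h2 hη
    by_contra! hlt
    have h6 : 0 ≤ η * (n + σG + G + 2 * c * D) := by positivity
    have h7 : 0 < ‖p - v.2‖ := h6.trans_lt hlt
    nlinarith
  have h4 : ‖v.1 - η • gradX (P.atSample i (ξ k)) v.1 v.2 - w.1‖ ≤ ‖v.1 - w.1‖
      + η * (n + σG + l * (‖v.1 - w.1‖ + ‖v.2 - w.2‖) + ‖gradX P.loss w.1 w.2‖) := by
    rw [sub_right_comm]
    refine (_root_.norm_sub_le _ _).trans ?_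
    rw [norm_smul, Real.norm_of_nonneg hη]
    gcongr
  have h5 : ‖p - w.2‖ ≤ ‖p - v.2‖ + ‖v.2 - w.2‖ := norm_sub_le_norm_sub_add_norm_sub _ _ _
  linarith

lemma localDrift_le (N : NonconvexConcave P Y l σ σG G D Φlow) (hl : 0 ≤ l) (hσG : 0 ≤ σG)
    (hG : 0 ≤ G) (hD : 0 < D) {c : ℝ} (hc : 0 ≤ c) {y₀ : Vec d₂} (hy₀ : y₀ ∈ Y) (θ : Params)
    {η : ℝ} (hη : 0 ≤ η) (hηx : θ.ηxl = η) (hηy : θ.ηyl = η) (hηK : η * l * θ.K ≤ 1)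
    (i : Fin M) {w : Vec d₁ × Vec d₂} (hw : w.2 ∈ Y) (ξ : Fin θ.K → Ξ) (k : Fin θ.K) :
    localDrift (P.regularize c y₀) Y θ i w ξ k
      ≤ 3 * η * ∑ j, (‖gradX P.loss w.1 w.2‖ + (G + 2 * σG + 2 * c * D)
          + 2 * ‖localNoise P (P.regularize c y₀) Y θ i w j ξ‖) := by
  set A : Fin θ.K → ℝ := fun j => ‖gradX P.loss w.1 w.2‖ + (G + 2 * σG + 2 * c * D)
          + 2 * ‖localNoise P (P.regularize c y₀) Y θ i w j ξ‖ with hA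
  have hA0 : ∀ j, 0 ≤ A j := fun j => by positivity
  have hηl : 0 ≤ η * l := mul_nonneg hη hl
  -- The increments are extended by zero beyond the last local update, since the recursion is
  -- indexed by ℕ.
  have h1 := le_pow_mul_sum_of_le (d := localDrift (P.regularize c y₀) Y θ i w ξ)
    (a := fun j => if h : j < θ.K then η * A ⟨j, h⟩ else 0) (q := η * l) (K := θ.K)
    hηl (fun j => by
      split_ifs
      · exact mul_nonneg hη (hA0 _)
      · exact le_rfl) (by simp [localDrift, localIter]) (fun j hj => by
      simp only [hj, dif_pos]
      exact N.localDrift_succ_le hl hσG hG hD hc hy₀ θ hη hηx hηy i hw ξ ⟨j, hj⟩) k.2.le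
  refine h1.trans ?_
  -- Since ηlK ≤ 1, the Grönwall factor is at most e.
  have h2 : (1 + η * l) ^ (k : ℕ) ≤ 3 := by
    calc (1 + η * l) ^ (k : ℕ) ≤ (1 + η * l) ^ θ.K :=
          pow_le_pow_right₀ (by linarith) k.2.le
      _ ≤ (Real.exp (η * l)) ^ θ.K :=
          pow_le_pow_left₀ (by linarith) (by linarith [Real.add_one_le_exp (η * l)]) _
      _ = Real.exp (θ.K * (η * l)) := (Real.exp_nat_mul _ _).symm
      _ ≤ Real.exp 1 := Real.exp_le_exp.2 (by linarith)
      _ ≤ 3 := by linarith [Real.exp_one_lt_d9]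
  have h3 : ∑ j ∈ Finset.range k, (if h : j < θ.K then η * A ⟨j, h⟩ else 0) ≤ η * ∑ j, A j := by
    calc _ ≤ ∑ j ∈ Finset.range θ.K, (if h : j < θ.K then η * A ⟨j, h⟩ else 0) := by
          refine Finset.sum_le_sum_of_subset_of_nonneg
            (Finset.range_subset_range.2 k.2.le) fun j _ _ => ?_
          split_ifs
          · exact mul_nonneg hη (hA0 _)
          · exact le_rfl
      _ = _ := by
          rw [Finset.sum_range, Finset.mul_sum]
          refine Finset.sum_congr rfl fun j _ => ?_
          simp
  have h4 : 0 ≤ η * ∑ j, A j := mul_nonneg hη (Finset.sum_nonneg fun j _ => hA0 j)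
  calc _ ≤ (1 + η * l) ^ (k : ℕ) * (η * ∑ j, A j) := by gcongr
    _ ≤ 3 * (η * ∑ j, A j) := by gcongr
    _ = _ := by ring

/-- The place where full participation or homogeneity acts: no error from client sampling remains at
the server's point. -/
lemma average_grad_localLoss (N : NonconvexConcave P Y l σ σG G D Φlow) {m : ℕ} (hm : 1 ≤ m)
    (hmM : m = M ∨ σG = 0) {S : Finset (Fin M)} (hS : S.card = m) (x : Vec d₁) {y : Vec d₂}
    (hy : y ∈ Y) : (1 / (m : ℝ)) • ∑ i ∈ S, grad (P.localLoss i) x y = grad P.loss x y := by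
  have hm0 : (m : ℝ) ≠ 0 := by positivity
  rcases hmM with h | h
  · have : S = Finset.univ := by
      rw [← Finset.card_eq_iff_eq_univ, hS, h, Fintype.card_fin]
    rw [this, N.smooth.grad_loss x hy, h]
  · have : ∀ i ∈ S, grad (P.localLoss i) x y = grad P.loss x y := fun i _ => by
      have := N.grad_localLoss_sub_le h.ge i x hy
      rw [h] at this
      exact sub_eq_zero.1 (norm_le_zero_iff.1 this)
    rw [Finset.sum_congr rfl this, Finset.sum_const, hS, ← Nat.cast_smul_eq_nsmul ℝ, smul_smul,
      one_div_mul_cancel hm0, one_smul]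

/-- Each sample gradient is noise, plus the change of the regularized local gradient from the
server's point, plus its value there. The last part averages exactly to the target. The factor 2l is
l from the local loss plus 2c ≤ l from the regularizer. -/
lemma norm_roundError_le (N : NonconvexConcave P Y l σ σG G D Φlow) (hl : 0 ≤ l) {m : ℕ}
    (hm : 1 ≤ m) (hmM : m = M ∨ σG = 0) {c : ℝ} (hc : 0 ≤ c) (hcl : 2 * c ≤ l) (y₀ : Vec d₂)
    (θ : Params) (hK : 1 ≤ θ.K) {r : Round M θ.K Ξ}
    (hr : r.1.card = m) {w : Vec d₁ × Vec d₂} (hw : w.2 ∈ Y) {W : Fin M → ℝ}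
    (hW : ∀ i, ∀ k : Fin θ.K, localDrift (P.regularize c y₀) Y θ i w (r.2 i) k ≤ W i) :
    ‖roundError P Y θ m c y₀ r w‖ ≤ 1 / ((m : ℝ) * θ.K)
        * ‖∑ i ∈ r.1, ∑ k, localNoise P (P.regularize c y₀) Y θ i w k (r.2 i)‖
      + 2 * l / m * ∑ i ∈ r.1, W i := by
  have hm0 : (0 : ℝ) < m := by exact_mod_cast hm
  have hK0 : (0 : ℝ) < θ.K := by exact_mod_cast hK
  set v : Fin M → Fin θ.K → Vec d₁ × Vec d₂ :=
    fun i k => localIter (P.regularize c y₀) Y θ i (r.2 i) w k with hv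
  have hvY : ∀ i k, (v i k).2 ∈ Y := fun i k => N.localIter_mem _ θ i _ hw k
  set R : Fin M → Fin θ.K → WithLp 2 (Vec d₁ × Vec d₂) := fun i k =>
    (grad (P.localLoss i) (v i k).1 (v i k).2 - grad (P.localLoss i) w.1 w.2)
      - WithLp.toLp 2 (0, (2 * c) • ((v i k).2 - w.2)) with hR
  have e1 : ∀ i, WithLp.toLp 2 (localSumX (P.regularize c y₀) Y θ i (r.2 i) w,
      localSumY (P.regularize c y₀) Y θ i (r.2 i) w)
      = ∑ k, (localNoise P (P.regularize c y₀) Y θ i w k (r.2 i) + R i k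
        + (grad (P.localLoss i) w.1 w.2 - WithLp.toLp 2 (0, (2 * c) • (w.2 - y₀)))) := by
    intro i
    have e : ∀ k, localNoise P (P.regularize c y₀) Y θ i w k (r.2 i) + R i k
        + (grad (P.localLoss i) w.1 w.2 - WithLp.toLp 2 (0, (2 * c) • (w.2 - y₀)))
        = WithLp.toLp 2 (gradX ((P.regularize c y₀).atSample i (r.2 i k)) (v i k).1 (v i k).2,
          gradY ((P.regularize c y₀).atSample i (r.2 i k)) (v i k).1 (v i k).2) := by
      intro k
      rw [Problem.gradX_regularize, N.regular.gradY_regularize c y₀ i _ _ (hvY i k)]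
      have e2 : (2 * c) • ((v i k).2 - y₀) = (2 * c) • ((v i k).2 - w.2) + (2 * c) • (w.2 - y₀) := by
        rw [← smul_add, sub_add_sub_cancel]
      rw [e2]
      refine WithLp.ofLp_injective 2 (Prod.ext ?_ ?_)
      · simp only [localNoise, hR, grad, hv, WithLp.ofLp_add, WithLp.ofLp_sub, Prod.fst_add,
          Prod.fst_sub]
        abel
      · simp only [localNoise, hR, grad, hv, WithLp.ofLp_add, WithLp.ofLp_sub, Prod.snd_add,
          Prod.snd_sub]
        abel
    rw [Finset.sum_congr rfl fun k _ => e k, ← WithLp.toLp_sum]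
    congr 1
    ext1
    · simp [Prod.fst_sum, localSumX, hv]
    · simp [Prod.snd_sum, localSumY, hv]
  have e2 : roundError P Y θ m c y₀ r w
      = (1 / ((m : ℝ) * θ.K)) • ∑ i ∈ r.1, WithLp.toLp 2
          (localSumX (P.regularize c y₀) Y θ i (r.2 i) w,
            localSumY (P.regularize c y₀) Y θ i (r.2 i) w)
        - (grad P.loss w.1 w.2 - WithLp.toLp 2 (0, (2 * c) • (w.2 - y₀))) := by
    rw [roundError, ← WithLp.toLp_sum, ← WithLp.toLp_smul, grad, ← WithLp.toLp_sub,
      ← WithLp.toLp_sub]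
    congr 1
    ext1
    · simp [Prod.fst_sum]
    · simp [Prod.snd_sum]
  have e3 : (1 / ((m : ℝ) * θ.K)) • ∑ i ∈ r.1, ∑ _k : Fin θ.K,
        (grad (P.localLoss i) w.1 w.2 - WithLp.toLp 2 (0, (2 * c) • (w.2 - y₀)))
      = grad P.loss w.1 w.2 - WithLp.toLp 2 (0, (2 * c) • (w.2 - y₀)) := by
    rw [← N.average_grad_localLoss hm hmM hr w.1 hw]
    generalize WithLp.toLp 2 ((0 : Vec d₁), (2 * c) • (w.2 - y₀)) = C
    simp only [Finset.sum_const, Finset.card_univ, Fintype.card_fin, ← Finset.smul_sum,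
      Finset.sum_sub_distrib, hr, ← Nat.cast_smul_eq_nsmul ℝ, smul_smul, smul_sub]
    congr 2
    · field_simp
    · field_simp
      simp
  have e4 : roundError P Y θ m c y₀ r w = (1 / ((m : ℝ) * θ.K)) •
        ∑ i ∈ r.1, ∑ k, localNoise P (P.regularize c y₀) Y θ i w k (r.2 i)
      + (1 / ((m : ℝ) * θ.K)) • ∑ i ∈ r.1, ∑ k, R i k := by
    rw [e2, Finset.sum_congr rfl fun i _ => e1 i]
    simp only [Finset.sum_add_distrib, smul_add]
    rw [e3]
    abel
  have hRle : ∀ i k, ‖R i k‖ ≤ 2 * l * W i := by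
    intro i k
    have h1 := N.smooth.lipschitz i (v i k).1 w.1 _ (hvY i k) _ hw
    have h2 : ‖WithLp.toLp 2 ((0 : Vec d₁), (2 * c) • ((v i k).2 - w.2))‖
        ≤ l * ‖(v i k).2 - w.2‖ := by
      rw [WithLp.norm_toLp_snd, norm_smul, Real.norm_of_nonneg (by positivity)]
      gcongr
    have h3 := hW i k
    rw [localDrift] at h3
    refine (_root_.norm_sub_le _ _).trans ?_
    have h4 : ‖(v i k).1 - w.1‖ + ‖(v i k).2 - w.2‖ ≤ W i := h3
    have h5 := mul_le_mul_of_nonneg_left h4 hl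
    have h6 := mul_nonneg hl (norm_nonneg ((v i k).1 - w.1))
    linarith
  rw [e4]
  refine (norm_add_le _ _).trans ?_
  rw [norm_smul, norm_smul, Real.norm_of_nonneg (by positivity)]
  refine add_le_add le_rfl ?_
  calc 1 / ((m : ℝ) * θ.K) * ‖∑ i ∈ r.1, ∑ k, R i k‖
      ≤ 1 / ((m : ℝ) * θ.K) * ∑ i ∈ r.1, ∑ _k : Fin θ.K, 2 * l * W i := by
        gcongr
        refine (norm_sum_le _ _).trans (Finset.sum_le_sum fun i _ => ?_)
        exact (norm_sum_le _ _).trans (Finset.sum_le_sum fun k _ => hRle i k)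
    _ = _ := by
        simp only [Finset.sum_const, Finset.card_univ, Fintype.card_fin, nsmul_eq_mul,
          ← Finset.mul_sum]
        field_simp

end NonconvexConcave
end RoundErrors

/-! ### Second moment of the gradient error of a round. -/

section RoundMoments

variable {d₁ d₂ M : ℕ} {Ξ : Type*} [MeasurableSpace Ξ] {P : Problem d₁ d₂ M Ξ}
  {Y : Set (Vec d₂)} {l σ σG G D Φlow : ℝ}

lemma integral_eval {ι : Type*} [Fintype ι] {α : ι → Type*} [∀ i, MeasurableSpace (α i)]
    {ν : ∀ i, Measure (α i)} [∀ i, IsProbabilityMeasure (ν i)] {E : Type*} [NormedAddCommGroup E]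
    [NormedSpace ℝ E] (i : ι) {F : α i → E} (hF : AEStronglyMeasurable F (ν i)) :
    ∫ ω, F (ω i) ∂(Measure.pi ν) = ∫ t, F t ∂(ν i) := by
  have h := measurePreserving_eval ν i
  conv_rhs => rw [← h.map_eq]
  exact (integral_map (φ := Function.eval i) h.measurable.aemeasurable
    (by rw [h.map_eq]; exact hF)).symm

namespace NonconvexConcave

/-- Clients are independent and centered, so second moments add across them too. After division by
(mK)² this is the linear speedup σ²/(mK). -/
lemma totalNoise (N : NonconvexConcave P Y l σ σG G D Φlow) (hl : 0 ≤ l) (c : ℝ)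
    {y₀ : Vec d₂} (hy₀ : y₀ ∈ Y) (θ : Params) {w : Vec d₁ × Vec d₂} (hw : w.2 ∈ Y)
    (S : Finset (Fin M)) :
    Integrable (fun ξ : Fin M → Fin θ.K → Ξ =>
      ‖∑ i ∈ S, ∑ k, localNoise P (P.regularize c y₀) Y θ i w k (ξ i)‖ ^ 2)
      (Measure.pi fun i => clientLaw P i θ.K) ∧
    ∫ ξ : Fin M → Fin θ.K → Ξ,
      ‖∑ i ∈ S, ∑ k, localNoise P (P.regularize c y₀) Y θ i w k (ξ i)‖ ^ 2
      ∂(Measure.pi fun i => clientLaw P i θ.K) ≤ S.card * (θ.K * σ ^ 2) := by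
  have hZ := fun i => N.clientNoise hl c hy₀ θ i hw
  set Z : ∀ i : Fin M, (Fin θ.K → Ξ) → WithLp 2 (Vec d₁ × Vec d₂) :=
    fun i ξ => ∑ k, localNoise P (P.regularize c y₀) Y θ i w k ξ with hZdef
  have hL : ∀ i, MemLp (fun ξ : Fin M → Fin θ.K → Ξ => Z i (ξ i)) 2
      (Measure.pi fun i => clientLaw P i θ.K) := fun i =>
    (hZ i).1.comp_measurePreserving (measurePreserving_eval (fun i => clientLaw P i θ.K) i)
  constructor
  · have h1 := memLp_finsetSum S fun i _ => hL i
    exact (memLp_two_iff_integrable_sq_norm h1.1).1 h1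
  · have h1 := integral_norm_sum_sq (ν := fun i => clientLaw P i θ.K) S hL
      (fun i j hij ω t => by rw [Function.update_of_ne hij.ne])
      (fun j ω => by
        simp only [Function.update_self]
        exact (hZ j).1.integrable one_le_two)
      (fun j ω => by
        simp only [Function.update_self]
        exact (hZ j).2.1)
    rw [h1]
    calc _ ≤ ∑ _i ∈ S, (θ.K * σ ^ 2) := by
          refine Finset.sum_le_sum fun i _ => ?_
          rw [integral_eval (ν := fun i => clientLaw P i θ.K) i (F := fun ξ => ‖Z i ξ‖ ^ 2)
            ((memLp_two_iff_integrable_sq_norm (hZ i).1.1).1 (hZ i).1).1]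
          exact (hZ i).2.2
      _ = _ := by simp

/-- The second moment of the gradient error of one round with a fixed set of clients. -/
lemma lintegral_roundError_sq_le_of_card (N : NonconvexConcave P Y l σ σG G D Φlow) (hl : 0 ≤ l)
    (hσG : 0 ≤ σG) (hG : 0 ≤ G) (hD : 0 < D) {c : ℝ} (hc : 0 ≤ c) (hcl : 2 * c ≤ l) {y₀ : Vec d₂}
    (hy₀ : y₀ ∈ Y) {m : ℕ} (hm : 1 ≤ m) (hmM : m = M ∨ σG = 0) (θ : Params) (hK : 1 ≤ θ.K)
    {η : ℝ} (hη : 0 ≤ η) (hηx : θ.ηxl = η) (hηy : θ.ηyl = η) (hηK : η * l * θ.K ≤ 1)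
    {w : Vec d₁ × Vec d₂} (hw : w.2 ∈ Y) {S : Finset (Fin M)} (hS : S.card = m) :
    ∫⁻ ξ : Fin M → Fin θ.K → Ξ, ENNReal.ofReal (‖roundError P Y θ m c y₀ (S, ξ) w‖ ^ 2)
      ∂(Measure.pi fun i => clientLaw P i θ.K)
    ≤ ENNReal.ofReal (2 * σ ^ 2 / (m * θ.K) + 288 * (l * η * θ.K) ^ 2
      * (‖gradX P.loss w.1 w.2‖ ^ 2 + (G + 2 * σG + 2 * c * D) ^ 2 + 2 * σ ^ 2)) := by
  have hm0 : (0 : ℝ) < m := by exact_mod_cast hm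
  have hK0 : (0 : ℝ) < θ.K := by exact_mod_cast hK
  set g := ‖gradX P.loss w.1 w.2‖
  set B := G + 2 * σG + 2 * c * D
  set n : (i : Fin M) → Fin θ.K → (Fin θ.K → Ξ) → WithLp 2 (Vec d₁ × Vec d₂) :=
    fun i k => localNoise P (P.regularize c y₀) Y θ i w k with hn
  set F₁ : (Fin M → Fin θ.K → Ξ) → ℝ := fun ξ => ‖∑ i ∈ S, ∑ k, n i k (ξ i)‖ ^ 2
  set F₂ : (Fin M → Fin θ.K → Ξ) → ℝ :=
    fun ξ => ∑ i ∈ S, ∑ k, (2 * (g + B) ^ 2 + 8 * ‖n i k (ξ i)‖ ^ 2)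
  have hF₁ := N.totalNoise hl c hy₀ θ hw S
  have hn2 : ∀ i k, Integrable (fun ξ : Fin M → Fin θ.K → Ξ => ‖n i k (ξ i)‖ ^ 2)
      (Measure.pi fun i => clientLaw P i θ.K) ∧
      ∫ ξ : Fin M → Fin θ.K → Ξ, ‖n i k (ξ i)‖ ^ 2 ∂(Measure.pi fun i => clientLaw P i θ.K)
        ≤ σ ^ 2 := by
    intro i k
    have h1 := N.localNoise_memLp hl c hy₀ θ i hw k
    have h2 : Integrable (fun ξ => ‖n i k ξ‖ ^ 2) (clientLaw P i θ.K) :=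
      (memLp_two_iff_integrable_sq_norm h1.1.1).1 h1.1
    refine ⟨(measurePreserving_eval (fun i => clientLaw P i θ.K) i).integrable_comp_of_integrable
      h2, ?_⟩
    rw [integral_eval (ν := fun i => clientLaw P i θ.K) i (F := fun ξ => ‖n i k ξ‖ ^ 2) h2.1]
    exact h1.2
  have hterm : ∀ i k, Integrable (fun ξ : Fin M → Fin θ.K → Ξ =>
      2 * (g + B) ^ 2 + 8 * ‖n i k (ξ i)‖ ^ 2) (Measure.pi fun i => clientLaw P i θ.K) :=
    fun i k => (integrable_const _).add ((hn2 i k).1.const_mul 8)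
  have hF₂i : Integrable F₂ (Measure.pi fun i => clientLaw P i θ.K) :=
    integrable_finsetSum _ fun i _ => integrable_finsetSum _ fun k _ => hterm i k
  have hF₂ : ∫ ξ, F₂ ξ ∂(Measure.pi fun i => clientLaw P i θ.K)
      ≤ m * θ.K * (2 * (g + B) ^ 2 + 8 * σ ^ 2) := by
    rw [integral_finsetSum _ fun i _ => integrable_finsetSum _ fun k _ => hterm i k]
    calc _ ≤ ∑ _i ∈ S, ∑ _k : Fin θ.K, (2 * (g + B) ^ 2 + 8 * σ ^ 2) := by
          refine Finset.sum_le_sum fun i _ => ?_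
          rw [integral_finsetSum _ fun k _ => hterm i k]
          refine Finset.sum_le_sum fun k _ => ?_
          rw [integral_add (integrable_const _) ((hn2 i k).1.const_mul 8), integral_const,
            integral_const_mul, probReal_univ, one_smul]
          have := (hn2 i k).2
          linarith
      _ = _ := by simp [hS]; ring
  -- An integrable majorant of the squared error; 72 = 2 · 2² · 3², from splitting the square, the
  -- factor 2l of the drift term and the factor 3η of the drift bound.
  set F : (Fin M → Fin θ.K → Ξ) → ℝ := fun ξ => 2 * (1 / ((m : ℝ) * θ.K)) ^ 2 * F₁ ξ
    + 72 * (l * η) ^ 2 * θ.K / m * F₂ ξ with hF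
  have hFi : Integrable F (Measure.pi fun i => clientLaw P i θ.K) :=
    (hF₁.1.const_mul _).add (hF₂i.const_mul _)
  have hpt : ∀ ξ : Fin M → Fin θ.K → Ξ, ‖roundError P Y θ m c y₀ (S, ξ) w‖ ^ 2 ≤ F ξ := by
    intro ξ
    set W : Fin M → ℝ := fun i => 3 * η * ∑ j, ((g + B) + 2 * ‖n i j (ξ i)‖) with hWdef
    have h1 := N.norm_roundError_le hl hm hmM hc hcl y₀ θ hK (r := (S, ξ)) hS hw (W := W)
      (fun i k => N.localDrift_le hl hσG hG hD hc hy₀ θ hη hηx hηy hηK i hw (ξ i) k)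
    have h2 : (∑ i ∈ S, W i) ^ 2 ≤ m * (9 * η ^ 2 * (θ.K * F₂ ξ)) := by
      calc (∑ i ∈ S, W i) ^ 2 ≤ S.card * ∑ i ∈ S, W i ^ 2 := sq_sum_le_card_mul_sum_sq
        _ ≤ m * ∑ i ∈ S, 9 * η ^ 2 * (θ.K * ∑ k, (2 * (g + B) ^ 2 + 8 * ‖n i k (ξ i)‖ ^ 2)) := by
            rw [hS]
            gcongr with i _
            rw [hWdef]
            simp only
            rw [mul_pow, mul_pow]
            norm_num
            gcongr
            refine sq_sum_le_card_mul_sum_sq.trans ?_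
            simp only [Finset.card_univ, Fintype.card_fin]
            gcongr with k _
            nlinarith [sq_nonneg ((g + B) - 2 * ‖n i k (ξ i)‖)]
        _ = _ := by simp only [F₂, Finset.mul_sum]
    have h3 : ‖roundError P Y θ m c y₀ (S, ξ) w‖ ^ 2
        ≤ 2 * ((1 / ((m : ℝ) * θ.K) * ‖∑ i ∈ S, ∑ k, n i k (ξ i)‖) ^ 2
          + (2 * l / m * ∑ i ∈ S, W i) ^ 2) :=
      (pow_le_pow_left₀ (norm_nonneg _) h1 2).trans add_sq_le
    refine h3.trans ?_
    have h4 : (2 * l / m * ∑ i ∈ S, W i) ^ 2 ≤ (2 * l / m) ^ 2 * (m * (9 * η ^ 2 * (θ.K * F₂ ξ))) := by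
      rw [mul_pow]; gcongr
    have h5 : (2 * l / m) ^ 2 * (m * (9 * η ^ 2 * (θ.K * F₂ ξ)))
        = 36 * (l * η) ^ 2 * θ.K / m * F₂ ξ := by field_simp; ring
    rw [h5] at h4
    have h6 : (1 / ((m : ℝ) * θ.K) * ‖∑ i ∈ S, ∑ k, n i k (ξ i)‖) ^ 2
        = (1 / ((m : ℝ) * θ.K)) ^ 2 * F₁ ξ := mul_pow _ _ _
    rw [h6]
    have h7 : 72 * (l * η) ^ 2 * θ.K / m * F₂ ξ = 2 * (36 * (l * η) ^ 2 * θ.K / m * F₂ ξ) := by ring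
    rw [hF]
    simp only
    linarith
  calc _ ≤ ∫⁻ ξ, ENNReal.ofReal (F ξ) ∂(Measure.pi fun i => clientLaw P i θ.K) :=
        lintegral_mono fun ξ => ENNReal.ofReal_le_ofReal (hpt ξ)
    _ = ENNReal.ofReal (∫ ξ, F ξ ∂(Measure.pi fun i => clientLaw P i θ.K)) :=
        (ofReal_integral_eq_lintegral_ofReal hFi (Filter.Eventually.of_forall fun ξ =>
          (sq_nonneg _).trans (hpt ξ))).symm
    _ ≤ _ := by
        refine ENNReal.ofReal_le_ofReal ?_
        rw [hF, integral_add (hF₁.1.const_mul _) (hF₂i.const_mul _), integral_const_mul,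
          integral_const_mul]
        have h1 := hF₁.2
        rw [hS] at h1
        calc _ ≤ 2 * (1 / ((m : ℝ) * θ.K)) ^ 2 * (m * (θ.K * σ ^ 2))
              + 72 * (l * η) ^ 2 * θ.K / m * (m * θ.K * (2 * (g + B) ^ 2 + 8 * σ ^ 2)) := by
              gcongr
          _ = 2 * σ ^ 2 / (m * θ.K) + 72 * (l * η * θ.K) ^ 2 * (2 * (g + B) ^ 2 + 8 * σ ^ 2) := by
              field_simp
          _ ≤ _ := by
              have h2 : 2 * (g + B) ^ 2 + 8 * σ ^ 2 ≤ 4 * (g ^ 2 + B ^ 2 + 2 * σ ^ 2) := by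
                nlinarith [sq_nonneg (g - B)]
              have h3 := mul_le_mul_of_nonneg_left h2 (sq_nonneg (l * η * θ.K))
              linarith

lemma measurable_localSums (N : NonconvexConcave P Y l σ σG G D Φlow) (c : ℝ)
    {y₀ : Vec d₂} (hy₀ : y₀ ∈ Y) (θ : Params) (i : Fin M) :
    Measurable (fun p : (Vec d₁ × Y) × (Fin θ.K → Ξ) =>
      localSumX (P.regularize c y₀) Y θ i p.2 (p.1.1, p.1.2)) ∧
    Measurable (fun p : (Vec d₁ × Y) × (Fin θ.K → Ξ) =>
      localSumY (P.regularize c y₀) Y θ i p.2 (p.1.1, p.1.2)) := by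
  have h1 : ∀ k : Fin θ.K, Measurable fun p : (Vec d₁ × Y) × (Fin θ.K → Ξ) =>
      ((localPoint N (P.regularize c y₀) θ i k p).1,
        (localPoint N (P.regularize c y₀) θ i k p).2, p.2 k) := fun k =>
    (N.measurable_localPoint c hy₀ θ i k).fst.prodMk
      ((N.measurable_localPoint c hy₀ θ i k).snd.prodMk
        ((measurable_pi_apply k).comp measurable_snd))
  constructor
  · refine Finset.measurable_sum _ fun k _ => ?_
    simp only [Problem.gradX_regularize]
    exact (N.regular.measurable_gradX i).comp (h1 k)
  · refine Finset.measurable_sum _ fun k _ => ?_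
    have e : (fun p : (Vec d₁ × Y) × (Fin θ.K → Ξ) =>
        gradY ((P.regularize c y₀).atSample i (p.2 k))
          (localIter (P.regularize c y₀) Y θ i p.2 (p.1.1, p.1.2) k).1
          (localIter (P.regularize c y₀) Y θ i p.2 (p.1.1, p.1.2) k).2)
        = fun p => gradY (P.atSample i (p.2 k)) (localPoint N (P.regularize c y₀) θ i k p).1
            (localPoint N (P.regularize c y₀) θ i k p).2
          - (2 * c) • (((localPoint N (P.regularize c y₀) θ i k p).2 : Vec d₂) - y₀) := by
      funext p
      rw [N.regular.gradY_regularize c y₀ i _ _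
        (N.localIter_mem _ θ i p.2 (w := (p.1.1, p.1.2)) p.1.2.2 k)]
      rfl
    rw [e]
    have hv : Measurable fun p => ((localPoint N (P.regularize c y₀) θ i k p).2 : Vec d₂) :=
      measurable_subtype_coe.comp (N.measurable_localPoint c hy₀ θ i k).snd
    exact ((N.regular.measurable_gradY i).comp (h1 k)).sub ((hv.sub_const y₀).const_smul (2 * c))

lemma measurable_roundSums (N : NonconvexConcave P Y l σ σG G D Φlow) (c : ℝ)
    {y₀ : Vec d₂} (hy₀ : y₀ ∈ Y) (θ : Params) :
    Measurable (fun p : (Vec d₁ × Y) × Round M θ.K Ξ =>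
      ∑ i ∈ p.2.1, localSumX (P.regularize c y₀) Y θ i (p.2.2 i) (p.1.1, p.1.2)) ∧
    Measurable (fun p : (Vec d₁ × Y) × Round M θ.K Ξ =>
      ∑ i ∈ p.2.1, localSumY (P.regularize c y₀) Y θ i (p.2.2 i) (p.1.1, p.1.2)) := by
  have h1 : ∀ i : Fin M, Measurable fun p : (Vec d₁ × Y) × Round M θ.K Ξ => (p.1, p.2.2 i) :=
    fun i => measurable_fst.prodMk ((measurable_pi_apply i).comp measurable_snd.snd)
  have h2 : ∀ i : Fin M, MeasurableSet {p : (Vec d₁ × Y) × Round M θ.K Ξ | i ∈ p.2.1} := fun i =>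
    measurable_snd.fst (Set.to_countable {S : Finset (Fin M) | i ∈ S}).measurableSet
  constructor
  · have e : (fun p : (Vec d₁ × Y) × Round M θ.K Ξ =>
        ∑ i ∈ p.2.1, localSumX (P.regularize c y₀) Y θ i (p.2.2 i) (p.1.1, p.1.2))
        = fun p => ∑ i, if i ∈ p.2.1 then
          localSumX (P.regularize c y₀) Y θ i (p.2.2 i) (p.1.1, p.1.2) else 0 := by
      funext p
      rw [Finset.sum_ite_mem, Finset.univ_inter]
    rw [e]
    refine Finset.measurable_sum _ fun i _ => ?_
    have h3 : Measurable fun p : (Vec d₁ × Y) × Round M θ.K Ξ =>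
        localSumX (P.regularize c y₀) Y θ i (p.2.2 i) (p.1.1, p.1.2) := by
      have h4 := (N.measurable_localSums c hy₀ θ i).1.comp (h1 i)
      simpa only [Function.comp_def] using h4
    exact Measurable.ite (h2 i) h3 measurable_const
  · have e : (fun p : (Vec d₁ × Y) × Round M θ.K Ξ =>
        ∑ i ∈ p.2.1, localSumY (P.regularize c y₀) Y θ i (p.2.2 i) (p.1.1, p.1.2))
        = fun p => ∑ i, if i ∈ p.2.1 then
          localSumY (P.regularize c y₀) Y θ i (p.2.2 i) (p.1.1, p.1.2) else 0 := by
      funext p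
      rw [Finset.sum_ite_mem, Finset.univ_inter]
    rw [e]
    refine Finset.measurable_sum _ fun i _ => ?_
    have h3 : Measurable fun p : (Vec d₁ × Y) × Round M θ.K Ξ =>
        localSumY (P.regularize c y₀) Y θ i (p.2.2 i) (p.1.1, p.1.2) := by
      have h4 := (N.measurable_localSums c hy₀ θ i).2.comp (h1 i)
      simpa only [Function.comp_def] using h4
    exact Measurable.ite (h2 i) h3 measurable_const

lemma measurable_roundError (N : NonconvexConcave P Y l σ σG G D Φlow) (hl : 0 ≤ l) (c : ℝ)
    {y₀ : Vec d₂} (hy₀ : y₀ ∈ Y) (m : ℕ) (θ : Params) :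
    Measurable (fun p : (Vec d₁ × Y) × Round M θ.K Ξ =>
      roundError P Y θ m c y₀ p.2 (p.1.1, p.1.2)) := by
  have hg : Measurable fun p : (Vec d₁ × Y) × Round M θ.K Ξ => grad P.loss p.1.1 p.1.2 :=
    (N.continuous_grad_loss hl).measurable.comp measurable_fst
  have hg' := (WithLp.measurable_ofLp 2 (Vec d₁ × Vec d₂)).comp hg
  have hv : Measurable fun p : (Vec d₁ × Y) × Round M θ.K Ξ => (p.1.2 : Vec d₂) :=
    measurable_subtype_coe.comp measurable_fst.snd
  refine (WithLp.measurable_toLp 2 (Vec d₁ × Vec d₂)).comp (Measurable.prodMk ?_ ?_)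
  · exact ((N.measurable_roundSums c hy₀ θ).1.const_smul (1 / ((m : ℝ) * θ.K))).sub hg'.fst
  · exact ((N.measurable_roundSums c hy₀ θ).2.const_smul (1 / ((m : ℝ) * θ.K))).sub
      (hg'.snd.sub ((hv.sub_const y₀).const_smul (2 * c)))

/-- The second moment of the gradient error of one round. -/
lemma lintegral_roundError_sq_le (N : NonconvexConcave P Y l σ σG G D Φlow) (hl : 0 ≤ l)
    (hσG : 0 ≤ σG) (hG : 0 ≤ G) (hD : 0 < D) {c : ℝ} (hc : 0 ≤ c) (hcl : 2 * c ≤ l) {y₀ : Vec d₂}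
    (hy₀ : y₀ ∈ Y) {m : ℕ} (hm : 1 ≤ m) (hmM' : m ≤ M) (hmM : m = M ∨ σG = 0) (θ : Params)
    (hK : 1 ≤ θ.K)
    {η : ℝ} (hη : 0 ≤ η) (hηx : θ.ηxl = η) (hηy : θ.ηyl = η) (hηK : η * l * θ.K ≤ 1)
    (x : Vec d₁) (y : Y) :
    ∫⁻ r, ENNReal.ofReal (‖roundError P Y θ m c y₀ r (x, y)‖ ^ 2) ∂(roundLaw P m θ.K)
    ≤ ENNReal.ofReal (2 * σ ^ 2 / (m * θ.K) + 288 * (l * η * θ.K) ^ 2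
      * (‖gradX P.loss x y‖ ^ 2 + (G + 2 * σG + 2 * c * D) ^ 2 + 2 * σ ^ 2)) := by
  have hne : {S : Finset (Fin M) | S.card = m}.Nonempty := by
    obtain ⟨S, _, hS⟩ := Finset.exists_subset_card_eq (s := (Finset.univ : Finset (Fin M)))
      (n := m) (by simpa using hmM')
    exact ⟨S, hS⟩
  have : IsProbabilityMeasure (uniformOn {S : Finset (Fin M) | S.card = m}) :=
    isProbabilityMeasure_uniformOn (Set.toFinite _) hne
  have hmeas : Measurable fun r : Round M θ.K Ξ =>
      ENNReal.ofReal (‖roundError P Y θ m c y₀ r (x, y)‖ ^ 2) :=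
    (((N.measurable_roundError hl c hy₀ m θ).comp
      (measurable_prodMk_left (x := (x, y)))).norm.pow_const 2).ennreal_ofReal
  rw [roundLaw, lintegral_prod _ hmeas.aemeasurable]
  -- The estimate is uniform over sets of size m, so uniformity of the random set is used only
  -- through its support.
  have hae : ∀ᵐ S ∂(uniformOn {S : Finset (Fin M) | S.card = m}), S.card = m :=
    ae_cond_mem (Set.to_countable _).measurableSet
  calc _ ≤ ∫⁻ _, ENNReal.ofReal (2 * σ ^ 2 / (m * θ.K) + 288 * (l * η * θ.K) ^ 2
      * (‖gradX P.loss x y‖ ^ 2 + (G + 2 * σG + 2 * c * D) ^ 2 + 2 * σ ^ 2))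
        ∂(uniformOn {S : Finset (Fin M) | S.card = m}) := by
        refine lintegral_mono_ae ?_
        filter_upwards [hae] with S hS
        exact N.lintegral_roundError_sq_le_of_card hl hσG hG hD hc hcl hy₀ hm hmM θ hK hη hηx hηy
          hηK (w := (x, y)) y.2 hS
    _ = _ := by simp

end NonconvexConcave
end RoundMoments

/-! ### The trajectory as inexact smoothed gradient descent-ascent. -/

/-- Inputs of FESS-GDA for which a round is an inexact step of smoothed gradient descent-ascent
with step sizes `1 / (9 l)` and `1 / (200 l)`. -/
structure Params.Tuned (θ : Params) (l μ η : ℝ) : Prop where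
  one_le_K : 1 ≤ θ.K
  η_nonneg : 0 ≤ η
  ηxl_eq : θ.ηxl = η
  ηyl_eq : θ.ηyl = η
  drift_le : η * l * θ.K ≤ 1
  stepX : θ.ηxg * θ.ηxl * θ.K = 1 / (9 * l)
  stepY : θ.ηyg * θ.ηyl * θ.K = 1 / (200 * l)
  β_eq : θ.β = μ / (100000 * l)
  p_eq : θ.p = 2 * l

section Trajectory

variable {d₁ d₂ M : ℕ} {Ξ : Type*} [MeasurableSpace Ξ] {P : Problem d₁ d₂ M Ξ}
  {Y : Set (Vec d₂)} {l σ σG G D Φlow : ℝ}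

/-- Adaptedness at the level of rounds, from which independence of state and next round follows. -/
lemma fessGDA_congr (Q : Problem d₁ d₂ M Ξ) (Y : Set (Vec d₂)) (θ : Params) (m : ℕ)
    (s₀ : State d₁ d₂) {r r' : ℕ → Round M θ.K Ξ} {t : ℕ} (h : ∀ j < t, r j = r' j) :
    fessGDA Q Y θ m s₀ r t = fessGDA Q Y θ m s₀ r' t := by
  induction t with
  | zero => rfl
  | succ t ih =>
    rw [fessGDA, fessGDA, ih fun j hj => h j (by omega), h t (by omega)]

namespace NonconvexConcave

lemma fessGDA_mem (N : NonconvexConcave P Y l σ σG G D Φlow) (Q : Problem d₁ d₂ M Ξ)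
    (θ : Params) (m : ℕ) {s₀ : State d₁ d₂} (hs : s₀.y ∈ Y) (r : ℕ → Round M θ.K Ξ) (t : ℕ) :
    (fessGDA Q Y θ m s₀ r t).y ∈ Y := by
  cases t with
  | zero => exact hs
  | succ t => exact (proj_spec N.convex N.compact ⟨_, hs⟩ _).1

/-- The state of the server, as a point of `X × Y × X`. -/
def _root_.FedMinimax.statePoint (N : NonconvexConcave P Y l σ σG G D Φlow)
    (Q : Problem d₁ d₂ M Ξ) (θ : Params) (m : ℕ) {s₀ : State d₁ d₂} (hs : s₀.y ∈ Y) (t : ℕ)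
    (r : ℕ → Round M θ.K Ξ) : (Vec d₁ × Y) × Vec d₁ :=
  (((fessGDA Q Y θ m s₀ r t).x, ⟨(fessGDA Q Y θ m s₀ r t).y, N.fessGDA_mem Q θ m hs r t⟩),
    (fessGDA Q Y θ m s₀ r t).z)

lemma measurable_statePoint (N : NonconvexConcave P Y l σ σG G D Φlow) (c : ℝ) {y₀ : Vec d₂}
    (hy₀ : y₀ ∈ Y) (θ : Params) (m : ℕ) {s₀ : State d₁ d₂} (hs : s₀.y ∈ Y) (t : ℕ) :
    Measurable (statePoint N (P.regularize c y₀) θ m hs t) := by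
  induction t with
  | zero =>
    exact (measurable_const : Measurable fun _ : ℕ → Round M θ.K Ξ =>
      (((s₀.x, ⟨s₀.y, hs⟩), s₀.z) : (Vec d₁ × Y) × Vec d₁))
  | succ t ih =>
    have h1 : Measurable fun r : ℕ → Round M θ.K Ξ =>
        ((statePoint N (P.regularize c y₀) θ m hs t r).1, r t) :=
      ih.fst.prodMk (measurable_pi_apply t)
    have hX := (N.measurable_roundSums c hy₀ θ).1.comp h1
    have hY := (N.measurable_roundSums c hy₀ θ).2.comp h1
    have hx : Measurable fun r : ℕ → Round M θ.K Ξ =>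
        (fessGDA (P.regularize c y₀) Y θ m s₀ r (t + 1)).x := by
      have := ih.fst.fst.sub (((hX.const_smul (1 / ((m : ℝ) * θ.K))).add
        ((ih.fst.fst.sub ih.snd).const_smul θ.p)).const_smul (θ.ηxg * θ.ηxl * θ.K))
      exact this
    have hy : Measurable fun r : ℕ → Round M θ.K Ξ =>
        (fessGDA (P.regularize c y₀) Y θ m s₀ r (t + 1)).y := by
      have := (proj_nonexpansive N.convex N.compact ⟨_, hs⟩).continuous.measurable.comp
        ((measurable_subtype_coe.comp ih.fst.snd).add
          ((hY.const_smul (1 / ((m : ℝ) * θ.K))).const_smul (θ.ηyg * θ.ηyl * θ.K)))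
      exact this
    have hz : Measurable fun r : ℕ → Round M θ.K Ξ =>
        (fessGDA (P.regularize c y₀) Y θ m s₀ r (t + 1)).z := by
      have := ih.snd.add ((hx.sub ih.snd).const_smul θ.β)
      exact this
    exact (hx.prodMk (hy.subtype_mk)).prodMk hz

/-- A round of FESS-GDA is an inexact step of smoothed gradient descent-ascent. -/
lemma serverStep_eq {c μ : ℝ} (hμ : μ = 2 * c) {y₀ : Vec d₂} {θ : Params} {η : ℝ}
    (hθ : θ.Tuned l μ η) (m : ℕ) (r : Round M θ.K Ξ) (s : State d₁ d₂) :
    (serverStep (P.regularize c y₀) Y θ m r s).x = s.x - (1 / (9 * l)) •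
      (smoothedGrad (gradX P.loss) l s.z s.y s.x + (roundError P Y θ m c y₀ r (s.x, s.y)).fst) ∧
    (serverStep (P.regularize c y₀) Y θ m r s).y = proj Y (s.y + (1 / (200 * l)) •
      ((gradY P.loss s.x s.y - μ • (s.y - y₀)) + (roundError P Y θ m c y₀ r (s.x, s.y)).snd)) ∧
    (serverStep (P.regularize c y₀) Y θ m r s).z
      = s.z + θ.β • ((serverStep (P.regularize c y₀) Y θ m r s).x - s.z) := by
  have hfst : ∀ (a : Vec d₁) (b : Vec d₂), (WithLp.toLp 2 (a, b)).fst = a := fun _ _ => rfl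
  have hsnd : ∀ (a : Vec d₁) (b : Vec d₂), (WithLp.toLp 2 (a, b)).snd = b := fun _ _ => rfl
  refine ⟨?_, ?_, rfl⟩
  · simp only [serverStep, hθ.stepX, hθ.p_eq, smoothedGrad, roundError, hfst]
    congr 2
    abel
  · simp only [serverStep, hθ.stepY, roundError, hμ, hsnd]
    congr 3
    abel

/-- One round of FESS-GDA decreases the potential by a multiple of the stationarity measures, up
to the squared errors of the gradients. -/
lemma potential_serverStep (N : NonconvexConcave P Y l σ σG G D Φlow) (hl : 0 < l) (hG : 0 ≤ G)
    (hD : 0 < D) {c μ : ℝ} (hμ : μ = 2 * c) (hμ0 : 0 < μ) (hμl : μ ≤ l) {y₀ : Vec d₂}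
    (hy₀ : y₀ ∈ Y) {θ : Params} {η : ℝ} (hθ : θ.Tuned l μ η) (m : ℕ) (r : Round M θ.K Ξ)
    {s : State d₁ d₂} (hs : s.y ∈ Y) :
    potential Y (fun x y => P.loss x y - μ / 2 * ‖y - y₀‖ ^ 2) (gradX P.loss) l
        (serverStep (P.regularize c y₀) Y θ m r s).x (serverStep (P.regularize c y₀) Y θ m r s).y
        (serverStep (P.regularize c y₀) Y θ m r s).z
      + θ.β / (12 * l) * (residX P.loss s.x s.y ^ 2 + residY P.loss Y l s.x s.y ^ 2
        - 2 * (μ * D) ^ 2)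
    ≤ potential Y (fun x y => P.loss x y - μ / 2 * ‖y - y₀‖ ^ 2) (gradX P.loss) l s.x s.y s.z
      + 3 / l * ‖roundError P Y θ m c y₀ r (s.x, s.y)‖ ^ 2 := by
  have h := N.weaklyConvexStronglyConcave hl hG hD hμ0 hμl hy₀
  obtain ⟨e1, e2, e3⟩ := serverStep_eq (P := P) (Y := Y) hμ (y₀ := y₀) hθ m r s
  have hp := fun y => proj_spec N.convex N.compact ⟨_, hy₀⟩ y
  have hβ0 : 0 < θ.β := by rw [hθ.β_eq]; positivity
  -- Taking the perturbation `r` to be the gradient of the regularizer makes `q` the projected step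
  -- of the original loss.
  have h1 := h.potential_stationarity hμl hθ.β_eq hs
    (y' := (serverStep (P.regularize c y₀) Y θ m r s).y)
    (q := proj Y (s.y + (1 / l) • gradY P.loss s.x s.y)) (r := μ • (s.y - y₀))
    (by rw [e2]; exact (hp _).1) (hp _).1 e1 (by rw [e2]; exact (hp _).2)
    (by rw [sub_add_cancel]; exact (hp _).2) e3
  rw [WithLp.prod_norm_sq_eq_of_L2]
  refine le_trans ?_ h1
  have h2 : ‖μ • (s.y - y₀)‖ ^ 2 ≤ (μ * D) ^ 2 := by
    refine pow_le_pow_left₀ (norm_nonneg _) ?_ 2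
    rw [norm_smul, Real.norm_of_nonneg hμ0.le]
    exact mul_le_mul_of_nonneg_left (N.norm_sub_le hs hy₀) hμ0.le
  rw [residX, residY]
  gcongr

/-- The sum of the stationarity measures along a realization of FESS-GDA. -/
lemma sum_stationarity_le (N : NonconvexConcave P Y l σ σG G D Φlow) (hl : 0 < l) (hG : 0 ≤ G)
    (hD : 0 < D) {c μ : ℝ} (hμ : μ = 2 * c) (hμ0 : 0 < μ) (hμl : μ ≤ l) {y₀ : Vec d₂}
    (hy₀ : y₀ ∈ Y) {θ : Params} {η : ℝ} (hθ : θ.Tuned l μ η) (m : ℕ) (x₀ z₀ : Vec d₁)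
    (r : ℕ → Round M θ.K Ξ) (T : ℕ) :
    θ.β / (12 * l) * ∑ t ∈ Finset.range T,
      (residX P.loss (fessGDA (P.regularize c y₀) Y θ m ⟨x₀, y₀, z₀⟩ r t).x
          (fessGDA (P.regularize c y₀) Y θ m ⟨x₀, y₀, z₀⟩ r t).y ^ 2
        + residY P.loss Y l (fessGDA (P.regularize c y₀) Y θ m ⟨x₀, y₀, z₀⟩ r t).x
          (fessGDA (P.regularize c y₀) Y θ m ⟨x₀, y₀, z₀⟩ r t).y ^ 2 - 2 * (μ * D) ^ 2)
    ≤ 2 * (P.primal Y x₀ + l * ‖x₀ - z₀‖ ^ 2 - Φlow) + 3 * G * D + 4 * l * D ^ 2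
      + 3 / l * ∑ t ∈ Finset.range T, ‖roundError P Y θ m c y₀ (r t)
        ((fessGDA (P.regularize c y₀) Y θ m ⟨x₀, y₀, z₀⟩ r t).x,
          (fessGDA (P.regularize c y₀) Y θ m ⟨x₀, y₀, z₀⟩ r t).y)‖ ^ 2 := by
  have h := N.weaklyConvexStronglyConcave hl hG hD hμ0 hμl hy₀
  set s := fessGDA (P.regularize c y₀) Y θ m ⟨x₀, y₀, z₀⟩ r with hs
  have hsY : ∀ t, (s t).y ∈ Y := fun t => N.fessGDA_mem _ θ m (s₀ := ⟨x₀, y₀, z₀⟩) hy₀ r t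
  set V : ℕ → ℝ := fun t => potential Y (fun x y => P.loss x y - μ / 2 * ‖y - y₀‖ ^ 2)
    (gradX P.loss) l (s t).x (s t).y (s t).z with hV
  have hlow : ∀ x, ∃ y ∈ Y, Φlow - μ / 2 * D ^ 2 ≤ P.loss x y - μ / 2 * ‖y - y₀‖ ^ 2 := by
    intro x
    obtain ⟨y, hy, h1⟩ := N.exists_primal_eq hG hD x
    refine ⟨y, hy, ?_⟩
    have := N.norm_sub_le hy hy₀
    gcongr
  have hstep : ∀ t, V (t + 1) + θ.β / (12 * l) * (residX P.loss (s t).x (s t).y ^ 2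
      + residY P.loss Y l (s t).x (s t).y ^ 2 - 2 * (μ * D) ^ 2)
      ≤ V t + 3 / l * ‖roundError P Y θ m c y₀ (r t) ((s t).x, (s t).y)‖ ^ 2 := fun t =>
    N.potential_serverStep hl hG hD hμ hμ0 hμl hy₀ hθ m (r t) (hsY t)
  have hsum : V T + θ.β / (12 * l) * ∑ t ∈ Finset.range T, (residX P.loss (s t).x (s t).y ^ 2
      + residY P.loss Y l (s t).x (s t).y ^ 2 - 2 * (μ * D) ^ 2)
      ≤ V 0 + 3 / l * ∑ t ∈ Finset.range T,
        ‖roundError P Y θ m c y₀ (r t) ((s t).x, (s t).y)‖ ^ 2 := by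
    induction T with
    | zero => simp
    | succ T ih =>
      rw [Finset.sum_range_succ, Finset.sum_range_succ, mul_add, mul_add]
      linarith [hstep T]
  have hVT : Φlow - μ / 2 * D ^ 2 ≤ V T := (h.le_potential hlow _ (hsY T) _).2
  have hV0 := h.potential_le hlow x₀ hy₀ z₀ (U := P.primal Y x₀) (D := D)
    (fun v hv => by
      have h1 := N.loss_le_primal hG x₀ hv
      have h2 : 0 ≤ μ / 2 * ‖v - y₀‖ ^ 2 := by positivity
      linarith)
    (fun v hv => N.norm_sub_le hv hy₀)
  have e0 : V 0 = potential Y (fun x y => P.loss x y - μ / 2 * ‖y - y₀‖ ^ 2)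
    (gradX P.loss) l x₀ y₀ z₀ := rfl
  rw [← e0] at hV0
  have h3 : μ * D ^ 2 ≤ l * D ^ 2 := by gcongr
  have h4 : 3 * (G + μ * D) * D = 3 * G * D + 3 * (μ * D ^ 2) := by ring
  linarith

end NonconvexConcave
end Trajectory

/-! ### Independence and square-integrability along the trajectory. -/

section Expectation

variable {d₁ d₂ M : ℕ} {Ξ : Type*} [MeasurableSpace Ξ] {P : Problem d₁ d₂ M Ξ}
  {Y : Set (Vec d₂)} {l σ σG G D Φlow : ℝ} {Ω : Type*} [MeasurableSpace Ω] {ρ : Measure Ω}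
lemma memLp_fst_toLp {H H' : Type*} [NormedAddCommGroup H]
    [NormedAddCommGroup H'] {e : Ω → WithLp 2 (H × H')} (he : MemLp e 2 ρ) :
    MemLp (fun ω => (e ω).fst) 2 ρ :=
  he.mono ((continuous_fst.comp (WithLp.prod_continuous_ofLp 2 H H')).comp_aestronglyMeasurable
    he.1) (Filter.Eventually.of_forall fun _ => withLp_norm_fst_le _)

namespace NonconvexConcave

lemma aemeasurable_statePoint (N : NonconvexConcave P Y l σ σG G D Φlow) (c : ℝ) {y₀ : Vec d₂}
    (hy₀ : y₀ ∈ Y) (θ : Params) (m : ℕ) {s₀ : State d₁ d₂} (hs : s₀.y ∈ Y)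
    {R : ℕ → Ω → Round M θ.K Ξ} (hR : ∀ t, AEMeasurable (R t) ρ) (t : ℕ) :
    AEMeasurable (fun ω => statePoint N (P.regularize c y₀) θ m hs t fun j => R j ω) ρ :=
  (N.measurable_statePoint c hy₀ θ m hs t).comp_aemeasurable (aemeasurable_pi_lambda _ hR)

lemma measurable_gradX_loss (N : NonconvexConcave P Y l σ σG G D Φlow) (hl : 0 ≤ l) :
    Measurable fun q : Vec d₁ × Y => gradX P.loss q.1 q.2 := by
  have h1 := (WithLp.measurable_ofLp 2 (Vec d₁ × Vec d₂)).comp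
    (N.continuous_grad_loss hl).measurable
  exact h1.fst

end NonconvexConcave

variable [IsProbabilityMeasure ρ]

lemma lintegral_of_indepFun {A B : Type*} [MeasurableSpace A] [MeasurableSpace B] {X : Ω → A}
    {Z : Ω → B} (hX : AEMeasurable X ρ) (hZ : AEMeasurable Z ρ) (h : IndepFun X Z ρ)
    {F : A × B → ENNReal} (hF : Measurable F) :
    ∫⁻ ω, F (X ω, Z ω) ∂ρ = ∫⁻ ω, ∫⁻ b, F (X ω, b) ∂(ρ.map Z) ∂ρ := by
  have := Measure.isProbabilityMeasure_map hZ
  have h1 := (indepFun_iff_map_prod_eq_prod_map_map hX hZ).1 h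
  rw [← lintegral_map' (f := F) hF.aemeasurable (hX.prodMk hZ), h1,
    lintegral_prod _ hF.aemeasurable, lintegral_map' hF.lintegral_prod_right'.aemeasurable hX]

namespace NonconvexConcave

/-- The state at the start of a round is independent of the randomness of the round. -/
lemma indepFun_statePoint (N : NonconvexConcave P Y l σ σG G D Φlow) (c : ℝ) {y₀ : Vec d₂}
    (hy₀ : y₀ ∈ Y) (θ : Params) (m : ℕ) {s₀ : State d₁ d₂} (hs : s₀.y ∈ Y)
    {R : ℕ → Ω → Round M θ.K Ξ} (hR : ∀ t, AEMeasurable (R t) ρ) (hind : iIndepFun R ρ) (t : ℕ) :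
    IndepFun (fun ω => statePoint N (P.regularize c y₀) θ m hs t fun j => R j ω) (R t) ρ := by
  obtain ⟨ω₀⟩ : Nonempty Ω := nonempty_of_isProbabilityMeasure ρ
  have h1 := hind.indepFun_finset₀ (Finset.range t) {t} (by simp) hR
  -- The unused later rounds are filled with an arbitrary constant, so that the state becomes a
  -- function of the first t rounds.
  let ext : (Finset.range t → Round M θ.K Ξ) → ℕ → Round M θ.K Ξ :=
    fun u j => if h : j ∈ Finset.range t then u ⟨j, h⟩ else R 0 ω₀
  have hext : Measurable ext := by
    refine measurable_pi_lambda _ fun j => ?_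
    by_cases h : j ∈ Finset.range t
    · simp only [ext, h, dif_pos]
      exact measurable_pi_apply _
    · simp only [ext, h, dif_neg, not_false_eq_true]
      exact measurable_const
  have h2 := h1.comp ((N.measurable_statePoint c hy₀ θ m hs t).comp hext)
    (measurable_pi_apply (⟨t, Finset.mem_singleton_self t⟩ : ({t} : Finset ℕ)))
  have e : (statePoint N (P.regularize c y₀) θ m hs t ∘ ext) ∘
      (fun ω (i : Finset.range t) => R i ω)
      = fun ω => statePoint N (P.regularize c y₀) θ m hs t fun j => R j ω := by
    funext ω
    have e1 : fessGDA (P.regularize c y₀) Y θ m s₀ (ext fun i => R i ω) t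
        = fessGDA (P.regularize c y₀) Y θ m s₀ (fun j => R j ω) t :=
      fessGDA_congr _ _ _ _ _ fun j hj => by simp [ext, hj]
    simp only [Function.comp_apply, statePoint, e1]
  rw [e] at h2
  exact h2

/-- By independence the state can be frozen while the round is integrated out. The statement is in
`ENNReal` because integrability along the trajectory is not yet known. -/
lemma lintegral_roundError_statePoint (N : NonconvexConcave P Y l σ σG G D Φlow) (hl : 0 ≤ l)
    (hσG : 0 ≤ σG) (hG : 0 ≤ G) (hD : 0 < D) {c μ : ℝ} (hμ : μ = 2 * c) (hμ0 : 0 ≤ μ)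
    (hμl : μ ≤ l) {y₀ : Vec d₂} (hy₀ : y₀ ∈ Y) {m : ℕ} (hm : 1 ≤ m) (hmM' : m ≤ M)
    (hmM : m = M ∨ σG = 0) {θ : Params} {η : ℝ} (hθ : θ.Tuned l μ η) {s₀ : State d₁ d₂}
    (hs : s₀.y ∈ Y) {R : ℕ → Ω → Round M θ.K Ξ} (hR : ∀ t, HasLaw (R t) (roundLaw P m θ.K) ρ)
    (hind : iIndepFun R ρ) (t : ℕ) :
    ∫⁻ ω, ENNReal.ofReal (‖roundError P Y θ m c y₀ (R t ω)
        ((fessGDA (P.regularize c y₀) Y θ m s₀ (fun j => R j ω) t).x,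
          (fessGDA (P.regularize c y₀) Y θ m s₀ (fun j => R j ω) t).y)‖ ^ 2) ∂ρ
    ≤ ∫⁻ ω, ENNReal.ofReal (2 * σ ^ 2 / (m * θ.K) + 288 * (l * η * θ.K) ^ 2
      * (residX P.loss (fessGDA (P.regularize c y₀) Y θ m s₀ (fun j => R j ω) t).x
          (fessGDA (P.regularize c y₀) Y θ m s₀ (fun j => R j ω) t).y ^ 2
        + (G + 2 * σG + μ * D) ^ 2 + 2 * σ ^ 2)) ∂ρ := by
  have hF : Measurable fun p : ((Vec d₁ × Y) × Vec d₁) × Round M θ.K Ξ =>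
      ENNReal.ofReal (‖roundError P Y θ m c y₀ p.2 (p.1.1.1, p.1.1.2)‖ ^ 2) :=
    (((N.measurable_roundError hl c hy₀ m θ).comp
      (measurable_fst.fst.prodMk measurable_snd)).norm.pow_const 2).ennreal_ofReal
  have h1 := lintegral_of_indepFun
    (N.aemeasurable_statePoint c hy₀ θ m hs (fun t => (hR t).aemeasurable) t)
    (hR t).aemeasurable
    (N.indepFun_statePoint c hy₀ θ m hs (fun t => (hR t).aemeasurable) hind t) hF
  simp only [statePoint] at h1
  rw [h1, (hR t).map_eq, hμ]
  refine lintegral_mono fun ω => ?_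
  exact N.lintegral_roundError_sq_le hl hσG hG hD (by linarith) (by linarith) hy₀ hm hmM' hmM θ
    hθ.one_le_K hθ.η_nonneg hθ.ηxl_eq hθ.ηyl_eq hθ.drift_le
    (fessGDA (P.regularize c y₀) Y θ m s₀ (fun j => R j ω) t).x
    ⟨(fessGDA (P.regularize c y₀) Y θ m s₀ (fun j => R j ω) t).y, N.fessGDA_mem _ θ m hs _ t⟩

lemma gradX_loss_norm_le (N : NonconvexConcave P Y l σ σG G D Φlow) (hl : 0 ≤ l) (x x' : Vec d₁)
    {y y' : Vec d₂} (hy : y ∈ Y) (hy' : y' ∈ Y) :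
    ‖gradX P.loss x y‖ ≤ ‖gradX P.loss x' y'‖ + l * (‖x - x'‖ + D) := by
  have h1 : ‖gradX P.loss x y - gradX P.loss x' y'‖ ≤ l * (‖x - x'‖ + ‖y - y'‖) :=
    (withLp_norm_fst_le _).trans (N.smooth.grad_loss_lipschitz hl x x' hy hy')
  have h2 := norm_sub_norm_le (gradX P.loss x y) (gradX P.loss x' y')
  have h3 := mul_le_mul_of_nonneg_left (N.norm_sub_le hy hy') hl
  linarith

/-- The gradient grows at most linearly in x, and Y is bounded. -/
lemma memLp_gradX_loss (N : NonconvexConcave P Y l σ σG G D Φlow) (hl : 0 ≤ l) {x : Ω → Vec d₁}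
    {y : Ω → Vec d₂} (hy : ∀ ω, y ω ∈ Y) (hm : AEMeasurable (fun ω => gradX P.loss (x ω) (y ω)) ρ)
    (hx : MemLp x 2 ρ) : MemLp (fun ω => gradX P.loss (x ω) (y ω)) 2 ρ := by
  obtain ⟨ω₀⟩ : Nonempty Ω := nonempty_of_isProbabilityMeasure ρ
  have hb : MemLp (fun ω => ‖gradX P.loss (x ω₀) (y ω₀)‖ + l * (‖x ω - x ω₀‖ + D)) 2 ρ :=
    (memLp_const ‖gradX P.loss (x ω₀) (y ω₀)‖).add
      ((((hx.sub (memLp_const (x ω₀))).norm).add (memLp_const D)).const_mul l)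
  exact hb.mono' hm.aestronglyMeasurable (Filter.Eventually.of_forall fun ω =>
    N.gradX_loss_norm_le hl _ _ (hy ω) (hy ω₀))

lemma _root_.FedMinimax.memLp_two_of_lintegral_le {H H' : Type*} [NormedAddCommGroup H]
    [NormedAddCommGroup H'] [MeasurableSpace H] [BorelSpace H] [SecondCountableTopology H]
    {e : Ω → H} {g : Ω → H'} (he : AEMeasurable e ρ) (hg : MemLp g 2 ρ) {a b c d : ℝ}
    (ha : 0 ≤ a) (hb : 0 ≤ b) (hc : 0 ≤ c) (hd : 0 ≤ d)
    (h : ∫⁻ ω, ENNReal.ofReal (‖e ω‖ ^ 2) ∂ρ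
      ≤ ∫⁻ ω, ENNReal.ofReal (a + b * (‖g ω‖ ^ 2 + c + d)) ∂ρ) :
    MemLp e 2 ρ ∧ ∫ ω, ‖e ω‖ ^ 2 ∂ρ ≤ a + b * (∫ ω, ‖g ω‖ ^ 2 ∂ρ + c + d) := by
  have hg2 := (memLp_two_iff_integrable_sq_norm hg.1).1 hg
  have hgc : Integrable (fun ω => ‖g ω‖ ^ 2 + c) ρ := hg2.add (integrable_const c)
  have h1 : Integrable (fun ω => ‖g ω‖ ^ 2 + c + d) ρ := hgc.add (integrable_const d)
  have hint : Integrable (fun ω => a + b * (‖g ω‖ ^ 2 + c + d)) ρ :=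
    (integrable_const a).add (h1.const_mul b)
  rw [← ofReal_integral_eq_lintegral_ofReal hint (Filter.Eventually.of_forall fun _ => by
    positivity)] at h
  have hval : ∫ ω, (a + b * (‖g ω‖ ^ 2 + c + d)) ∂ρ = a + b * (∫ ω, ‖g ω‖ ^ 2 ∂ρ + c + d) := by
    rw [integral_add (integrable_const a) (h1.const_mul b), integral_const_mul,
      integral_add hgc (integrable_const d),
      integral_add hg2 (integrable_const c)]
    simp
  rw [hval] at h
  have he2 : Integrable (fun ω => ‖e ω‖ ^ 2) ρ := by
    refine ⟨(he.norm.pow_const 2).aestronglyMeasurable, ?_⟩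
    rw [hasFiniteIntegral_iff_ofReal (Filter.Eventually.of_forall fun _ => by positivity)]
    exact h.trans_lt ENNReal.ofReal_lt_top
  refine ⟨(memLp_two_iff_integrable_sq_norm he.aestronglyMeasurable).2 he2, ?_⟩
  rw [← ofReal_integral_eq_lintegral_ofReal he2 (Filter.Eventually.of_forall fun _ => by
    positivity)] at h
  have : 0 ≤ ∫ ω, ‖g ω‖ ^ 2 ∂ρ := integral_nonneg fun _ => by positivity
  exact (ENNReal.ofReal_le_ofReal_iff (by positivity)).1 h

/-- Along FESS-GDA the states, the gradients and the gradient errors are square-integrable. -/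
lemma fessGDA_memLp (N : NonconvexConcave P Y l σ σG G D Φlow) (hl : 0 ≤ l)
    (hσG : 0 ≤ σG) (hG : 0 ≤ G) (hD : 0 < D) {c μ : ℝ} (hμ : μ = 2 * c) (hμ0 : 0 ≤ μ)
    (hμl : μ ≤ l) {y₀ : Vec d₂} (hy₀ : y₀ ∈ Y) {m : ℕ} (hm : 1 ≤ m) (hmM' : m ≤ M)
    (hmM : m = M ∨ σG = 0) {θ : Params} {η : ℝ} (hθ : θ.Tuned l μ η) {s₀ : State d₁ d₂}
    (hs : s₀.y ∈ Y) {R : ℕ → Ω → Round M θ.K Ξ} (hR : ∀ t, HasLaw (R t) (roundLaw P m θ.K) ρ)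
    (hind : iIndepFun R ρ) {s : ℕ → Ω → State d₁ d₂}
    (hsdef : ∀ t ω, s t ω = fessGDA (P.regularize c y₀) Y θ m s₀ (fun j => R j ω) t) (t : ℕ) :
    (MemLp (fun ω => (s t ω).x) 2 ρ ∧ MemLp (fun ω => (s t ω).z) 2 ρ) ∧
    MemLp (fun ω => gradX P.loss (s t ω).x (s t ω).y) 2 ρ ∧
    MemLp (fun ω => roundError P Y θ m c y₀ (R t ω) ((s t ω).x, (s t ω).y)) 2 ρ ∧
    ∫ ω, ‖roundError P Y θ m c y₀ (R t ω) ((s t ω).x, (s t ω).y)‖ ^ 2 ∂ρ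
      ≤ 2 * σ ^ 2 / (m * θ.K) + 288 * (l * η * θ.K) ^ 2
        * (∫ ω, ‖gradX P.loss (s t ω).x (s t ω).y‖ ^ 2 ∂ρ
          + (G + 2 * σG + μ * D) ^ 2 + 2 * σ ^ 2) := by
  have hmem : ∀ t ω, (s t ω).y ∈ Y := fun t ω => by
    rw [hsdef]; exact N.fessGDA_mem _ θ m hs _ t
  have hmeas : ∀ t, AEMeasurable (fun ω => (((s t ω).x, ⟨(s t ω).y, hmem t ω⟩) : Vec d₁ × Y)) ρ := by
    intro t
    have h1 := (N.aemeasurable_statePoint c hy₀ θ m hs (fun t => (hR t).aemeasurable) t).fst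
    simp only [statePoint, ← hsdef] at h1
    exact h1
  have hle : ∀ t, ∫⁻ ω, ENNReal.ofReal
      (‖roundError P Y θ m c y₀ (R t ω) ((s t ω).x, (s t ω).y)‖ ^ 2) ∂ρ
      ≤ ∫⁻ ω, ENNReal.ofReal (2 * σ ^ 2 / (m * θ.K) + 288 * (l * η * θ.K) ^ 2
        * (‖gradX P.loss (s t ω).x (s t ω).y‖ ^ 2
          + (G + 2 * σG + μ * D) ^ 2 + 2 * σ ^ 2)) ∂ρ := by
    intro t
    have h1 := N.lintegral_roundError_statePoint hl hσG hG hD hμ hμ0 hμl hy₀ hm hmM' hmM hθ hs hR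
      hind t
    simp only [← hsdef] at h1
    exact h1
  have hsucc : ∀ t ω, s (t + 1) ω = serverStep (P.regularize c y₀) Y θ m (R t ω) (s t ω) := by
    intro t ω
    rw [hsdef, hsdef, fessGDA]
  have hzero : MemLp (fun ω => (s 0 ω).x) 2 ρ ∧ MemLp (fun ω => (s 0 ω).z) 2 ρ := by
    simp only [hsdef, fessGDA]
    exact ⟨memLp_const s₀.x, memLp_const s₀.z⟩
  clear hsdef
  have key : ∀ t, MemLp (fun ω => (s t ω).x) 2 ρ →
      MemLp (fun ω => gradX P.loss (s t ω).x (s t ω).y) 2 ρ ∧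
      MemLp (fun ω => roundError P Y θ m c y₀ (R t ω) ((s t ω).x, (s t ω).y)) 2 ρ ∧
      ∫ ω, ‖roundError P Y θ m c y₀ (R t ω) ((s t ω).x, (s t ω).y)‖ ^ 2 ∂ρ
        ≤ 2 * σ ^ 2 / (m * θ.K) + 288 * (l * η * θ.K) ^ 2
          * (∫ ω, ‖gradX P.loss (s t ω).x (s t ω).y‖ ^ 2 ∂ρ
            + (G + 2 * σG + μ * D) ^ 2 + 2 * σ ^ 2) := by
    intro t hx
    have hgm : AEMeasurable (fun ω => gradX P.loss (s t ω).x (s t ω).y) ρ := by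
      have h1 := (N.measurable_gradX_loss hl).comp_aemeasurable (hmeas t)
      simpa only [Function.comp_def] using h1
    have hem : AEMeasurable
        (fun ω => roundError P Y θ m c y₀ (R t ω) ((s t ω).x, (s t ω).y)) ρ := by
      have h1 := (N.measurable_roundError hl c hy₀ m θ).comp_aemeasurable
        ((hmeas t).prodMk (hR t).aemeasurable)
      simpa only [Function.comp_def] using h1
    have hg := N.memLp_gradX_loss hl (hmem t) hgm hx
    exact ⟨hg, memLp_two_of_lintegral_le hem hg (by positivity) (by positivity) (by positivity)
      (by positivity) (hle t)⟩
  -- Square-integrability propagates from the state to its gradient, then to the round error, then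
  -- to the next state.
  have hxz : ∀ t, MemLp (fun ω => (s t ω).x) 2 ρ ∧ MemLp (fun ω => (s t ω).z) 2 ρ := by
    intro t
    induction t with
    | zero => exact hzero
    | succ t ih =>
      obtain ⟨hg, he, -⟩ := key t ih.1
      have hx : MemLp (fun ω => (s (t + 1) ω).x) 2 ρ := by
        have h1 := ih.1.sub (((hg.add ((ih.1.sub ih.2).const_smul (2 * l))).add
          (memLp_fst_toLp he)).const_smul (1 / (9 * l)))
        refine (memLp_congr_ae (Filter.Eventually.of_forall fun ω => ?_)).1 h1
        rw [hsucc, (serverStep_eq (P := P) (Y := Y) hμ (y₀ := y₀) hθ m (R t ω) (s t ω)).1]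
        rfl
      refine ⟨hx, ?_⟩
      have h1 := ih.2.add ((hx.sub ih.2).const_smul θ.β)
      refine (memLp_congr_ae (Filter.Eventually.of_forall fun ω => ?_)).1 h1
      simp only [hsucc]
      rw [(serverStep_eq (P := P) (Y := Y) hμ (y₀ := y₀) hθ m (R t ω) (s t ω)).2.2]
      rfl
  exact ⟨hxz t, key t (hxz t).1⟩

end NonconvexConcave
end Expectation

/-! ### Absorption of errors and convergence with tuned inputs. -/

/-- Absorption of the gradient errors into the stationarity measures. -/
lemma average_le_of_descent {T : ℕ} (hT : 1 ≤ T) {A B E : ℕ → ℝ} {β l C ε v b w : ℝ}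
    (hβ : 0 < β) (hl : 0 < l) (hA : ∀ t, 0 ≤ A t) (hB : ∀ t, 0 ≤ B t)
    (hdescent : β / (12 * l) * (∑ t ∈ Finset.range T, (A t + B t) - T * (ε ^ 2 / 2))
      ≤ C + 3 / l * ∑ t ∈ Finset.range T, E t)
    (hE : ∀ t, E t ≤ v + b * (A t + w)) (h₁ : 12 * l / β * C ≤ T * (ε ^ 2 / 8))
    (h₂ : 36 / β * v ≤ ε ^ 2 / 16) (h₃ : 36 / β * b * w ≤ ε ^ 2 / 16) (h₄ : 36 / β * b ≤ 1 / 4) :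
    1 / (T : ℝ) * ∑ t ∈ Finset.range T, (A t + B t) ≤ ε ^ 2 := by
  have hT0 : (0 : ℝ) < T := by exact_mod_cast hT
  have hsumE : 36 / β * ∑ t ∈ Finset.range T, E t
      ≤ T * (ε ^ 2 / 8) + 1 / 4 * ∑ t ∈ Finset.range T, (A t + B t) := by
    rw [Finset.mul_sum, Finset.mul_sum]
    calc _ ≤ ∑ t ∈ Finset.range T, (ε ^ 2 / 8 + 1 / 4 * (A t + B t)) := by
          refine Finset.sum_le_sum fun t _ => ?_
          have h5 := mul_le_mul_of_nonneg_left (hE t) (by positivity : 0 ≤ 36 / β)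
          have h6 := mul_le_mul_of_nonneg_right h₄ (hA t)
          have h7 := hB t
          have e : 36 / β * (v + b * (A t + w))
            = 36 / β * v + 36 / β * b * w + 36 / β * b * A t := by ring
          rw [e] at h5
          linarith
      _ = _ := by
          rw [Finset.sum_add_distrib, Finset.sum_const, Finset.card_range, nsmul_eq_mul]
  have h5 := mul_le_mul_of_nonneg_left hdescent (by positivity : 0 ≤ 12 * l / β)
  have e1 : 12 * l / β * (β / (12 * l) * (∑ t ∈ Finset.range T, (A t + B t)
      - T * (ε ^ 2 / 2))) = ∑ t ∈ Finset.range T, (A t + B t) - T * (ε ^ 2 / 2) := by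
    field_simp
  have e2 : 12 * l / β * (C + 3 / l * ∑ t ∈ Finset.range T, E t)
      = 12 * l / β * C + 36 / β * ∑ t ∈ Finset.range T, E t := by
    field_simp
    ring
  rw [e1, e2] at h5
  rw [one_div, inv_mul_le_iff₀ hT0]
  linarith

/-- The number q will be lηK, the total local step length in units of 1/l. It can be taken as small
as desired without affecting T or K. -/
lemma exists_small_step {X w ε : ℝ} (hX : 0 ≤ X) (hw : 0 ≤ w) (hε : 0 < ε) :
    ∃ q : ℝ, 0 < q ∧ q ≤ 1 ∧ X * (288 * q ^ 2) ≤ 1 / 4 ∧ X * (288 * q ^ 2) * w ≤ ε ^ 2 / 16 := by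
  set δ := min (1 / 4) (ε ^ 2 / 16)
  have hδ : 0 < δ := lt_min (by norm_num) (by positivity)
  set Z := X * 288 * (1 + w) with hZ
  have hZ0 : 0 ≤ Z := by positivity
  have hden : 0 < 1 + δ + Z := by positivity
  set q := δ / (1 + δ + Z) with hq
  have hq0 : 0 < q := by positivity
  have hq1 : q ≤ 1 := by rw [hq, div_le_one hden]; linarith
  have hqq : q ^ 2 ≤ q := pow_le_of_le_one hq0.le hq1 two_ne_zero
  have hmul : q * (1 + δ + Z) = δ := div_mul_cancel₀ _ hden.ne'
  have hqZ : q ^ 2 * Z ≤ δ := by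
    have h1 : q ^ 2 * Z ≤ q * Z := mul_le_mul_of_nonneg_right hqq hZ0
    have h2 : 0 ≤ q * δ := by positivity
    linarith
  have e : q ^ 2 * Z = X * (288 * q ^ 2) + X * (288 * q ^ 2) * w := by rw [hZ]; ring
  have h1 : 0 ≤ X * (288 * q ^ 2) := by positivity
  have h2 : 0 ≤ X * (288 * q ^ 2) * w := by positivity
  refine ⟨q, hq0, hq1, ?_, ?_⟩
  · exact le_trans (by linarith) (min_le_left (1 / 4) (ε ^ 2 / 16))
  · exact le_trans (by linarith) (min_le_right (1 / 4) (ε ^ 2 / 16))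

section Convergence

variable {d₁ d₂ M : ℕ} {Ξ : Type*} [MeasurableSpace Ξ] {P : Problem d₁ d₂ M Ξ}
  {Y : Set (Vec d₂)} {l σ σG G D Φlow : ℝ} {Ω : Type*} [MeasurableSpace Ω] {ρ : Measure Ω}
  [IsProbabilityMeasure ρ]

namespace NonconvexConcave

/-- Both the projected point and y lie in Y, so the measure is bounded by lD. -/
lemma integrable_residY_sq (N : NonconvexConcave P Y l σ σG G D Φlow) (hl : 0 ≤ l)
    {w : Ω → Vec d₁ × Y} (hw : AEMeasurable w ρ) :
    Integrable (fun ω => residY P.loss Y l (w ω).1 (w ω).2 ^ 2) ρ := by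
  obtain ⟨ω₀⟩ : Nonempty Ω := nonempty_of_isProbabilityMeasure ρ
  have hne : Y.Nonempty := ⟨_, (w ω₀).2.2⟩
  have hg : Measurable fun q : Vec d₁ × Y => gradY P.loss q.1 q.2 :=
    ((WithLp.measurable_ofLp 2 (Vec d₁ × Vec d₂)).comp (N.continuous_grad_loss hl).measurable).snd
  have hv : Measurable fun q : Vec d₁ × Y => (q.2 : Vec d₂) :=
    measurable_subtype_coe.comp measurable_snd
  have hr : Measurable fun q : Vec d₁ × Y => residY P.loss Y l q.1 q.2 ^ 2 := by
    have h1 := (proj_nonexpansive N.convex N.compact hne).continuous.measurable.comp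
      (hv.add (hg.const_smul (1 / l)))
    exact ((h1.sub hv).norm.const_mul l).pow_const 2
  have hm : AEMeasurable (fun ω => residY P.loss Y l (w ω).1 (w ω).2 ^ 2) ρ := by
    have h1 := hr.comp_aemeasurable hw
    simpa only [Function.comp_def] using h1
  refine (integrable_const ((l * D) ^ 2)).mono' hm.aestronglyMeasurable
    (Filter.Eventually.of_forall fun ω => ?_)
  rw [Real.norm_of_nonneg (sq_nonneg _), residY]
  refine pow_le_pow_left₀ (by positivity) ?_ 2
  gcongr
  exact N.norm_sub_le (proj_spec N.convex N.compact hne _).1 (w ω).2.2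

/-- Convergence of FESS-GDA with tuned inputs. -/
lemma findsStationaryPoint (N : NonconvexConcave P Y l σ σG G D Φlow) (hl : 0 < l)
    (hσG : 0 ≤ σG) (hG : 0 ≤ G) (hD : 0 < D) {c μ : ℝ} (hμ : μ = 2 * c) (hμ0 : 0 < μ)
    (hμl : μ ≤ l) {y₀ : Vec d₂} (hy₀ : y₀ ∈ Y) {m : ℕ} (hm : 1 ≤ m) (hmM' : m ≤ M)
    (hmM : m = M ∨ σG = 0) {θ : Params} {η : ℝ} (hθ : θ.Tuned l μ η) (hT : 1 ≤ θ.T)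
    (x₀ z₀ : Vec d₁) {R : ℕ → Ω → Round M θ.K Ξ}
    (hR : ∀ t, HasLaw (R t) (roundLaw P m θ.K) ρ) (hind : iIndepFun R ρ) {ε C : ℝ}
    (hε : μ * D = ε / 2)
    (hC : 2 * (P.primal Y x₀ + l * ‖x₀ - z₀‖ ^ 2 - Φlow) + 3 * G * D + 4 * l * D ^ 2 ≤ C)
    (h₁ : 12 * l / θ.β * C ≤ θ.T * (ε ^ 2 / 8))
    (h₂ : 36 / θ.β * (2 * σ ^ 2 / (m * θ.K)) ≤ ε ^ 2 / 16)
    (h₃ : 36 / θ.β * (288 * (l * η * θ.K) ^ 2) * ((G + 2 * σG + μ * D) ^ 2 + 2 * σ ^ 2)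
      ≤ ε ^ 2 / 16)
    (h₄ : 36 / θ.β * (288 * (l * η * θ.K) ^ 2) ≤ 1 / 4) :
    FindsStationaryPoint ρ P.loss Y l ε θ.T (fun t ω =>
      ((fessGDA (P.regularize c y₀) Y θ m ⟨x₀, y₀, z₀⟩ (fun j => R j ω) t).x,
        (fessGDA (P.regularize c y₀) Y θ m ⟨x₀, y₀, z₀⟩ (fun j => R j ω) t).y)) := by
  have hβ0 : 0 < θ.β := by rw [hθ.β_eq]; positivity
  obtain ⟨s, hs⟩ : ∃ s : ℕ → Ω → State d₁ d₂, ∀ t ω,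
    s t ω = fessGDA (P.regularize c y₀) Y θ m ⟨x₀, y₀, z₀⟩ (fun j => R j ω) t := ⟨_, fun _ _ => rfl⟩
  have hmem : ∀ t ω, (s t ω).y ∈ Y := fun t ω => by
    rw [hs]; exact N.fessGDA_mem _ θ m (s₀ := ⟨x₀, y₀, z₀⟩) hy₀ _ t
  have hmeas : ∀ t, AEMeasurable (fun ω => (((s t ω).x, ⟨(s t ω).y, hmem t ω⟩) : Vec d₁ × Y)) ρ := by
    intro t
    have h1 := (N.aemeasurable_statePoint c hy₀ θ m (s₀ := ⟨x₀, y₀, z₀⟩) hy₀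
      (fun t => (hR t).aemeasurable) t).fst
    simp only [statePoint, ← hs] at h1
    exact h1
  have hL := N.fessGDA_memLp hl.le hσG hG hD hμ hμ0.le hμl hy₀ hm hmM' hmM hθ
    (s₀ := ⟨x₀, y₀, z₀⟩) hy₀ hR hind hs
  have hpath := fun ω => N.sum_stationarity_le hl hG hD hμ hμ0 hμl hy₀ hθ m x₀ z₀
    (fun j => R j ω) θ.T
  simp only [← hs] at hpath ⊢
  clear hs
  have hX : ∀ t, Integrable (fun ω => residX P.loss (s t ω).x (s t ω).y ^ 2) ρ := by
    intro t
    have h := (hL t).2.1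
    simp only [residX]
    exact h.integrable_norm_pow two_ne_zero
  have hY : ∀ t, Integrable (fun ω => residY P.loss Y l (s t ω).x (s t ω).y ^ 2) ρ := by
    intro t
    have h := N.integrable_residY_sq hl.le (hmeas t)
    dsimp only at h
    exact h
  refine ⟨fun t _ => ae_of_all _ (hmem t), fun t _ => hX t, fun t _ => hY t, ?_⟩
  have hE : ∀ t, Integrable
      (fun ω => ‖roundError P Y θ m c y₀ (R t ω) ((s t ω).x, (s t ω).y)‖ ^ 2) ρ := fun t =>
    (hL t).2.2.1.integrable_norm_pow two_ne_zero
  have hEle := fun t => (hL t).2.2.2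
  have hXe : ∀ t, ∫ ω, ‖gradX P.loss (s t ω).x (s t ω).y‖ ^ 2 ∂ρ
    = ∫ ω, residX P.loss (s t ω).x (s t ω).y ^ 2 ∂ρ := fun t => by
    simp only [residX]
  have hXY : ∀ t, Integrable (fun ω => residX P.loss (s t ω).x (s t ω).y ^ 2
      + residY P.loss Y l (s t ω).x (s t ω).y ^ 2) ρ := fun t => (hX t).add (hY t)
  have hterm : ∀ t, Integrable (fun ω => residX P.loss (s t ω).x (s t ω).y ^ 2
      + residY P.loss Y l (s t ω).x (s t ω).y ^ 2 - 2 * (μ * D) ^ 2) ρ := fun t =>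
    (hXY t).sub (integrable_const _)
  have hI1 : Integrable (fun ω => θ.β / (12 * l) * ∑ t ∈ Finset.range θ.T,
      (residX P.loss (s t ω).x (s t ω).y ^ 2 + residY P.loss Y l (s t ω).x (s t ω).y ^ 2
        - 2 * (μ * D) ^ 2)) ρ :=
    (integrable_finsetSum _ fun t _ => hterm t).const_mul _
  have hI2 : Integrable (fun ω => 3 / l * ∑ t ∈ Finset.range θ.T,
      ‖roundError P Y θ m c y₀ (R t ω) ((s t ω).x, (s t ω).y)‖ ^ 2) ρ :=
    (integrable_finsetSum _ fun t _ => hE t).const_mul _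
  have hI3 : Integrable (fun ω => C + 3 / l * ∑ t ∈ Finset.range θ.T,
      ‖roundError P Y θ m c y₀ (R t ω) ((s t ω).x, (s t ω).y)‖ ^ 2) ρ :=
    (integrable_const C).add hI2
  have hint := integral_mono hI1 hI3 fun ω => (hpath ω).trans (add_le_add hC le_rfl)
  have hrhs : ∫ ω, (C + 3 / l * ∑ t ∈ Finset.range θ.T,
      ‖roundError P Y θ m c y₀ (R t ω) ((s t ω).x, (s t ω).y)‖ ^ 2) ∂ρ
      = C + 3 / l * ∑ t ∈ Finset.range θ.T,
        ∫ ω, ‖roundError P Y θ m c y₀ (R t ω) ((s t ω).x, (s t ω).y)‖ ^ 2 ∂ρ := by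
    rw [integral_add (integrable_const C) hI2, integral_const_mul,
      integral_finsetSum _ fun t _ => hE t]
    simp
  rw [hrhs, integral_const_mul, integral_finsetSum _ fun t _ => hterm t] at hint
  -- The regularization bias 2(μD)² is exactly half of the budget ε².
  have hterm' : ∀ t, ∫ ω, (residX P.loss (s t ω).x (s t ω).y ^ 2
      + residY P.loss Y l (s t ω).x (s t ω).y ^ 2 - 2 * (μ * D) ^ 2) ∂ρ
      = (∫ ω, residX P.loss (s t ω).x (s t ω).y ^ 2 ∂ρ
        + ∫ ω, residY P.loss Y l (s t ω).x (s t ω).y ^ 2 ∂ρ) - ε ^ 2 / 2 := by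
    intro t
    rw [integral_sub (hXY t) (integrable_const _), integral_add (hX t) (hY t), hε]
    simp only [integral_const, probReal_univ, one_smul]
    ring
  simp only [hterm', Finset.sum_sub_distrib, Finset.sum_const, Finset.card_range,
    nsmul_eq_mul] at hint
  simp only [hXe] at hEle
  obtain ⟨A, hA⟩ : ∃ A : ℕ → ℝ, ∀ t, ∫ ω, residX P.loss (s t ω).x (s t ω).y ^ 2 ∂ρ = A t :=
    ⟨_, fun _ => rfl⟩
  obtain ⟨B, hB⟩ : ∃ B : ℕ → ℝ, ∀ t, ∫ ω, residY P.loss Y l (s t ω).x (s t ω).y ^ 2 ∂ρ = B t :=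
    ⟨_, fun _ => rfl⟩
  obtain ⟨E, hE'⟩ : ∃ E : ℕ → ℝ, ∀ t,
      ∫ ω, ‖roundError P Y θ m c y₀ (R t ω) ((s t ω).x, (s t ω).y)‖ ^ 2 ∂ρ = E t :=
    ⟨_, fun _ => rfl⟩
  have hA0 : ∀ t, 0 ≤ A t := fun t => hA t ▸ integral_nonneg fun _ => sq_nonneg _
  have hB0 : ∀ t, 0 ≤ B t := fun t => hB t ▸ integral_nonneg fun _ => sq_nonneg _
  simp only [hA, hB, hE'] at hint hEle ⊢
  simp only [add_assoc (A _)] at hEle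
  simp only [Finset.sum_add_distrib] at hint
  rw [← Finset.sum_add_distrib] at hint
  exact average_le_of_descent hT hβ0 hl hA0 hB0 hint hEle h₁ h₂ h₃ h₄

end NonconvexConcave
end Convergence

end FedMinimax

end

/-! ### Choice of constants and parameters. -/

set_option maxHeartbeats 1000000 in
/-- `Δ` bounds the initial gap; `C` depends only on `l, σ, σG, G, D, Δ`, and the inputs of the
algorithm only on these constants and on `ε, M, m`. The number of communication rounds is
`T = O(ε⁻³)`; the number of samples per client is `K T = O(m⁻¹ ε⁻⁶)`, where the maximum with
`ε⁻³` only matters when `m > ε⁻³` (every round uses at least one sample per client). -/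
theorem theorem3 (l σ σG G D Δ : ℝ) (hl : 0 < l) (hσ : 0 ≤ σ) (hσG : 0 ≤ σG) (hG : 0 ≤ G)
    (hD : 0 < D) :
    ∃ C : ℝ, 0 < C ∧
      ∀ ε : ℝ, 0 < ε → ε ≤ 2 * l * D →
      ∀ M m : ℕ, 1 ≤ m → m ≤ M → (m = M ∨ σG = 0) →
      ∃ θ : FedMinimax.Params, θ.Admissible ∧
        (θ.T : ℝ) ≤ C * (1 / ε ^ 3) ∧
        (θ.K : ℝ) * (θ.T : ℝ) ≤ C * max (1 / ((m : ℝ) * ε ^ 6)) (1 / ε ^ 3) ∧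
        ∀ (d₁ d₂ : ℕ) (Ξ : Type*) [MeasurableSpace Ξ] (P : FedMinimax.Problem d₁ d₂ M Ξ)
          (Y : Set (FedMinimax.Vec d₂)) (Φlow : ℝ),
          FedMinimax.NonconvexConcave P Y l σ σG G D Φlow →
        ∀ (x₀ z₀ : FedMinimax.Vec d₁) (y₀ : FedMinimax.Vec d₂), y₀ ∈ Y →
          P.primal Y x₀ + l * ‖x₀ - z₀‖ ^ 2 - Φlow ≤ Δ →
        ∀ (Ω : Type*) [MeasurableSpace Ω] (μ : MeasureTheory.Measure Ω)
          [MeasureTheory.IsProbabilityMeasure μ] (R : ℕ → Ω → FedMinimax.Round M θ.K Ξ),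
          (∀ t, ProbabilityTheory.HasLaw (R t) (FedMinimax.roundLaw P m θ.K) μ) →
          ProbabilityTheory.iIndepFun R μ →
          FedMinimax.FindsStationaryPoint μ P.loss Y l ε θ.T (fun t ω =>
            let s := FedMinimax.fessGDA (P.regularize (ε / (4 * D)) y₀) Y θ m
              ⟨x₀, y₀, z₀⟩ (fun t => R t ω) t
            (s.x, s.y)) := by
  -- The absolute value makes the constant positive for every real Δ, since it is fixed before any
  -- problem is given.
  set C₁ : ℝ := 2 * |Δ| + 3 * G * D + 4 * l * D ^ 2 with hC₁
  have hC₁0 : 0 < C₁ := by positivity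
  -- With β = ε/(200000lD), `A` and `B` are the values for which T ≥ A/ε³ and mK ≥ B/ε³ give the
  -- initial-gap and noise conditions; 19200000 = 8 · 12 · 200000 and 230400000 = 16 · 72 · 200000.
  set A : ℝ := 19200000 * l ^ 2 * D * C₁ with hA
  set B : ℝ := 230400000 * σ ^ 2 * l * D with hB
  have hA0 : 0 < A := by positivity
  have hB0 : 0 ≤ B := by positivity
  -- The rounding of T costs at most 2, which is O(ε⁻³) because ε ≤ 2lD.
  set A' : ℝ := A + 2 * (2 * l * D) ^ 3 with hA'
  have hA'0 : 0 < A' := by positivity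
  refine ⟨A' * (B + 3), by positivity, fun ε hε hεD M m hm hmM' hmM => ?_⟩
  have hm0 : (0 : ℝ) < m := by exact_mod_cast hm
  -- The added 1 keeps K positive when σ = 0.
  set K : ℕ := ⌈B / (m * ε ^ 3)⌉₊ + 1 with hK
  set T : ℕ := ⌈A / ε ^ 3⌉₊ + 1 with hT
  have hK1 : 1 ≤ K := Nat.le_add_left _ _
  have hT1 : 1 ≤ T := Nat.le_add_left _ _
  have hK0 : (0 : ℝ) < K := by rw [hK]; positivity
  have hKge : B / (m * ε ^ 3) ≤ K := by
    rw [hK]; push_cast; linarith [Nat.le_ceil (B / (m * ε ^ 3))]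
  have hKle : (K : ℝ) ≤ B / (m * ε ^ 3) + 2 := by
    rw [hK]; push_cast; linarith [Nat.ceil_lt_add_one (by positivity : 0 ≤ B / (m * ε ^ 3))]
  have hTge : A / ε ^ 3 ≤ T := by
    rw [hT]; push_cast; linarith [Nat.le_ceil (A / ε ^ 3)]
  have hTle : (T : ℝ) ≤ A' / ε ^ 3 := by
    have h1 : (T : ℝ) ≤ A / ε ^ 3 + 2 := by
      rw [hT]; push_cast; linarith [Nat.ceil_lt_add_one (by positivity : 0 ≤ A / ε ^ 3)]
    have h2 : 1 ≤ (2 * l * D) ^ 3 / ε ^ 3 := by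
      rw [one_le_div (by positivity)]
      exact pow_le_pow_left₀ hε.le hεD 3
    rw [hA', add_div, mul_div_assoc 2]
    linarith
  set μ₀ : ℝ := ε / (2 * D) with hμ₀
  have hμ₀0 : 0 < μ₀ := by positivity
  have hμ₀l : μ₀ ≤ l := by rw [hμ₀, div_le_iff₀ (by positivity)]; linarith
  set β : ℝ := μ₀ / (100000 * l) with hβ
  have hβ0 : 0 < β := by positivity
  have hβ1 : β < 1 := by rw [hβ, div_lt_one (by positivity)]; linarith
  have hβe : β = ε / (200000 * l * D) := by rw [hβ, hμ₀]; field_simp; norm_num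
  obtain ⟨q, hq0, hq1, hqX, hqZ⟩ := FedMinimax.exists_small_step (X := 36 / β)
    (w := (G + 2 * σG + μ₀ * D) ^ 2 + 2 * σ ^ 2) (ε := ε) (by positivity) (by positivity) hε
  set η : ℝ := q / (l * K) with hη
  have hη0 : 0 < η := by positivity
  have hηq : l * η * K = q := by rw [hη]; field_simp
  -- The global step sizes undo ηK, so shrinking the local step leaves the server's steps unchanged.
  set θ : FedMinimax.Params :=
    { ηxl := η, ηyl := η, ηxg := 1 / (9 * l * η * K), ηyg := 1 / (200 * l * η * K), β := β,
      p := 2 * l, T := T, K := K } with hθ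
  have htuned : θ.Tuned l μ₀ η :=
    { one_le_K := hK1
      η_nonneg := hη0.le
      ηxl_eq := rfl
      ηyl_eq := rfl
      drift_le := by
        have : η * l * K ≤ 1 := by rw [mul_comm η l, hηq]; exact hq1
        exact this
      stepX := by
        have : 1 / (9 * l * η * K) * η * K = 1 / (9 * l) := by field_simp
        exact this
      stepY := by
        have : 1 / (200 * l * η * K) * η * K = 1 / (200 * l) := by field_simp
        exact this
      β_eq := rfl
      p_eq := rfl }
  have hA'T : (T : ℝ) ≤ A' * (B + 3) * (1 / ε ^ 3) := by
    rw [mul_one_div]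
    refine hTle.trans ?_
    gcongr
    exact le_mul_of_one_le_right hA'0.le (by linarith)
  refine ⟨θ, ⟨hη0, hη0, ?_, ?_, hβ0, hβ1, ?_, ?_, htuned.one_le_K⟩, hA'T, ?_, ?_⟩
  · exact one_div_pos.2 (by positivity)
  · exact one_div_pos.2 (by positivity)
  · exact mul_pos two_pos hl
  · exact hT1
  · change (K : ℝ) * (T : ℝ) ≤ _
    set mx := max (1 / ((m : ℝ) * ε ^ 6)) (1 / ε ^ 3)
    have hm1 : 1 / ((m : ℝ) * ε ^ 6) ≤ mx := le_max_left _ _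
    have hm2 : 1 / ε ^ 3 ≤ mx := le_max_right _ _
    have hmx : 0 ≤ mx := le_trans (by positivity) hm2
    calc (K : ℝ) * T ≤ (B / (m * ε ^ 3) + 2) * (A' / ε ^ 3) := by gcongr
      _ = A' * (B * (1 / ((m : ℝ) * ε ^ 6)) + 2 * (1 / ε ^ 3)) := by field_simp
      _ ≤ A' * (B * mx + 2 * mx) := by gcongr
      _ ≤ A' * (B + 3) * mx := by
        linarith [mul_nonneg hA'0.le hmx, (by ring : A' * (B + 3) * mx
          = A' * (B * mx + 2 * mx) + A' * mx)]
  · intro d₁ d₂ Ξ _ P Y Φlow N x₀ z₀ y₀ hy₀ hΔ Ω _ μ _ R hR hind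
    refine N.findsStationaryPoint hl hσG hG hD (c := ε / (4 * D)) (μ := μ₀)
      (by rw [hμ₀]; field_simp; norm_num) hμ₀0 hμ₀l hy₀ hm hmM' hmM htuned hT1 x₀ z₀ hR
      hind (ε := ε) (C := C₁) (by rw [hμ₀]; field_simp) ?_ ?_ ?_ ?_ ?_
    · have := hΔ.trans (le_abs_self Δ)
      rw [hC₁]
      linarith
    · change 12 * l / β * C₁ ≤ T * (ε ^ 2 / 8)
      calc 12 * l / β * C₁ = A / ε ^ 3 * (ε ^ 2 / 8) := by
            rw [hβe, hA]; field_simp; norm_num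
        _ ≤ _ := by gcongr
    · change 36 / β * (2 * σ ^ 2 / (m * K)) ≤ ε ^ 2 / 16
      have h1 : B ≤ m * K * ε ^ 3 := by
        rw [div_le_iff₀ (by positivity)] at hKge
        linarith
      have e : 36 / β * (2 * σ ^ 2 / (m * K)) = B / (m * K * ε) * (1 / 16) := by
        rw [hβe, hB]; field_simp; ring
      rw [e]
      have h2 : B / (m * K * ε) ≤ ε ^ 2 := by
        rw [div_le_iff₀ (by positivity)]
        linarith
      linarith
    · change 36 / β * (288 * (l * η * K) ^ 2) * ((G + 2 * σG + μ₀ * D) ^ 2 + 2 * σ ^ 2) ≤ _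
      rw [hηq]
      exact hqZ
    · change 36 / β * (288 * (l * η * K) ^ 2) ≤ _
      rw [hηq]
      exact hqX
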